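/- **Theorem 3.14.** Let $n\in\mathbb N$, $n\ge 1$, $n\neq 2$, let $\Omega\subseteq\mathbb R^n$ be nonempty and open, and let $V:\Omega\to\mathbb C$ be Lebesgue measurable with $V\in L^{n/2}(\Omega)+L^\infty(\Omega)$ if $n\ge 3$ and $V\in L^1(\Omega)+L^\infty(\Omega)$ if $n=1$. Put $v=|V|^{1/2}$, with $\operatorname{dom}(v)=\{f\in L^2(\Omega): vf\in L^2(\Omega)\}$, and $\mathfrak q_V(f,g)=(vf,e^{i\arg V}vg)_{L^2(\Omega)}$ for $f,g\in\operatorname{dom}(v)$. *Notation.* Scalar products are linear in the second argument. For a closed subspace $\mathcal W$ of $W^{1,2}(\Omega)$ containing $C_0^\infty(\Omega)$ and a measurable $a:\Omega\to\mathbb C^{n\times n}$ with constants $0<a_1\le a_2<\infty$ such that for a.e. $x\in\Omega$ and all $\xi,\zeta\in\mathbb C^n$ $$a_1\|\xi\|^2\le\operatorname{Re}(\xi,a(x)\xi)_{\mathbb C^n},\qquad |(\zeta,a(x)\xi)_{\mathbb C^n}|\le a_2\|\xi\|\,\|\zeta\|,$$ let $L_{a,\mathcal W}$ be the m-sectorial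 operator in $L^2(\Omega)$ associated with the closed sectorial form $\mathfrak q_{a,\mathcal W}(f,g)=\int_\Omega(\nabla f,a\nabla g)_{\mathbb C^n}\,d^nx$, $f,g\in\mathcal W$, and let $-\Delta_{\mathcal W}=L_{I_n,\mathcal W}$. Write $L_{a,\Omega,D}$, $L_{a,\Omega,N}$, $L_{a,\Omega,\Pi}$ for $\mathcal W=W_0^{1,2}(\Omega)$, $W^{1,2}(\Omega)$, $W^{1,2}_\Pi(\Omega)$, respectively, where $W_0^{1,2}(\Omega)$ is the closure of $C_0^\infty(\Omega)$ in $W^{1,2}(\Omega)$ and, for $\Pi\subseteq\partial\Omega$ relatively open, $W^{1,2}_\Pi(\Omega)$ is the closure in $W^{1,2}(\Omega)$ of $\{f|_\Omega: f\in C_0^\infty(\mathbb R^n\setminus(\partial\Omega\setminus\Pi))\}$; similarly $-\Delta_{\Omega,D}$, $-\Delta_{\Omega,N}$, $-\Delta_{\Omega,\Pi}$. A form $\mathfrak b$ is *infinitesimally form bounded* with respect to the m-sectorial operator associated with a densely defined, closed, sectorial form $\mathfrak t$ if $\operatorname{dom}(\mathfrak t)\subseteq\operatorname{dom}(\mathfrak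 b)$ and for every $\alpha>0$ there is $\beta\ge0$ with $|\mathfrak b(f,f)|\le\alpha|\mathfrak t(f,f)|+\beta\|f\|^2$ for all $f\in\operatorname{dom}(\mathfrak t)$; for $V$ this refers to $\mathfrak b=\mathfrak q_V$. For $\mathcal W$ as above consider the following two assertions. $(\Delta_{\mathcal W})$ $V$ is infinitesimally form bounded with respect to $-\Delta_{\mathcal W}$, $\operatorname{dom}((-\Delta_{\mathcal W})^{1/2})=\mathcal W\subseteq\operatorname{dom}(v)$, and there is a function $\eta:(0,\infty)\to[0,\infty)$ with $$\||V|^{1/2}f\|_{L^2(\Omega)}^2\le\varepsilon\|(-\Delta_{\mathcal W})^{1/2}f\|_{L^2(\Omega)}^2+\eta(\varepsilon)\|f\|_{L^2(\Omega)}^2,\qquad f\in\mathcal W,\ \varepsilon>0.$$ $(L_{\mathcal W})$ For every $a_1>0$ there is a function $\tilde\eta:(0,\infty)\to[0,\infty)$ such that for every $a$ as above with lower ellipticity constant $a_1$ (and any $a_2$), $V$ is infinitesimally form bounded with respect to $L_{a,\mathcal W}$, and $$\||V|^{1/2}f\|_{L^2(\Omega)}^2\le\varepsilon\operatorname{Re}[\mathfrak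 q_{a,\mathcal W}(f,f)]+\tilde\eta(\varepsilon)\|f\|_{L^2(\Omega)}^2,\qquad f\in\mathcal W,\ \varepsilon>0.$$ Then (the functions $\eta,\tilde\eta$ may depend on $n$, $\Omega$, $V$, $\mathcal W$): (i) $(\Delta_{\mathcal W})$ and $(L_{\mathcal W})$ hold for $\mathcal W=W_0^{1,2}(\Omega)$, that is, for $-\Delta_{\Omega,D}$ and $L_{a,\Omega,D}$. (ii) If $n=1$ and $\Omega$ is an open interval (bounded or not), then $(\Delta_{\mathcal W})$ and $(L_{\mathcal W})$ hold for $\mathcal W=W^{1,2}(\Omega)$, that is, for $-\Delta_{\Omega,N}$ and $L_{a,\Omega,N}$. (iii) If $n\ge3$ and $\Omega$ is a strongly Lipschitz domain, then for every relatively open $\Pi\subseteq\partial\Omega$ ($\Pi=\emptyset$ and $\Pi=\partial\Omega$ permitted) $(\Delta_{\mathcal W})$ and $(L_{\mathcal W})$ hold for $\mathcal W=W^{1,2}_\Pi(\Omega)$, that is, for $-\Delta_{\Omega,\Pi}$ and $L_{a,\Omega,\Pi}$. Here a strongly Lipschitz domain is a connected, nonempty open set whose boundary is covered by finitely many open coordinate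 patches, in each of which, after a rotation, $\Omega$ coincides with the region above the graph of a Lipschitz function, and such that at most one of the corresponding parts of $\partial\Omega$ is unbounded. -/

import Mathlib

open MeasureTheory Set
open scoped ENNReal NNReal ContDiff ComplexConjugate InnerProductSpace

noncomputable section

/-! ### Sesquilinear forms and their operators in a complex Hilbert space -/

/-- A sesquilinear form in `H`, conjugate linear in the first and linear in the second argument,
with form domain `dom`. -/
structure SesqForm (H : Type*) [NormedAddCommGroup H] [InnerProductSpace ℂ H] where
  dom : Submodule ℂ H
  form : dom →ₗ⋆[ℂ] dom →ₗ[ℂ] ℂ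

namespace SesqForm

variable {H : Type*} [NormedAddCommGroup H] [InnerProductSpace ℂ H]

/-- The numerical range lies in a sector `{ζ : |arg (ζ - c)| ≤ θ}`, `θ < π / 2` (with `K = tan θ`),
written for vectors that are not normalized. -/
def IsSectorial (t : SesqForm H) : Prop :=
  ∃ c K : ℝ, 0 ≤ K ∧ ∀ u : t.dom, c * ‖u‖ ^ 2 ≤ (t.form u u).re ∧
    |(t.form u u).im| ≤ K * ((t.form u u).re - c * ‖u‖ ^ 2)

/-- Closedness of a sectorial form: if `u_k` in the domain converges to `u` in `H` and
`Re t[u_k - u_l] → 0`, then `u` lies in the domain and `Re t[u_k - u] → 0`. -/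
def IsClosed (t : SesqForm H) : Prop :=
  ∀ (s : ℕ → t.dom) (u : H),
    Filter.Tendsto (fun k => (s k : H)) Filter.atTop (nhds u) →
    Filter.Tendsto (fun p : ℕ × ℕ => (t.form (s p.1 - s p.2) (s p.1 - s p.2)).re)
      Filter.atTop (nhds 0) →
    ∃ hu : u ∈ t.dom,
      Filter.Tendsto (fun k => (t.form (s k - ⟨u, hu⟩) (s k - ⟨u, hu⟩)).re)
        Filter.atTop (nhds 0)

/-- The graph of the operator associated with `t`: the pairs `(v, f)` with `v` in the form domain
and `t(w, v) = (w, f)` for all `w` in the form domain. -/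
def operatorGraph (t : SesqForm H) : Submodule ℂ (H × H) where
  carrier := {p | ∃ hv : p.1 ∈ t.dom, ∀ w : t.dom, t.form w ⟨p.1, hv⟩ = ⟪(w : H), p.2⟫_ℂ}
  add_mem' := by
    rintro ⟨a, b⟩ ⟨c, d⟩ ⟨ha, hb⟩ ⟨hc, hd⟩
    refine ⟨t.dom.add_mem ha hc, fun w => ?_⟩
    have h : (⟨a + c, t.dom.add_mem ha hc⟩ : t.dom) = ⟨a, ha⟩ + ⟨c, hc⟩ := rfl
    change t.form w ⟨a + c, t.dom.add_mem ha hc⟩ = ⟪(w : H), b + d⟫_ℂ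
    rw [h, map_add, inner_add_right, hb w, hd w]
  zero_mem' := by
    refine ⟨t.dom.zero_mem, fun w => ?_⟩
    change t.form w 0 = ⟪(w : H), 0⟫_ℂ
    simp
  smul_mem' := by
    rintro r ⟨a, b⟩ ⟨ha, hb⟩
    refine ⟨t.dom.smul_mem r ha, fun w => ?_⟩
    have h : (⟨r • a, t.dom.smul_mem r ha⟩ : t.dom) = r • ⟨a, ha⟩ := rfl
    change t.form w ⟨r • a, t.dom.smul_mem r ha⟩ = ⟪(w : H), r • b⟫_ℂ
    rw [h, map_smul, inner_smul_right, hb w, smul_eq_mul]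

/-- The operator associated with the (densely defined) form `t`. -/
def operator (t : SesqForm H) : H →ₗ.[ℂ] H := t.operatorGraph.toLinearPMap

/-- `b` is infinitesimally form bounded with respect to the form `t`. -/
def InfBounded (b t : SesqForm H) : Prop :=
  t.dom ≤ b.dom ∧ ∀ α : ℝ, 0 < α → ∃ β : ℝ, 0 ≤ β ∧
    ∀ (u : H) (ht : u ∈ t.dom) (hb : u ∈ b.dom),
      ‖b.form ⟨u, hb⟩ ⟨u, hb⟩‖ ≤ α * ‖t.form ⟨u, ht⟩ ⟨u, ht⟩‖ + β * ‖u‖ ^ 2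

/-- `b` is infinitesimally form bounded with respect to the m-sectorial operator `T`, that is, with
respect to the densely defined, closed, sectorial form `t` whose associated operator is `T`. -/
def InfBoundedWrt (b : SesqForm H) (T : H →ₗ.[ℂ] H) : Prop :=
  ∃ t : SesqForm H, Dense (t.dom : Set H) ∧ t.IsSectorial ∧ t.IsClosed ∧ t.operator = T ∧
    b.InfBounded t

end SesqForm

/-- `S` is a non-negative self-adjoint operator with `S ∘ S = T` (domains included). -/
def IsNonnegSqrt {H : Type*} [NormedAddCommGroup H] [InnerProductSpace ℂ H] [CompleteSpace H]
    (S T : H →ₗ.[ℂ] H) : Prop :=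
  IsSelfAdjoint S ∧ (∀ x : S.domain, 0 ≤ (⟪(x : H), S x⟫_ℂ).re) ∧
    ∀ x y : H, (x, y) ∈ T.graph ↔ ∃ z : H, (x, z) ∈ S.graph ∧ (z, y) ∈ S.graph

open Classical in
/-- The non-negative self-adjoint square root `T^{1/2}` of a non-negative self-adjoint operator `T`
(it exists and is unique; the value is the zero operator on `{0}` if `T` has no such root). -/
def opSqrt {H : Type*} [NormedAddCommGroup H] [InnerProductSpace ℂ H] [CompleteSpace H]
    (T : H →ₗ.[ℂ] H) : H →ₗ.[ℂ] H :=
  if h : ∃ S : H →ₗ.[ℂ] H, IsNonnegSqrt S T then h.choose else ⊥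

/-! ### Sobolev spaces on a set `Ω ⊆ ℝⁿ` -/

/-- `ℝⁿ`. -/
abbrev Rn (n : ℕ) : Type := EuclideanSpace ℝ (Fin n)

/-- `ℂⁿ`. -/
abbrev Cn (n : ℕ) : Type := EuclideanSpace ℂ (Fin n)

/-- Lebesgue measure on `Ω`. -/
abbrev vol {n : ℕ} (Ω : Set (Rn n)) : Measure (Rn n) := volume.restrict Ω

/-- `L²(Ω)`. -/
abbrev L2 {n : ℕ} (Ω : Set (Rn n)) : Type := Lp ℂ 2 (vol Ω)

/-- `L²(Ω)ⁿ`. -/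
abbrev L2vec {n : ℕ} (Ω : Set (Rn n)) : Type := Lp (Cn n) 2 (vol Ω)

lemma integrable_testFun_smul {n : ℕ} {Ω : Set (Rn n)} {F : Type*} [NormedAddCommGroup F]
    [NormedSpace ℝ F] {φ : Rn n → ℝ} (hφ : Continuous φ) (hc : HasCompactSupport φ)
    {f : Rn n → F} (hf : MemLp f 2 (vol Ω)) : Integrable (fun x => φ x • f x) (vol Ω) := by
  have h := (hφ.memLp_of_hasCompactSupport (p := 2) (μ := vol Ω) hc)
  exact memLp_one_iff_integrable.1 (hf.smul (r := 1) h)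

/-- The graph of the weak gradient in `L²(Ω)`: the pairs `(f, g)` such that
`∫_Ω f ∂_j φ = - ∫_Ω g_j φ` for all `j` and all test functions `φ ∈ C_0^∞(Ω)`
(real-valued ones suffice). -/
def weakGradGraph {n : ℕ} (Ω : Set (Rn n)) : Submodule ℂ (L2 Ω × L2vec Ω) where
  carrier := {p | ∀ φ : Rn n → ℝ, ContDiff ℝ ∞ φ → HasCompactSupport φ → tsupport φ ⊆ Ω →
    ∀ j : Fin n,
      ∫ x, (fderiv ℝ φ x (EuclideanSpace.single j 1)) • p.1 x ∂(vol Ω)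
        = - ∫ x, φ x • (p.2 x) j ∂(vol Ω)}
  add_mem' := by
    rintro ⟨f, g⟩ ⟨f', g'⟩ h h' φ hφ hc hs j
    have h1 := h φ hφ hc hs j
    have h2 := h' φ hφ hc hs j
    have hd : Continuous fun x => fderiv ℝ φ x (EuclideanSpace.single j 1) :=
      (hφ.continuous_fderiv (by simp)).clm_apply continuous_const
    have hdc : HasCompactSupport fun x => fderiv ℝ φ x (EuclideanSpace.single j 1) :=
      hc.fderiv_apply (𝕜 := ℝ) _
    have hg : ∀ g : L2vec Ω, MemLp (fun x => (g x) j) 2 (vol Ω) := fun g =>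
      (Lp.memLp g).continuousLinearMap_comp (EuclideanSpace.proj (𝕜 := ℂ) j)
    have e1 : (fun x => (fderiv ℝ φ x (EuclideanSpace.single j 1)) • (f + f') x) =ᵐ[vol Ω]
        fun x => (fderiv ℝ φ x (EuclideanSpace.single j 1)) • f x +
          (fderiv ℝ φ x (EuclideanSpace.single j 1)) • f' x := by
      filter_upwards [Lp.coeFn_add f f'] with x hx
      rw [hx, Pi.add_apply, smul_add]
    have e2 : (fun x => φ x • ((g + g') x) j) =ᵐ[vol Ω]
        fun x => φ x • (g x) j + φ x • (g' x) j := by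
      filter_upwards [Lp.coeFn_add g g'] with x hx
      rw [hx, Pi.add_apply, PiLp.add_apply, smul_add]
    change ∫ x, (fderiv ℝ φ x (EuclideanSpace.single j 1)) • (f + f') x ∂(vol Ω)
        = - ∫ x, φ x • ((g + g') x) j ∂(vol Ω)
    rw [integral_congr_ae e1, integral_congr_ae e2,
      integral_add (integrable_testFun_smul hd hdc (Lp.memLp f))
        (integrable_testFun_smul hd hdc (Lp.memLp f')),
      integral_add (integrable_testFun_smul hφ.continuous hc (hg g))
        (integrable_testFun_smul hφ.continuous hc (hg g')), neg_add]
    exact congrArg₂ (· + ·) h1 h2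
  zero_mem' := by
    intro φ hφ hc hs j
    have e1 : (fun x => (fderiv ℝ φ x (EuclideanSpace.single j 1)) • (0 : L2 Ω) x)
        =ᵐ[vol Ω] fun _ => 0 := by
      filter_upwards [Lp.coeFn_zero ℂ 2 (vol Ω)] with x hx
      rw [hx, Pi.zero_apply, smul_zero]
    have e2 : (fun x => φ x • ((0 : L2vec Ω) x) j) =ᵐ[vol Ω] fun _ => 0 := by
      filter_upwards [Lp.coeFn_zero (Cn n) 2 (vol Ω)] with x hx
      rw [hx, Pi.zero_apply, PiLp.zero_apply, smul_zero]
    change ∫ x, (fderiv ℝ φ x (EuclideanSpace.single j 1)) • (0 : L2 Ω) x ∂(vol Ω)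
        = - ∫ x, φ x • ((0 : L2vec Ω) x) j ∂(vol Ω)
    rw [integral_congr_ae e1, integral_congr_ae e2]
    simp
  smul_mem' := by
    rintro r ⟨f, g⟩ h φ hφ hc hs j
    have h1 := h φ hφ hc hs j
    have e1 : (fun x => (fderiv ℝ φ x (EuclideanSpace.single j 1)) • (r • f) x) =ᵐ[vol Ω]
        fun x => r • ((fderiv ℝ φ x (EuclideanSpace.single j 1)) • f x) := by
      filter_upwards [Lp.coeFn_smul r f] with x hx
      rw [hx, Pi.smul_apply, smul_comm]
    have e2 : (fun x => φ x • ((r • g) x) j) =ᵐ[vol Ω] fun x => r • (φ x • (g x) j) := by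
      filter_upwards [Lp.coeFn_smul r g] with x hx
      rw [hx, Pi.smul_apply, PiLp.smul_apply, smul_comm]
    change ∫ x, (fderiv ℝ φ x (EuclideanSpace.single j 1)) • (r • f) x ∂(vol Ω)
        = - ∫ x, φ x • ((r • g) x) j ∂(vol Ω)
    rw [integral_congr_ae e1, integral_congr_ae e2, integral_smul, integral_smul, ← smul_neg]
    exact congrArg (r • ·) h1

/-- The weak gradient `∇ : W^{1,2}(Ω) → L²(Ω)ⁿ`. -/
def weakGrad {n : ℕ} (Ω : Set (Rn n)) : L2 Ω →ₗ.[ℂ] L2vec Ω := (weakGradGraph Ω).toLinearPMap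

/-- `W^{1,2}(Ω)`, as a subspace of `L²(Ω)`. -/
def W12 {n : ℕ} (Ω : Set (Rn n)) : Submodule ℂ (L2 Ω) := (weakGrad Ω).domain

/-- The restrictions to `Ω` of the functions in `C_0^∞(U)`, where `U ⊆ ℝⁿ`. -/
def testRestrictions {n : ℕ} (Ω U : Set (Rn n)) : Submodule ℂ (L2 Ω) where
  carrier := {f | ∃ φ : Rn n → ℂ, ContDiff ℝ ∞ φ ∧ HasCompactSupport φ ∧ tsupport φ ⊆ U ∧
    f =ᵐ[vol Ω] φ}
  add_mem' := by
    rintro f f' ⟨φ, h1, h2, h3, h4⟩ ⟨φ', h1', h2', h3', h4'⟩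
    refine ⟨φ + φ', h1.add h1', h2.add h2', ?_, ?_⟩
    · exact (tsupport_add φ φ').trans (union_subset h3 h3')
    · exact (Lp.coeFn_add f f').trans (h4.add h4')
  zero_mem' := ⟨0, contDiff_const, HasCompactSupport.zero, by simp [tsupport],
    Lp.coeFn_zero ℂ 2 (vol Ω)⟩
  smul_mem' := by
    rintro r f ⟨φ, h1, h2, h3, h4⟩
    refine ⟨r • φ, contDiff_const.smul h1, h2.smul_left (f := fun _ => r), ?_, ?_⟩
    · exact (tsupport_smul_subset_right (fun _ => r) φ).trans h3
    · exact (Lp.coeFn_smul r f).trans (h4.const_smul r)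

/-- The closure in `W^{1,2}(Ω)` of (the elements of `W^{1,2}(Ω)` in) `D`: those
`f ∈ W^{1,2}(Ω)` for which `(f, ∇f)` is a limit in `L²(Ω) × L²(Ω)ⁿ` of pairs `(g, ∇g)`, `g ∈ D`. -/
def sobolevClosure {n : ℕ} (Ω : Set (Rn n)) (D : Submodule ℂ (L2 Ω)) : Submodule ℂ (L2 Ω) :=
  ((((weakGrad Ω).graph ⊓ D.prod ⊤).topologicalClosure) ⊓ (weakGrad Ω).graph).map
    (LinearMap.fst ℂ (L2 Ω) (L2vec Ω))

lemma sobolevClosure_le {n : ℕ} (Ω : Set (Rn n)) (D : Submodule ℂ (L2 Ω)) :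
    sobolevClosure Ω D ≤ W12 Ω := by
  rw [W12, ← (weakGrad Ω).graph_map_fst_eq_domain]
  exact Submodule.map_mono inf_le_right

/-- `W_0^{1,2}(Ω)`, the closure of `C_0^∞(Ω)` in `W^{1,2}(Ω)`. -/
def W12zero {n : ℕ} (Ω : Set (Rn n)) : Submodule ℂ (L2 Ω) :=
  sobolevClosure Ω (testRestrictions Ω Ω)

/-- `W_Π^{1,2}(Ω)`, the closure in `W^{1,2}(Ω)` of the restrictions to `Ω` of the functions in
`C_0^∞(ℝⁿ \ (∂Ω \ Π))`. -/
def W12mixed {n : ℕ} (Ω P : Set (Rn n)) : Submodule ℂ (L2 Ω) :=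
  sobolevClosure Ω (testRestrictions Ω (frontier Ω \ P)ᶜ)

/-! ### Divergence form elliptic operators -/

/-- The coefficient matrix `a` is measurable, bounded and uniformly elliptic on `Ω`, with
constants `0 < a₁ ≤ a₂`. -/
structure IsElliptic {n : ℕ} (Ω : Set (Rn n)) (a : Rn n → Matrix (Fin n) (Fin n) ℂ)
    (a₁ a₂ : ℝ) : Prop where
  pos : 0 < a₁
  le : a₁ ≤ a₂
  meas : AEStronglyMeasurable a (vol Ω)
  lower : ∀ᵐ x ∂(vol Ω), ∀ ξ : Cn n,
    a₁ * ‖ξ‖ ^ 2 ≤ (⟪ξ, Matrix.toEuclideanCLM (𝕜 := ℂ) (a x) ξ⟫_ℂ).re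
  upper : ∀ᵐ x ∂(vol Ω), ∀ ξ ζ : Cn n,
    ‖⟪ζ, Matrix.toEuclideanCLM (𝕜 := ℂ) (a x) ξ⟫_ℂ‖ ≤ a₂ * ‖ξ‖ * ‖ζ‖

lemma isElliptic_one {n : ℕ} (Ω : Set (Rn n)) : IsElliptic Ω (fun _ => 1) 1 1 where
  pos := one_pos
  le := le_rfl
  meas := aestronglyMeasurable_const
  lower := Filter.Eventually.of_forall fun x ξ => by
    rw [map_one, one_mul]
    exact (inner_self_eq_norm_sq (𝕜 := ℂ) ξ).ge
  upper := Filter.Eventually.of_forall fun x ξ ζ => by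
    rw [map_one, one_mul, mul_comm]
    exact norm_inner_le_norm ζ ξ

lemma IsElliptic.integrable {n : ℕ} {Ω : Set (Rn n)} {a : Rn n → Matrix (Fin n) (Fin n) ℂ}
    {a₁ a₂ : ℝ} (ha : IsElliptic Ω a a₁ a₂) (F G : L2vec Ω) :
    Integrable (fun x => ⟪F x, Matrix.toEuclideanCLM (𝕜 := ℂ) (a x) (G x)⟫_ℂ) (vol Ω) := by
  have hcont : Continuous fun M : Matrix (Fin n) (Fin n) ℂ =>
      Matrix.toEuclideanCLM (𝕜 := ℂ) (n := Fin n) M :=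
    LinearMap.continuous_of_finiteDimensional
      ((Matrix.toEuclideanCLM (𝕜 := ℂ) (n := Fin n)).toAlgEquiv.toLinearMap)
  have hm : AEStronglyMeasurable
      (fun x => Matrix.toEuclideanCLM (𝕜 := ℂ) (n := Fin n) (a x)) (vol Ω) :=
    hcont.comp_aestronglyMeasurable ha.meas
  have hG := (Lp.memLp G).1
  have hF := (Lp.memLp F).1
  have hdom : Integrable (fun x => a₂ * (‖F x‖ * ‖G x‖)) (vol Ω) :=
    ((Lp.memLp F).norm.integrable_mul (Lp.memLp G).norm).const_mul a₂
  have hA := (isBoundedBilinearMap_apply (𝕜 := ℂ) (E := Cn n)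
    (F := Cn n)).continuous.comp_aestronglyMeasurable (hm.prodMk hG)
  refine hdom.mono' (hF.inner hA) ?_
  filter_upwards [ha.upper] with x hx
  refine (hx (G x) (F x)).trans (le_of_eq ?_)
  ring

/-- The form `q_{a,W}(f, g) = ∫_Ω (∇f, a ∇g)_{ℂⁿ}` with domain `W ⊆ W^{1,2}(Ω)`. -/
def ellipticForm {n : ℕ} (Ω : Set (Rn n)) {a : Rn n → Matrix (Fin n) (Fin n) ℂ} {a₁ a₂ : ℝ}
    (ha : IsElliptic Ω a a₁ a₂) (W : Submodule ℂ (L2 Ω)) (hW : W ≤ W12 Ω) :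
    SesqForm (L2 Ω) where
  dom := W
  form :=
    have grad_add : ∀ f g : W, weakGrad Ω ⟨(f + g : W), hW (f + g).2⟩
        = weakGrad Ω ⟨f, hW f.2⟩ + weakGrad Ω ⟨g, hW g.2⟩ := fun f g =>
      (weakGrad Ω).map_add ⟨f, hW f.2⟩ ⟨g, hW g.2⟩
    have grad_smul : ∀ (c : ℂ) (f : W), weakGrad Ω ⟨(c • f : W), hW (c • f).2⟩
        = c • weakGrad Ω ⟨f, hW f.2⟩ := fun c f =>
      (weakGrad Ω).map_smul c ⟨f, hW f.2⟩
    LinearMap.mk₂'ₛₗ (starRingEnd ℂ) (RingHom.id ℂ)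
      (fun f g : W => ∫ x, ⟪weakGrad Ω ⟨f, hW f.2⟩ x,
        Matrix.toEuclideanCLM (𝕜 := ℂ) (a x) (weakGrad Ω ⟨g, hW g.2⟩ x)⟫_ℂ ∂(vol Ω))
      (fun f f' g => by
        rw [← integral_add (ha.integrable _ _) (ha.integrable _ _), grad_add]
        refine integral_congr_ae ?_
        filter_upwards [Lp.coeFn_add (weakGrad Ω ⟨f, hW f.2⟩) (weakGrad Ω ⟨f', hW f'.2⟩)]
          with x hx
        rw [hx, Pi.add_apply, inner_add_left])
      (fun c f g => by
        rw [smul_eq_mul, ← integral_const_mul, grad_smul]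
        refine integral_congr_ae ?_
        filter_upwards [Lp.coeFn_smul c (weakGrad Ω ⟨f, hW f.2⟩)] with x hx
        rw [hx, Pi.smul_apply, inner_smul_left])
      (fun f g g' => by
        rw [← integral_add (ha.integrable _ _) (ha.integrable _ _), grad_add]
        refine integral_congr_ae ?_
        filter_upwards [Lp.coeFn_add (weakGrad Ω ⟨g, hW g.2⟩) (weakGrad Ω ⟨g', hW g'.2⟩)]
          with x hx
        rw [hx, Pi.add_apply, map_add, inner_add_right])
      (fun c f g => by
        rw [RingHom.id_apply, smul_eq_mul, ← integral_const_mul, grad_smul]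
        refine integral_congr_ae ?_
        filter_upwards [Lp.coeFn_smul c (weakGrad Ω ⟨g, hW g.2⟩)] with x hx
        rw [hx, Pi.smul_apply, map_smul, inner_smul_right])

/-- `L_{a,W}`, the operator associated with `q_{a,W}`. -/
def ellipticOp {n : ℕ} (Ω : Set (Rn n)) {a : Rn n → Matrix (Fin n) (Fin n) ℂ} {a₁ a₂ : ℝ}
    (ha : IsElliptic Ω a a₁ a₂) (W : Submodule ℂ (L2 Ω)) (hW : W ≤ W12 Ω) :
    L2 Ω →ₗ.[ℂ] L2 Ω :=
  (ellipticForm Ω ha W hW).operator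

/-- `-Δ_W = L_{I_n,W}`. -/
def negLaplacian {n : ℕ} (Ω : Set (Rn n)) (W : Submodule ℂ (L2 Ω)) (hW : W ≤ W12 Ω) :
    L2 Ω →ₗ.[ℂ] L2 Ω :=
  ellipticOp Ω (isElliptic_one Ω) W hW

/-! ### The potential -/

/-- `V ∈ L^q(Ω) + L^∞(Ω)`, with `q = n / 2` for `n ≥ 3` and `q = 1` for `n = 1`. -/
def IsCriticalPotential {n : ℕ} (Ω : Set (Rn n)) (V : Rn n → ℂ) : Prop :=
  ∃ V₁ V₂ : Rn n → ℂ, MemLp V₁ (if n = 1 then 1 else (n : ℝ≥0∞) / 2) (vol Ω) ∧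
    MemLp V₂ ∞ (vol Ω) ∧ V =ᵐ[vol Ω] fun x => V₁ x + V₂ x

/-- The maximal operator of multiplication by `h` in `L²(Ω)`, with domain
`{f ∈ L²(Ω) : h f ∈ L²(Ω)}`. -/
def mulOp {n : ℕ} (Ω : Set (Rn n)) (h : Rn n → ℂ) : L2 Ω →ₗ.[ℂ] L2 Ω :=
  Submodule.toLinearPMap
    { carrier := {p : L2 Ω × L2 Ω | p.2 =ᵐ[vol Ω] fun x => h x * p.1 x}
      add_mem' := by
        rintro ⟨f, g⟩ ⟨f', g'⟩ (e : g =ᵐ[vol Ω] _) (e' : g' =ᵐ[vol Ω] _)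
        change (g + g' : L2 Ω) =ᵐ[vol Ω] fun x => h x * (f + f' : L2 Ω) x
        filter_upwards [e, e', Lp.coeFn_add f f', Lp.coeFn_add g g'] with x h1 h2 h3 h4
        rw [h4, h3, Pi.add_apply, Pi.add_apply, h1, h2, mul_add]
      zero_mem' := by
        change (0 : L2 Ω) =ᵐ[vol Ω] fun x => h x * (0 : L2 Ω) x
        filter_upwards [Lp.coeFn_zero ℂ 2 (vol Ω)] with x hx
        rw [hx, Pi.zero_apply, mul_zero]
      smul_mem' := by
        rintro c ⟨f, g⟩ (e : g =ᵐ[vol Ω] _)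
        change (c • g : L2 Ω) =ᵐ[vol Ω] fun x => h x * (c • f : L2 Ω) x
        filter_upwards [e, Lp.coeFn_smul c f, Lp.coeFn_smul c g] with x h1 h2 h3
        rw [h3, h2, Pi.smul_apply, Pi.smul_apply, h1, smul_eq_mul, smul_eq_mul]
        ring }

/-- The operator of multiplication by `v = |V|^{1/2}` in `L²(Ω)`. -/
def absSqrtOp {n : ℕ} (Ω : Set (Rn n)) (V : Rn n → ℂ) : L2 Ω →ₗ.[ℂ] L2 Ω :=
  mulOp Ω fun x => (Real.sqrt ‖V x‖ : ℂ)

/-- `e^{i arg z}`. -/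
def phase (z : ℂ) : ℂ := Complex.exp (Complex.arg z * Complex.I)

lemma integrable_phase {n : ℕ} {Ω : Set (Rn n)} {V : Rn n → ℂ}
    (hV : AEStronglyMeasurable V (vol Ω)) (F G : L2 Ω) :
    Integrable (fun x => ⟪F x, phase (V x) * G x⟫_ℂ) (vol Ω) := by
  have hm : AEStronglyMeasurable (fun x => phase (V x)) (vol Ω) := by
    have : Measurable phase := by unfold phase; fun_prop
    exact (this.comp_aemeasurable hV.aemeasurable).aestronglyMeasurable
  refine ((Lp.memLp F).norm.integrable_mul (Lp.memLp G).norm).mono'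
    ((Lp.memLp F).1.inner (hm.mul (Lp.memLp G).1)) ?_
  refine Filter.Eventually.of_forall fun x => (norm_inner_le_norm _ _).trans (le_of_eq ?_)
  simp [phase, Complex.norm_exp_ofReal_mul_I]

/-- The form `q_V(f, g) = (v f, e^{i arg V} v g)_{L²(Ω)}` with domain `dom(v)`. -/
def potentialForm {n : ℕ} (Ω : Set (Rn n)) {V : Rn n → ℂ}
    (hV : AEStronglyMeasurable V (vol Ω)) : SesqForm (L2 Ω) where
  dom := (absSqrtOp Ω V).domain
  form := LinearMap.mk₂'ₛₗ (starRingEnd ℂ) (RingHom.id ℂ)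
    (fun f g : (absSqrtOp Ω V).domain =>
      ∫ x, ⟪absSqrtOp Ω V f x, phase (V x) * absSqrtOp Ω V g x⟫_ℂ ∂(vol Ω))
    (fun f f' g => by
      rw [← integral_add (integrable_phase hV _ _) (integrable_phase hV _ _),
        LinearPMap.map_add]
      refine integral_congr_ae ?_
      filter_upwards [Lp.coeFn_add (absSqrtOp Ω V f) (absSqrtOp Ω V f')] with x hx
      rw [hx, Pi.add_apply, inner_add_left])
    (fun c f g => by
      rw [smul_eq_mul, ← integral_const_mul, LinearPMap.map_smul]
      refine integral_congr_ae ?_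
      filter_upwards [Lp.coeFn_smul c (absSqrtOp Ω V f)] with x hx
      rw [hx, Pi.smul_apply, inner_smul_left])
    (fun f g g' => by
      rw [← integral_add (integrable_phase hV _ _) (integrable_phase hV _ _),
        LinearPMap.map_add]
      refine integral_congr_ae ?_
      filter_upwards [Lp.coeFn_add (absSqrtOp Ω V g) (absSqrtOp Ω V g')] with x hx
      rw [hx, Pi.add_apply, mul_add, inner_add_right])
    (fun c f g => by
      rw [RingHom.id_apply, smul_eq_mul, ← integral_const_mul, LinearPMap.map_smul]
      refine integral_congr_ae ?_
      filter_upwards [Lp.coeFn_smul c (absSqrtOp Ω V g)] with x hx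
      rw [hx, Pi.smul_apply, smul_eq_mul, mul_left_comm, ← smul_eq_mul, inner_smul_right])

/-! ### Strongly Lipschitz domains -/

/-- The part strictly above the graph of `ψ : ν^⊥ → ℝ`, in the direction of the unit vector `ν`. -/
def aboveGraph {n : ℕ} (ν : Rn n) (ψ : (ℝ ∙ ν)ᗮ → ℝ) : Set (Rn n) :=
  {x | ψ ((ℝ ∙ ν)ᗮ.orthogonalProjectionOnto x) < ⟪ν, x⟫_ℝ}

/-- `Ω` is a connected open set whose boundary is covered by finitely many open coordinate patches
`U j`; in each patch, after a rotation which takes `ν j` to the last coordinate direction, `Ω` is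
the part above the graph of a Lipschitz function (so that `∂Ω` coincides with that graph); at most
one of the parts `∂Ω ∩ U j` of the boundary is unbounded. -/
def IsStronglyLipschitz {n : ℕ} (Ω : Set (Rn n)) : Prop :=
  IsOpen Ω ∧ IsConnected Ω ∧
  ∃ (N : ℕ) (U : Fin N → Set (Rn n)),
    (∀ j, IsOpen (U j)) ∧ frontier Ω ⊆ ⋃ j, U j ∧
    (∀ j, ∃ (ν : Rn n) (ψ : (ℝ ∙ ν)ᗮ → ℝ) (K : ℝ≥0),
      ‖ν‖ = 1 ∧ LipschitzWith K ψ ∧ Ω ∩ U j = aboveGraph ν ψ ∩ U j) ∧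
    ∀ j k, ¬ Bornology.IsBounded (frontier Ω ∩ U j) →
      ¬ Bornology.IsBounded (frontier Ω ∩ U k) → j = k

/-! ### The form bounds -/

/-- `V` is infinitesimally form bounded with respect to `-Δ_W`, and for some non-negative `η`,
`‖|V|^{1/2} f‖² ≤ ε ‖(-Δ_W)^{1/2} f‖² + η(ε) ‖f‖²` for all `ε > 0` and `f ∈ W = dom((-Δ_W)^{1/2})`. -/
def LaplacianFormBound {n : ℕ} (Ω : Set (Rn n)) {V : Rn n → ℂ}
    (hV : AEStronglyMeasurable V (vol Ω)) (W : Submodule ℂ (L2 Ω)) (hW : W ≤ W12 Ω) : Prop :=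
  (potentialForm Ω hV).InfBoundedWrt (negLaplacian Ω W hW) ∧
  (opSqrt (negLaplacian Ω W hW)).domain = W ∧
  ∃ η : ℝ → ℝ, (∀ ε, 0 < ε → 0 ≤ η ε) ∧
    ∀ ε, 0 < ε → ∀ f ∈ W,
      ∃ (hv : f ∈ (absSqrtOp Ω V).domain) (hs : f ∈ (opSqrt (negLaplacian Ω W hW)).domain),
        ‖absSqrtOp Ω V ⟨f, hv⟩‖ ^ 2 ≤
          ε * ‖opSqrt (negLaplacian Ω W hW) ⟨f, hs⟩‖ ^ 2 + η ε * ‖f‖ ^ 2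

/-- For every `a₁ > 0` there is a non-negative `η'` such that, for all elliptic coefficients `a`
with lower ellipticity constant `a₁`, `V` is infinitesimally form bounded with respect to `L_{a,W}`
and `‖|V|^{1/2} f‖² ≤ ε Re q_{a,W}(f, f) + η'(ε) ‖f‖²` for all `ε > 0` and `f ∈ W`. -/
def EllipticFormBound {n : ℕ} (Ω : Set (Rn n)) {V : Rn n → ℂ}
    (hV : AEStronglyMeasurable V (vol Ω)) (W : Submodule ℂ (L2 Ω)) (hW : W ≤ W12 Ω) : Prop :=
  ∀ a₁ : ℝ, 0 < a₁ → ∃ η' : ℝ → ℝ, (∀ ε, 0 < ε → 0 ≤ η' ε) ∧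
    ∀ (a₂ : ℝ) (a : Rn n → Matrix (Fin n) (Fin n) ℂ) (ha : IsElliptic Ω a a₁ a₂),
      (potentialForm Ω hV).InfBoundedWrt (ellipticOp Ω ha W hW) ∧
      ∀ ε, 0 < ε → ∀ (f : L2 Ω) (hf : f ∈ W),
        ∃ hv : f ∈ (absSqrtOp Ω V).domain,
          ‖absSqrtOp Ω V ⟨f, hv⟩‖ ^ 2 ≤
            ε * ((ellipticForm Ω ha W hW).form ⟨f, hf⟩ ⟨f, hf⟩).re + η' ε * ‖f‖ ^ 2

end

/-! Write `r` for the Sobolev exponent (`1/r = 1/2 - 1/n` if `n ≥ 3`, `r = ∞` if `n = 1`) and `q`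
for the exponent in the hypothesis on `V`. Up to a bounded function, `V` has arbitrarily small `L^q`
norm. As `1/(2q) + 1/r = 1/2`, Hölder's inequality turns any embedding `W ⊆ L^r(Ω)` into `‖|V|^{1/2}
f‖² ≤ ε ‖∇f‖² + η(ε) ‖f‖²` on `W` (`HasSobolevBound.absSqrtOp_bound`). The elliptic bound follows
from `a₁ ‖∇f‖² ≤ Re q_a(f, f)`. For the Laplacian, `-Δ_W = A*A` with `A` the gradient on `W`, and
`‖(A*A)^{1/2} f‖ = ‖A f‖` with equal domains (`opSqrt_of_gramGraph`). Both are collected in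
`formBounds_of_absSqrtOp_bound`.

What remains is the Sobolev embedding. For `W_0^{1,2}` it is the inequality on `ℝⁿ` for test
functions, followed by a limit (`hasSobolevBound_W12zero`). In the other cases it is proved on all
of `W^{1,2}(Ω)`, so the boundary condition plays no role, and no extension operator is used. The
Gagliardo-Nirenberg-Sobolev argument only integrates derivatives along half-lines parallel to the
axes, hence works on every open set that is a lower set in some linear coordinates
(`IsLowerDomain.exists_sobolev`). On such sets it extends to weak derivatives by mollifying with
kernels supported in the positive cone (`IsLowerDomain.exists_sobolev_weak`).

Both sides of a Lipschitz graph are lower domains. If a cutoff `χ` keeps away from `∂Ω` inside a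
lower domain `G`, then `χ f`, set to zero off `Ω`, is weakly differentiable on `G`
(`isWeakGradOn_cutoff`). Applying this to the two sides of the graph gives the estimate near a
boundary patch (`IsGraphPatch.sobolevBoundOn`); the graph itself is a null set. Finitely many balls
and one neighbourhood of infinity then cover `Ω` (`IsStronglyLipschitz.hasSobolevBound`). An
interval is treated likewise, as the union of two half-lines within it. -/

noncomputable section

/-! ### The operator `A*A` and its square root -/

section GramOperator

variable {H K : Type*} [NormedAddCommGroup H] [InnerProductSpace ℂ H]
  [NormedAddCommGroup K] [InnerProductSpace ℂ K]

/-- The graph of `A*A`, where `g` is the graph of `A`. -/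
def gramGraph (g : Submodule ℂ (H × K)) : Set (H × H) :=
  {p | ∃ k : K, (p.1, k) ∈ g ∧ ∀ w ∈ g, ⟪w.2, k⟫_ℂ = ⟪w.1, p.2⟫_ℂ}

lemma norm_sq_eq_of_mem_gramGraph {g : Submodule ℂ (H × K)} {x f : H} {k : K}
    (hk : (x, k) ∈ g) (h : ∀ w ∈ g, ⟪w.2, k⟫_ℂ = ⟪w.1, f⟫_ℂ) :
    ‖k‖ ^ 2 = (⟪x, f⟫_ℂ).re := by
  rw [← h _ hk]
  exact (inner_self_eq_norm_sq (𝕜 := ℂ) k).symm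

/-- A subspace of `H × K` as a subspace of the Hilbert space sum. -/
def hilbertGraph (g : Submodule ℂ (H × K)) : Submodule ℂ (WithLp 2 (H × K)) :=
  g.comap (WithLp.linearEquiv 2 ℂ (H × K)).toLinearMap

lemma isClosed_hilbertGraph {g : Submodule ℂ (H × K)} (hg : IsClosed (g : Set (H × K))) :
    IsClosed (hilbertGraph g : Set (WithLp 2 (H × K))) :=
  hg.preimage (WithLp.prod_continuous_ofLp 2 H K)

variable [CompleteSpace H] [CompleteSpace K]

/-- `R = (1 + A*A)⁻¹`, obtained by von Neumann's device: `(R h, k)` is the orthogonal projection of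
`(h, 0)` onto the graph, and the orthogonality of `(h - R h, -k)` to the graph is the stated
equation. -/
lemma exists_resolvent {g : Submodule ℂ (H × K)} (hg : IsClosed (g : Set (H × K))) :
    ∃ R : H →L[ℂ] H, ∀ h, ∃ k, (R h, k) ∈ g ∧ ∀ w ∈ g, ⟪w.2, k⟫_ℂ = ⟪w.1, h - R h⟫_ℂ := by
  have : CompleteSpace (hilbertGraph g) := (isClosed_hilbertGraph hg).completeSpace_coe
  let e := WithLp.prodContinuousLinearEquiv 2 ℂ H K
  refine ⟨ContinuousLinearMap.fst ℂ H K ∘L (e : WithLp 2 (H × K) →L[ℂ] H × K) ∘L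
    (hilbertGraph g).starProjection ∘L (e.symm : H × K →L[ℂ] WithLp 2 (H × K)) ∘L
    ContinuousLinearMap.inl ℂ H K, fun h => ?_⟩
  set p := (hilbertGraph g).starProjection (WithLp.toLp 2 (h, (0 : K))) with hp
  refine ⟨p.snd, ?_, fun w hw => ?_⟩
  · exact (hilbertGraph g).starProjection_apply_mem (WithLp.toLp 2 (h, (0 : K)))
  · have h1 := (hilbertGraph g).starProjection_inner_eq_zero (WithLp.toLp 2 (h, (0 : K)))
      (WithLp.toLp 2 w) hw
    rw [← hp, ← inner_conj_symm, map_eq_zero, WithLp.prod_inner_apply] at h1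
    have h2 : ⟪w.1, h - p.fst⟫_ℂ + ⟪w.2, 0 - p.snd⟫_ℂ = 0 := h1
    rw [zero_sub, inner_neg_right] at h2
    change ⟪w.2, p.snd⟫_ℂ = ⟪w.1, h - p.fst⟫_ℂ
    linear_combination -h2

/-- The domain of `A*A` is a core of the closed operator `A`. -/
lemma exists_seq_tendsto_of_mem_graph {g : Submodule ℂ (H × K)}
    (hg : IsClosed (g : Set (H × K))) (hfun : ∀ k, ((0 : H), k) ∈ g → k = 0) {p : H × K}
    (hp : p ∈ g) :
    ∃ s : ℕ → H × K, (∀ j, s j ∈ g ∧ ∃ f, ∀ w ∈ g, ⟪w.2, (s j).2⟫_ℂ = ⟪w.1, f⟫_ℂ) ∧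
      Filter.Tendsto s Filter.atTop (nhds p) := by
  obtain ⟨R, hR⟩ := exists_resolvent hg
  let N : Submodule ℂ (H × K) :=
    { carrier := {q | q ∈ g ∧ ∃ f, ∀ w ∈ g, ⟪w.2, q.2⟫_ℂ = ⟪w.1, f⟫_ℂ}
      add_mem' := by
        rintro q q' ⟨h1, f, h2⟩ ⟨h1', f', h2'⟩
        refine ⟨g.add_mem h1 h1', f + f', fun w hw => ?_⟩
        rw [Prod.snd_add, inner_add_right, inner_add_right, h2 w hw, h2' w hw]
      zero_mem' := ⟨g.zero_mem, 0, fun w _ => by simp⟩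
      smul_mem' := by
        rintro c q ⟨h1, f, h2⟩
        refine ⟨g.smul_mem c h1, c • f, fun w hw => ?_⟩
        rw [Prod.smul_snd, inner_smul_right, inner_smul_right, h2 w hw] }
  let L : Submodule ℂ (WithLp 2 (H × K)) := (hilbertGraph N).topologicalClosure
  have : CompleteSpace L := (hilbertGraph N).isClosed_topologicalClosure.completeSpace_coe
  have hLg : L ≤ hilbertGraph g :=
    Submodule.topologicalClosure_minimal _ (fun q hq => hq.1) (isClosed_hilbertGraph hg)
  have hpL : WithLp.toLp 2 p ∈ L := by
    rw [← Submodule.starProjection_eq_self_iff]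
    set q := WithLp.toLp 2 p - L.starProjection (WithLp.toLp 2 p) with hq
    have hqo : q ∈ Lᗮ := L.sub_starProjection_mem_orthogonal _
    have hqg : q ∈ hilbertGraph g :=
      (hilbertGraph g).sub_mem hp (hLg (L.starProjection_apply_mem _))
    -- Testing `q ⊥ L` against `(R q₁, k)` gives `0 = ⟪q₁, R q₁⟫ + ⟪q₁, q₁ - R q₁⟫ = ‖q₁‖²`; then
    -- `q₂ = 0`, since the graph is single-valued.
    obtain ⟨k, hk, hk'⟩ := hR q.fst
    have hmem : WithLp.toLp 2 (R q.fst, k) ∈ L :=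
      Submodule.le_topologicalClosure _ ⟨hk, q.fst - R q.fst, hk'⟩
    have h0 := Submodule.inner_left_of_mem_orthogonal hmem hqo
    rw [WithLp.prod_inner_apply] at h0
    have h1 : ⟪q.fst, R q.fst⟫_ℂ + ⟪q.snd, k⟫_ℂ = 0 := h0
    rw [hk' (q.fst, q.snd) hqg, ← inner_add_right, add_sub_cancel, inner_self_eq_zero] at h1
    have h2 : q.snd = 0 := hfun _ (h1 ▸ hqg)
    have h3 : q = 0 := WithLp.ofLp_injective 2 (Prod.ext h1 h2)
    exact (sub_eq_zero.1 h3).symm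
  obtain ⟨s, hs, hlim⟩ := mem_closure_iff_seq_limit.1 hpL
  exact ⟨fun j => ((s j).fst, (s j).snd), hs,
    ((WithLp.prod_continuous_ofLp 2 H K).tendsto _).comp hlim⟩

/-- If `A*A = B*B` for closed operators `A`, `B` with graphs `g`, `g'`, then
`dom A ⊆ dom B` and `‖A x‖ = ‖B x‖` on `dom A`. -/
lemma exists_mem_of_gramGraph_eq {K' : Type*} [NormedAddCommGroup K'] [InnerProductSpace ℂ K']
    [CompleteSpace K'] {g : Submodule ℂ (H × K)} {g' : Submodule ℂ (H × K')}
    (hg : IsClosed (g : Set (H × K))) (hg' : IsClosed (g' : Set (H × K')))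
    (hfun : ∀ k, ((0 : H), k) ∈ g → k = 0) (h : gramGraph g ⊆ gramGraph g') {p : H × K}
    (hp : p ∈ g) : ∃ k' : K', (p.1, k') ∈ g' ∧ ‖k'‖ = ‖p.2‖ := by
  obtain ⟨s, hs, hlim⟩ := exists_seq_tendsto_of_mem_graph hg hfun hp
  choose hsg f hf using hs
  have hmem : ∀ j, ((s j).1, f j) ∈ gramGraph g' := fun j => h ⟨(s j).2, hsg j, hf j⟩
  choose k hkg hk using hmem
  -- `‖A x‖² = Re ⟪x, A*A x⟫` depends on `A*A` only, so `A` and `B` have equal norms on differences,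
  -- and `B` of the sequence is Cauchy because `A` of it is.
  have hnorm : ∀ i j, ‖k i - k j‖ = ‖(s i).2 - (s j).2‖ := by
    intro i j
    have e1 : ∀ w ∈ g, ⟪w.2, (s i).2 - (s j).2⟫_ℂ = ⟪w.1, f i - f j⟫_ℂ := fun w hw => by
      rw [inner_sub_right, inner_sub_right, hf i w hw, hf j w hw]
    have e2 : ∀ w ∈ g', ⟪w.2, k i - k j⟫_ℂ = ⟪w.1, f i - f j⟫_ℂ := fun w hw => by
      rw [inner_sub_right, inner_sub_right, hk i w hw, hk j w hw]
    have n1 := norm_sq_eq_of_mem_gramGraph (g.sub_mem (hsg i) (hsg j)) e1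
    have n2 := norm_sq_eq_of_mem_gramGraph (g'.sub_mem (hkg i) (hkg j)) e2
    have n3 : ‖k i - k j‖ ^ 2 = ‖(s i).2 - (s j).2‖ ^ 2 := n2.trans n1.symm
    exact (pow_left_inj₀ (norm_nonneg _) (norm_nonneg _) two_ne_zero).1 n3
  have hnorm' : ∀ j, ‖k j‖ = ‖(s j).2‖ := by
    intro j
    have n1 := norm_sq_eq_of_mem_gramGraph (hsg j) (hf j)
    have n2 := norm_sq_eq_of_mem_gramGraph (hkg j) (hk j)
    exact (pow_left_inj₀ (norm_nonneg _) (norm_nonneg _) two_ne_zero).1 (n2.trans n1.symm)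
  have hlim1 := (continuous_fst.tendsto p).comp hlim
  have hlim2 := (continuous_snd.tendsto p).comp hlim
  have hc : CauchySeq k := by
    have := hlim2.cauchySeq
    rw [Metric.cauchySeq_iff] at this ⊢
    intro ε hε
    obtain ⟨N, hN⟩ := this ε hε
    refine ⟨N, fun m hm n hn => ?_⟩
    rw [dist_eq_norm, hnorm, ← dist_eq_norm]
    exact hN m hm n hn
  obtain ⟨k', hk'⟩ := cauchySeq_tendsto_of_complete hc
  refine ⟨k', hg'.mem_of_tendsto (hlim1.prodMk_nhds hk') (Filter.Eventually.of_forall hkg), ?_⟩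
  refine tendsto_nhds_unique hk'.norm ?_
  simp_rw [hnorm']
  exact hlim2.norm

/-- A non-negative contraction `R` with trivial kernel gives a non-negative self-adjoint square
root of `R⁻¹ - 1`. -/
lemma exists_isNonnegSqrt_of_resolvent {R : H →L[ℂ] H} (h0 : 0 ≤ R) (h1 : R ≤ 1)
    (hinj : ∀ x, R x = 0 → x = 0) {T : H →ₗ.[ℂ] H}
    (hT : ∀ x y, (x, y) ∈ T.graph ↔ ∃ z, x = R z ∧ y = z - R z) :
    ∃ S : H →ₗ.[ℂ] H, IsNonnegSqrt S T := by
  have h1' : 0 ≤ 1 - R := sub_nonneg.2 h1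
  set C := CFC.sqrt R with hC
  set D := CFC.sqrt (1 - R) with hD
  have hC0 : 0 ≤ C := CFC.sqrt_nonneg _
  have hD0 : 0 ≤ D := CFC.sqrt_nonneg _
  have hCC : C * C = R := CFC.sqrt_mul_sqrt_self R h0
  have hDD : D * D = 1 - R := CFC.sqrt_mul_sqrt_self (1 - R) h1'
  have hcomm : Commute C D := by
    have : Commute R (1 - R) := (Commute.one_right R).sub_right (Commute.refl R)
    have h2 : Commute C (1 - R) := this.cfcₙ_nnreal _
    exact (h2.symm.cfcₙ_nnreal _).symm
  have hCD0 : 0 ≤ C * D := Commute.mul_nonneg hC0 hD0 hcomm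
  have hCCx : ∀ x, C (C x) = R x := fun x => congrArg (fun F : H →L[ℂ] H => F x) hCC
  have hDDx : ∀ x, D (D x) = x - R x := fun x => congrArg (fun F : H →L[ℂ] H => F x) hDD
  have hCDx : ∀ x, D (C x) = C (D x) := fun x =>
    congrArg (fun F : H →L[ℂ] H => F x) hcomm.eq.symm
  have hCs : ∀ x y, ⟪C x, y⟫_ℂ = ⟪x, C y⟫_ℂ :=
    ((ContinuousLinearMap.nonneg_iff_isPositive C).1 hC0).isSymmetric
  have hDs : ∀ x y, ⟪D x, y⟫_ℂ = ⟪x, D y⟫_ℂ :=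
    ((ContinuousLinearMap.nonneg_iff_isPositive D).1 hD0).isSymmetric
  have hCinj : ∀ x, C x = 0 → x = 0 := fun x hx => hinj x (by rw [← hCCx, hx, map_zero])
  -- `T = (1 - R) R⁻¹ = D² C⁻²`, so the root should be `D C⁻¹`, whose graph is `{(C x, D x)}`.
  let g : Submodule ℂ (H × H) := LinearMap.range (C.toLinearMap.prod D.toLinearMap)
  have hgmem : ∀ p : H × H, p ∈ g ↔ ∃ x, C x = p.1 ∧ D x = p.2 := fun p => by
    simp [g, Prod.ext_iff]
  let S := g.toLinearPMap
  have hS : S.graph = g := by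
    refine g.toLinearPMap_graph_eq fun p hp hp1 => ?_
    obtain ⟨x, hx1, hx2⟩ := (hgmem p).1 hp
    rw [← hx2, hCinj x (hx1.trans hp1), map_zero]
  have hdense : Dense (S.domain : Set H) := by
    rw [Submodule.dense_iff_topologicalClosure_eq_top, Submodule.topologicalClosure_eq_top_iff,
      Submodule.eq_bot_iff]
    intro x hx
    refine hCinj x ?_
    have hm : C (C x) ∈ S.domain := LinearPMap.mem_domain_of_mem_graph
      (hS ▸ (hgmem (C (C x), D (C x))).2 ⟨C x, rfl, rfl⟩ : (C (C x), D (C x)) ∈ S.graph)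
    have := Submodule.inner_right_of_mem_orthogonal hm hx
    rw [hCs] at this
    exact inner_self_eq_zero.1 this
  -- `C² + D² = 1` makes `z = D w + C u` a common preimage, `u = C z` and `w = D z`. The graph is
  -- thus the full solution set of `D u = C w`. This yields self-adjointness, and also `S² = T` with
  -- the correct domain.
  have hkey : ∀ u w, D u = C w → (u, w) ∈ g := by
    intro u w huw
    refine (hgmem _).2 ⟨D w + C u, ?_, ?_⟩
    · change C (D w + C u) = u
      rw [map_add, hCCx, ← hCDx, ← huw, hDDx, sub_add_cancel]
    · change D (D w + C u) = w
      rw [map_add, hDDx, hCDx, huw, hCCx, sub_add_cancel]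
  refine ⟨S, ?_, fun x => ?_, fun x y => ?_⟩
  · rw [LinearPMap.isSelfAdjoint_def]
    refine LinearPMap.eq_of_eq_graph ?_
    rw [LinearPMap.adjoint_graph_eq_graph_adjoint hdense, hS]
    ext ⟨u, w⟩
    rw [Submodule.mem_adjoint_iff]
    constructor
    · intro h
      refine hkey u w (ext_inner_left ℂ fun x => ?_)
      have := h (C x) (D x) ((hgmem _).2 ⟨x, rfl, rfl⟩)
      rw [← hDs, ← hCs]
      exact sub_eq_zero.1 this
    · intro h a b hab
      obtain ⟨x, hx1, hx2⟩ := (hgmem _).1 h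
      obtain ⟨y, hy1, hy2⟩ := (hgmem _).1 hab
      dsimp only at hx1 hx2 hy1 hy2 ⊢
      rw [← hx1, ← hx2, ← hy1, ← hy2, hDs, hCs, hCDx, sub_self]
  · obtain ⟨z, hz1, hz2⟩ := (hgmem _).1 (hS ▸ S.mem_graph x)
    dsimp only at hz1 hz2
    rw [← hz1, ← hz2, hCs]
    exact ((ContinuousLinearMap.nonneg_iff_isPositive _).1 hCD0).re_inner_nonneg_right z
  · rw [hT, hS]
    constructor
    · rintro ⟨z, rfl, rfl⟩
      exact ⟨C (D z), (hgmem _).2 ⟨C z, hCCx z, hCDx z⟩, (hgmem _).2 ⟨D z, rfl, hDDx z⟩⟩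
    · rintro ⟨z, hxz, hzy⟩
      obtain ⟨p, hp1, hp2⟩ := (hgmem _).1 hxz
      obtain ⟨q, hq1, hq2⟩ := (hgmem _).1 hzy
      dsimp only at hp1 hp2 hq1 hq2
      obtain ⟨w, hw1, hw2⟩ := (hgmem _).1 (hkey p q (hp2.trans hq1.symm))
      dsimp only at hw1 hw2
      exact ⟨w, by rw [← hp1, ← hw1, hCCx], by rw [← hq2, ← hw2, hDDx]⟩

/-- The resolvent satisfies `⟪R x, y⟫ = ⟪k x, k y⟫ + ⟪R x, R y⟫`, where `k x = A R x`. This gives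
symmetry and `0 ≤ R ≤ 1`; the density of `dom A` gives injectivity. -/
lemma exists_isNonnegSqrt {g : Submodule ℂ (H × K)} (hg : IsClosed (g : Set (H × K)))
    (hdense : ∀ x : H, (∀ w ∈ g, ⟪w.1, x⟫_ℂ = 0) → x = 0) {T : H →ₗ.[ℂ] H}
    (hT : (T.graph : Set (H × H)) = gramGraph g) : ∃ S : H →ₗ.[ℂ] H, IsNonnegSqrt S T := by
  obtain ⟨R, hR⟩ := exists_resolvent hg
  choose k hkg hk using hR
  have hin : ∀ x y, ⟪R x, y⟫_ℂ = ⟪k x, k y⟫_ℂ + ⟪R x, R y⟫_ℂ := fun x y => by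
    rw [hk y _ (hkg x), inner_sub_right, sub_add_cancel]
  have hsymm : ∀ x y, ⟪R x, y⟫_ℂ = ⟪x, R y⟫_ℂ := fun x y => by
    rw [hin, ← inner_conj_symm x, hin y x, map_add, inner_conj_symm, inner_conj_symm]
  have hre : ∀ x, (⟪R x, x⟫_ℂ).re = ‖k x‖ ^ 2 + ‖R x‖ ^ 2 := fun x => by
    rw [hin, Complex.add_re]
    exact congrArg₂ (· + ·) (inner_self_eq_norm_sq (𝕜 := ℂ) _) (inner_self_eq_norm_sq (𝕜 := ℂ) _)
  have h0 : 0 ≤ R := by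
    rw [ContinuousLinearMap.nonneg_iff_isPositive, ContinuousLinearMap.isPositive_def]
    refine ⟨hsymm, fun x => ?_⟩
    change 0 ≤ (⟪R x, x⟫_ℂ).re
    rw [hre]
    positivity
  have h1 : R ≤ 1 := by
    rw [← sub_nonneg, ContinuousLinearMap.nonneg_iff_isPositive,
      ContinuousLinearMap.isPositive_def]
    refine ⟨fun x y => ?_, fun x => ?_⟩
    · change ⟪x - R x, y⟫_ℂ = ⟪x, y - R y⟫_ℂ
      rw [inner_sub_left, inner_sub_right, hsymm]
    · change 0 ≤ (⟪x - R x, x⟫_ℂ).re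
      have e1 : (⟪x, x⟫_ℂ).re = ‖x‖ ^ 2 := inner_self_eq_norm_sq (𝕜 := ℂ) x
      have e2 : (⟪R x, x⟫_ℂ).re ≤ ‖R x‖ * ‖x‖ := re_inner_le_norm (𝕜 := ℂ) _ _
      rw [inner_sub_left, Complex.sub_re, e1]
      have e3 := hre x
      nlinarith [sq_nonneg ‖k x‖, sq_nonneg (‖R x‖ - ‖x‖)]
  have hinj : ∀ x, R x = 0 → x = 0 := fun x hx => by
    refine hdense x fun w hw => ?_
    have hk0 : k x = 0 := by
      have := hre x
      rw [hx, inner_zero_left, norm_zero] at this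
      have h2 : ‖k x‖ ^ 2 = 0 := by simpa using this.symm
      exact norm_eq_zero.1 (pow_eq_zero_iff two_ne_zero |>.1 h2)
    have := hk x w hw
    rw [hx, sub_zero, hk0, inner_zero_right] at this
    exact this.symm
  refine exists_isNonnegSqrt_of_resolvent h0 h1 hinj fun x y => ?_
  rw [← SetLike.mem_coe, hT]
  constructor
  · rintro ⟨l, hl, hl'⟩
    dsimp only at hl hl'
    -- If `y = A*A x`, then `x + y = (1 + A*A) x`, so `x = R (x + y)` is expected. Subtracting the
    -- two defining equations gives `‖l - k (x + y)‖² = -‖x - R (x + y)‖²`, so both sides vanish.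
    refine ⟨x + y, ?_, ?_⟩
    all_goals
      have hd : x - R (x + y) = 0 := by
        have hm := g.sub_mem hl (hkg (x + y))
        have e1 := hl' _ hm
        have e2 := hk (x + y) _ hm
        have e3 : ⟪l - k (x + y), l - k (x + y)⟫_ℂ
            = - ⟪x - R (x + y), x - R (x + y)⟫_ℂ := by
          rw [inner_sub_right]
          change ⟪l - k (x + y), l⟫_ℂ = ⟪x - R (x + y), y⟫_ℂ at e1
          change ⟪l - k (x + y), k (x + y)⟫_ℂ = ⟪x - R (x + y), x + y - R (x + y)⟫_ℂ at e2
          rw [e1, e2, ← inner_sub_right, ← inner_neg_right]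
          congr 1
          abel
        have e4 : ‖l - k (x + y)‖ ^ 2 = - ‖x - R (x + y)‖ ^ 2 := by
          rw [inner_self_eq_norm_sq_to_K, inner_self_eq_norm_sq_to_K] at e3
          exact_mod_cast e3
        have h5 : 0 ≤ ‖l - k (x + y)‖ ^ 2 := by positivity
        have h6 : 0 ≤ ‖x - R (x + y)‖ ^ 2 := by positivity
        have : ‖x - R (x + y)‖ ^ 2 = 0 := by linarith
        exact norm_eq_zero.1 (pow_eq_zero_iff two_ne_zero |>.1 this)
    · exact sub_eq_zero.1 hd
    · rw [← sub_eq_zero.1 hd]; abel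
  · rintro ⟨z, rfl, rfl⟩
    exact ⟨k z, hkg z, hk z⟩

/-- The second representation theorem: for a closed densely defined operator `A` with graph `g` and
`T = A*A`, the domain of `T^{1/2}` is the domain of `A`, and `‖T^{1/2} x‖ = ‖A x‖`. -/
lemma opSqrt_of_gramGraph {g : Submodule ℂ (H × K)} (hg : IsClosed (g : Set (H × K)))
    (hfun : ∀ k, ((0 : H), k) ∈ g → k = 0)
    (hdense : ∀ x : H, (∀ w ∈ g, ⟪w.1, x⟫_ℂ = 0) → x = 0) {T : H →ₗ.[ℂ] H}
    (hT : (T.graph : Set (H × H)) = gramGraph g) :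
    (∀ x, x ∈ (opSqrt T).domain ↔ ∃ k, (x, k) ∈ g) ∧
      ∀ x : (opSqrt T).domain, ∀ k, ((x : H), k) ∈ g → ‖opSqrt T x‖ = ‖k‖ := by
  have hex := exists_isNonnegSqrt hg hdense hT
  obtain ⟨hsa, -, hsq⟩ : IsNonnegSqrt (opSqrt T) T := by
    rw [opSqrt, dif_pos hex]
    exact hex.choose_spec
  set S := opSqrt T
  have hdS : Dense (S.domain : Set H) := hsa.dense_domain
  -- As `S` is self-adjoint, `S² = S*S`. Hence `S` and `A` have the same Gram operator, and the
  -- comparison lemma applies in both directions, whichever root has been chosen.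
  have hgram : gramGraph S.graph = gramGraph g := by
    rw [← hT]
    ext ⟨x, y⟩
    rw [SetLike.mem_coe, hsq]
    have hadj : ∀ z, (z, y) ∈ S.graph ↔ ∀ w ∈ S.graph, ⟪w.2, z⟫_ℂ = ⟪w.1, y⟫_ℂ := fun z => by
      nth_rw 1 [← LinearPMap.isSelfAdjoint_def.1 hsa]
      rw [LinearPMap.adjoint_graph_eq_graph_adjoint hdS, Submodule.mem_adjoint_iff]
      exact ⟨fun h w hw => sub_eq_zero.1 (h w.1 w.2 hw), fun h a b hab =>
        sub_eq_zero.2 (h (a, b) hab)⟩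
    exact exists_congr fun z => and_congr Iff.rfl (hadj z).symm
  have hSc : IsClosed (S.graph : Set (H × H)) := hsa.isClosed
  have hSfun : ∀ k, ((0 : H), k) ∈ S.graph → k = 0 := fun k hk =>
    S.graph_fst_eq_zero_snd hk rfl
  refine ⟨fun x => ⟨fun hx => ?_, ?_⟩, fun x k hk => ?_⟩
  · obtain ⟨k, hk, -⟩ := exists_mem_of_gramGraph_eq hSc hg hSfun hgram.le (S.mem_graph ⟨x, hx⟩)
    exact ⟨k, hk⟩
  · rintro ⟨k, hk⟩
    obtain ⟨z, hz, -⟩ := exists_mem_of_gramGraph_eq hg hSc hfun hgram.ge hk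
    exact LinearPMap.mem_domain_of_mem_graph hz
  · obtain ⟨z, hz, hzn⟩ := exists_mem_of_gramGraph_eq hg hSc hfun hgram.ge hk
    rw [← hzn, LinearPMap.mem_graph_snd_inj S hz (S.mem_graph x) rfl]

end GramOperator

/-! ### The weak gradient as a closed operator -/

section WeakGradient

variable {n : ℕ} {Ω : Set (Rn n)}

lemma mem_weakGradGraph {p : L2 Ω × L2vec Ω} :
    p ∈ weakGradGraph Ω ↔ ∀ φ : Rn n → ℝ, ContDiff ℝ ∞ φ → HasCompactSupport φ → tsupport φ ⊆ Ω →
      ∀ j : Fin n, ∫ x, (fderiv ℝ φ x (EuclideanSpace.single j 1)) • p.1 x ∂(vol Ω)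
        = - ∫ x, φ x • (p.2 x) j ∂(vol Ω) := Iff.rfl

lemma memLp_proj (F : L2vec Ω) (j : Fin n) : MemLp (fun x => (F x) j) 2 (vol Ω) :=
  (Lp.memLp F).continuousLinearMap_comp (EuclideanSpace.proj (𝕜 := ℂ) j)

/-- A function on an open set `Ω` which vanishes against all test functions is zero. -/
lemma ae_eq_zero_of_forall_testFun (hΩ : IsOpen Ω) {f : Rn n → ℂ} (hf : MemLp f 2 (vol Ω))
    (h : ∀ φ : Rn n → ℝ, ContDiff ℝ ∞ φ → HasCompactSupport φ → tsupport φ ⊆ Ω →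
      ∫ x, φ x • f x ∂(vol Ω) = 0) : f =ᵐ[vol Ω] 0 := by
  have hloc : LocallyIntegrableOn f Ω volume := by
    have h1 : LocallyIntegrable f (vol Ω) := hf.locallyIntegrable one_le_two
    rw [locallyIntegrableOn_iff hΩ.isLocallyClosed]
    intro k hk hkc
    have := h1.integrableOn_isCompact hkc
    rwa [IntegrableOn, Measure.restrict_restrict_of_subset hk] at this
  have := hΩ.ae_eq_zero_of_integral_contDiff_smul_eq_zero hloc fun φ hφ hc hs => by
    rw [← h φ hφ hc hs, eq_comm]
    refine setIntegral_eq_integral_of_forall_compl_eq_zero fun x hx => ?_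
    rw [image_eq_zero_of_notMem_tsupport fun hx' => hx (hs hx'), zero_smul]
  rw [Filter.EventuallyEq, ae_restrict_iff' hΩ.measurableSet]
  filter_upwards [this] with x hx hxΩ using hx hxΩ

lemma snd_eq_zero_of_mem_weakGradGraph (hΩ : IsOpen Ω) (p : L2 Ω × L2vec Ω)
    (hp : p ∈ weakGradGraph Ω) (hp1 : p.1 = 0) : p.2 = 0 := by
  have hj : ∀ j, (fun x => (p.2 x) j) =ᵐ[vol Ω] 0 := fun j => by
    refine ae_eq_zero_of_forall_testFun hΩ (memLp_proj p.2 j) fun φ hφ hc hs => ?_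
    have h1 := hp φ hφ hc hs j
    rw [hp1] at h1
    have e1 : (fun x => (fderiv ℝ φ x (EuclideanSpace.single j 1)) • (0 : L2 Ω) x)
        =ᵐ[vol Ω] fun _ => 0 := by
      filter_upwards [Lp.coeFn_zero ℂ 2 (vol Ω)] with x hx
      rw [hx, Pi.zero_apply, smul_zero]
    rw [integral_congr_ae e1, integral_zero, eq_comm, neg_eq_zero] at h1
    exact h1
  refine Lp.ext ?_
  filter_upwards [Lp.coeFn_zero (Cn n) 2 (vol Ω), ae_all_iff.2 hj] with x h0 hx
  rw [h0]
  ext j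
  exact hx j

lemma weakGrad_graph (hΩ : IsOpen Ω) : (weakGrad Ω).graph = weakGradGraph Ω :=
  Submodule.toLinearPMap_graph_eq _ (snd_eq_zero_of_mem_weakGradGraph hΩ)

lemma continuous_integral_testFun_smul {ψ : Rn n → ℝ} (hψ : Continuous ψ)
    (hc : HasCompactSupport ψ) : Continuous fun f : L2 Ω => ∫ x, ψ x • f x ∂(vol Ω) := by
  have hm : MemLp (fun x => (ψ x : ℂ)) 2 (vol Ω) :=
    ((hψ.memLp_of_hasCompactSupport hc).ofReal)
  have : (fun f : L2 Ω => ∫ x, ψ x • f x ∂(vol Ω)) = fun f => ⟪hm.toLp _, f⟫_ℂ := by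
    ext f
    rw [L2.inner_def]
    refine integral_congr_ae ?_
    filter_upwards [hm.coeFn_toLp] with x hx
    rw [hx]
    simp [mul_comm]
  rw [this]
  fun_prop

lemma continuous_integral_testFun_smul_proj {ψ : Rn n → ℝ} (hψ : Continuous ψ)
    (hc : HasCompactSupport ψ) (j : Fin n) :
    Continuous fun F : L2vec Ω => ∫ x, ψ x • (F x) j ∂(vol Ω) := by
  have h := (continuous_integral_testFun_smul (Ω := Ω) hψ hc).comp
    ((EuclideanSpace.proj j : Cn n →L[ℂ] ℂ).compLpL 2 (vol Ω)).continuous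
  refine h.congr fun F => ?_
  refine integral_congr_ae ?_
  filter_upwards [(EuclideanSpace.proj j : Cn n →L[ℂ] ℂ).coeFn_compLpL F] with x hx
  rw [hx]
  rfl

lemma isClosed_weakGradGraph : IsClosed (weakGradGraph Ω : Set (L2 Ω × L2vec Ω)) := by
  have : (weakGradGraph Ω : Set (L2 Ω × L2vec Ω)) =
      ⋂ (φ : Rn n → ℝ) (_ : ContDiff ℝ ∞ φ) (_ : HasCompactSupport φ) (_ : tsupport φ ⊆ Ω)
        (j : Fin n), {p | ∫ x, (fderiv ℝ φ x (EuclideanSpace.single j 1)) • p.1 x ∂(vol Ω)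
        = - ∫ x, φ x • (p.2 x) j ∂(vol Ω)} := by
    ext p
    simp only [mem_iInter, mem_ofPred_eq, SetLike.mem_coe, mem_weakGradGraph]
  rw [this]
  refine isClosed_iInter fun φ => isClosed_iInter fun hφ => isClosed_iInter fun hc =>
    isClosed_iInter fun _ => isClosed_iInter fun j => isClosed_eq ?_ ?_
  · have hd : Continuous fun x => fderiv ℝ φ x (EuclideanSpace.single j 1) :=
      (hφ.continuous_fderiv (by simp)).clm_apply continuous_const
    have hdc : HasCompactSupport fun x => fderiv ℝ φ x (EuclideanSpace.single j 1) :=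
      hc.fderiv_apply (𝕜 := ℝ) _
    exact (continuous_integral_testFun_smul hd hdc).comp continuous_fst
  · exact ((continuous_integral_testFun_smul_proj hφ.continuous hc j).comp continuous_snd).neg

/-- The graph of the restriction of the weak gradient to `W`. -/
def restrictedGradGraph (Ω : Set (Rn n)) (W : Submodule ℂ (L2 Ω)) : Submodule ℂ (L2 Ω × L2vec Ω) :=
  weakGradGraph Ω ⊓ W.prod ⊤

/-- Weak gradients are unique, so passing to first components and restoring the gradients returns
the closed graph that defined the space. This is why the gradient on a Sobolev closure is a closed
operator. -/
lemma restrictedGradGraph_sobolevClosure (hΩ : IsOpen Ω) (D : Submodule ℂ (L2 Ω)) :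
    restrictedGradGraph Ω (sobolevClosure Ω D)
      = (weakGradGraph Ω ⊓ D.prod ⊤).topologicalClosure ⊓ weakGradGraph Ω := by
  ext p
  rw [restrictedGradGraph, sobolevClosure, weakGrad_graph hΩ]
  constructor
  · rintro ⟨h1, ⟨q, hq, hqp⟩, -⟩
    have hqp' : q.1 = p.1 := hqp
    have : q = p := by
      refine Prod.ext hqp' ?_
      have := snd_eq_zero_of_mem_weakGradGraph hΩ _ ((weakGradGraph Ω).sub_mem hq.2 h1)
        (sub_eq_zero.2 hqp')
      exact sub_eq_zero.1 this
    exact this ▸ hq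
  · rintro h
    exact ⟨h.2, ⟨p, h, rfl⟩, trivial⟩

lemma isClosed_restrictedGradGraph_sobolevClosure (hΩ : IsOpen Ω) (D : Submodule ℂ (L2 Ω)) :
    IsClosed (restrictedGradGraph Ω (sobolevClosure Ω D) : Set (L2 Ω × L2vec Ω)) := by
  rw [restrictedGradGraph_sobolevClosure hΩ]
  exact (Submodule.isClosed_topologicalClosure _).inter isClosed_weakGradGraph

lemma restrictedGradGraph_W12 (hΩ : IsOpen Ω) :
    restrictedGradGraph Ω (W12 Ω) = weakGradGraph Ω := by
  refine le_antisymm inf_le_left fun p hp => ⟨hp, ?_, trivial⟩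
  rw [← weakGrad_graph hΩ] at hp
  exact LinearPMap.mem_domain_of_mem_graph hp

lemma isClosed_restrictedGradGraph_W12 (hΩ : IsOpen Ω) :
    IsClosed (restrictedGradGraph Ω (W12 Ω) : Set (L2 Ω × L2vec Ω)) := by
  rw [restrictedGradGraph_W12 hΩ]
  exact isClosed_weakGradGraph

lemma mem_weakGradGraph_weakGrad (hΩ : IsOpen Ω) {f : L2 Ω} (hf : f ∈ W12 Ω) :
    (f, weakGrad Ω ⟨f, hf⟩) ∈ weakGradGraph Ω := by
  rw [← weakGrad_graph hΩ]
  exact (weakGrad Ω).mem_graph ⟨f, hf⟩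

lemma weakGrad_eq (hΩ : IsOpen Ω) {f : L2 Ω} {F : L2vec Ω} (h : (f, F) ∈ weakGradGraph Ω) :
    ∃ hf : f ∈ W12 Ω, weakGrad Ω ⟨f, hf⟩ = F := by
  rw [← weakGrad_graph hΩ] at h
  obtain ⟨y, hy1, hy2⟩ := (LinearPMap.mem_graph_iff _).1 h
  dsimp only at hy1 hy2
  subst hy1
  exact ⟨y.2, hy2⟩

/-! ### Smooth functions -/

/-- The gradient of a smooth function. -/
def classicalGrad (φ : Rn n → ℂ) (x : Rn n) : Cn n :=
  WithLp.toLp 2 fun j => fderiv ℝ φ x (EuclideanSpace.single j 1)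

lemma classicalGrad_apply (φ : Rn n → ℂ) (x : Rn n) (j : Fin n) :
    classicalGrad φ x j = fderiv ℝ φ x (EuclideanSpace.single j 1) := rfl

lemma continuous_classicalGrad {φ : Rn n → ℂ} (hφ : ContDiff ℝ 1 φ) :
    Continuous (classicalGrad φ) :=
  (PiLp.continuous_toLp 2 _).comp (continuous_pi fun _ =>
    (hφ.continuous_fderiv (by simp)).clm_apply continuous_const)

lemma hasCompactSupport_classicalGrad {φ : Rn n → ℂ} (hc : HasCompactSupport φ) :
    HasCompactSupport (classicalGrad φ) := by
  refine (hc.fderiv (𝕜 := ℝ)).mono fun x hx => ?_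
  rw [Function.mem_support] at hx ⊢
  intro h
  refine hx ?_
  ext j
  simp [classicalGrad_apply, h]

/-- Integration by parts. -/
lemma integral_fderiv_smul_eq_neg {φ : Rn n → ℂ} (hφ : ContDiff ℝ 1 φ)
    {ψ : Rn n → ℝ} (hψ : ContDiff ℝ 1 ψ) (hcψ : HasCompactSupport ψ) (v : Rn n) :
    ∫ x, fderiv ℝ ψ x v • φ x = - ∫ x, ψ x • fderiv ℝ φ x v := by
  have hd : Continuous fun x => fderiv ℝ φ x v :=
    (hφ.continuous_fderiv (by simp)).clm_apply continuous_const
  have hd' : Continuous fun x => fderiv ℝ ψ x v :=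
    (hψ.continuous_fderiv (by simp)).clm_apply continuous_const
  rw [eq_neg_iff_add_eq_zero, add_comm, ← eq_neg_iff_add_eq_zero]
  refine integral_smul_fderiv_eq_neg_fderiv_smul_of_integrable ?_ ?_ ?_
    (fun x _ => hψ.differentiable (by simp) x) (fun x _ => hφ.differentiable (by simp) x)
  · exact (hd'.smul hφ.continuous).integrable_of_hasCompactSupport
      ((hcψ.fderiv_apply (𝕜 := ℝ) v).smul_right)
  · exact (hψ.continuous.smul hd).integrable_of_hasCompactSupport hcψ.smul_right
  · exact (hψ.continuous.smul hφ.continuous).integrable_of_hasCompactSupport hcψ.smul_right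

lemma mem_weakGradGraph_of_contDiff {φ : Rn n → ℂ} (hφ : ContDiff ℝ 1 φ)
    {f : L2 Ω} {F : L2vec Ω} (hf : f =ᵐ[vol Ω] φ) (hF : F =ᵐ[vol Ω] classicalGrad φ) :
    (f, F) ∈ weakGradGraph Ω := by
  intro ψ hψ hcψ hs j
  have e1 : ∫ x, (fderiv ℝ ψ x (EuclideanSpace.single j 1)) • f x ∂(vol Ω)
      = ∫ x, (fderiv ℝ ψ x (EuclideanSpace.single j 1)) • φ x := by
    rw [integral_congr_ae (g := fun x => (fderiv ℝ ψ x (EuclideanSpace.single j 1)) • φ x)]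
    · refine setIntegral_eq_integral_of_forall_compl_eq_zero fun x hx => ?_
      have : fderiv ℝ ψ x = 0 := image_eq_zero_of_notMem_tsupport fun hx' =>
        hx (hs (tsupport_fderiv_subset ℝ hx'))
      rw [this, zero_apply, zero_smul]
    · filter_upwards [hf] with x hx
      rw [hx]
  have e2 : ∫ x, ψ x • (F x) j ∂(vol Ω)
      = ∫ x, ψ x • fderiv ℝ φ x (EuclideanSpace.single j 1) := by
    rw [integral_congr_ae (g := fun x => ψ x • fderiv ℝ φ x (EuclideanSpace.single j 1))]
    · refine setIntegral_eq_integral_of_forall_compl_eq_zero fun x hx => ?_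
      rw [image_eq_zero_of_notMem_tsupport fun hx' => hx (hs hx'), zero_smul]
    · filter_upwards [hF] with x hx
      rw [hx, classicalGrad_apply]
  rw [e1, e2]
  exact integral_fderiv_smul_eq_neg hφ (hψ.of_le (by simp)) hcψ _

lemma testRestrictions_mem {U : Set (Rn n)} {f : L2 Ω} (hf : f ∈ testRestrictions Ω U) :
    ∃ φ : Rn n → ℂ, ∃ F : L2vec Ω, ContDiff ℝ ∞ φ ∧ HasCompactSupport φ ∧ tsupport φ ⊆ U ∧
      f =ᵐ[vol Ω] φ ∧ F =ᵐ[vol Ω] classicalGrad φ ∧ (f, F) ∈ weakGradGraph Ω := by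
  obtain ⟨φ, h1, h2, h3, h4⟩ := hf
  have h1' : ContDiff ℝ 1 φ := h1.of_le (by simp)
  have hm : MemLp (classicalGrad φ) 2 (vol Ω) :=
    (continuous_classicalGrad h1').memLp_of_hasCompactSupport (hasCompactSupport_classicalGrad h2)
  exact ⟨φ, hm.toLp _, h1, h2, h3, h4, hm.coeFn_toLp,
    mem_weakGradGraph_of_contDiff h1' h4 hm.coeFn_toLp⟩

lemma testRestrictions_mono {U U' : Set (Rn n)} (h : U ⊆ U') :
    testRestrictions Ω U ≤ testRestrictions Ω U' := fun _ ⟨φ, h1, h2, h3, h4⟩ =>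
  ⟨φ, h1, h2, h3.trans h, h4⟩

lemma testRestrictions_le_W12 (hΩ : IsOpen Ω) (U : Set (Rn n)) :
    testRestrictions Ω U ≤ W12 Ω := fun f hf => by
  obtain ⟨_, F, -, -, -, -, -, h⟩ := testRestrictions_mem hf
  exact (weakGrad_eq hΩ h).1

lemma le_sobolevClosure {D : Submodule ℂ (L2 Ω)} (h : D ≤ W12 Ω) : D ≤ sobolevClosure Ω D := by
  intro f hf
  have hg := (weakGrad Ω).mem_graph ⟨f, h hf⟩
  exact ⟨_, ⟨Submodule.le_topologicalClosure _ ⟨hg, hf, trivial⟩, hg⟩, rfl⟩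

lemma eq_zero_of_orthogonal_testRestrictions (hΩ : IsOpen Ω) (f : L2 Ω)
    (h : ∀ g ∈ testRestrictions Ω Ω, ⟪g, f⟫_ℂ = 0) : f = 0 := by
  have h1 : f =ᵐ[vol Ω] 0 := by
    refine ae_eq_zero_of_forall_testFun hΩ (Lp.memLp f) fun φ hφ hc hs => ?_
    have hm : MemLp (fun x => (φ x : ℂ)) 2 (vol Ω) :=
      (hφ.continuous.memLp_of_hasCompactSupport hc).ofReal
    have hmem : hm.toLp _ ∈ testRestrictions Ω Ω :=
      ⟨fun x => (φ x : ℂ), Complex.ofRealCLM.contDiff.comp hφ, hc.comp_left Complex.ofReal_zero,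
        (tsupport_comp_subset Complex.ofReal_zero φ).trans hs, hm.coeFn_toLp⟩
    rw [← h _ hmem, L2.inner_def]
    refine integral_congr_ae ?_
    filter_upwards [hm.coeFn_toLp] with x hx
    rw [hx]
    simp [mul_comm]
  refine Lp.ext ?_
  filter_upwards [h1, Lp.coeFn_zero ℂ 2 (vol Ω)] with x hx h0
  rw [hx, h0]

end WeakGradient

/-! ### Reduction of the form bounds to an estimate for the potential -/

section FormBounds

variable {n : ℕ} {Ω : Set (Rn n)}

lemma mulOp_graph_mem {h : Rn n → ℂ} (f : (mulOp Ω h).domain) :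
    mulOp Ω h f =ᵐ[vol Ω] fun x => h x * (f : L2 Ω) x := by
  refine Submodule.mem_graph_toLinearPMap (fun p hp hp1 => ?_) f
  have hp' : p.2 =ᵐ[vol Ω] fun x => h x * p.1 x := hp
  refine Lp.ext ?_
  rw [hp1] at hp'
  filter_upwards [hp', Lp.coeFn_zero ℂ 2 (vol Ω)] with x hx h0
  rw [hx, h0, Pi.zero_apply, mul_zero]

lemma mem_mulOp_domain {h : Rn n → ℂ} {f : L2 Ω} (hf : MemLp (fun x => h x * f x) 2 (vol Ω)) :
    f ∈ (mulOp Ω h).domain :=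
  ⟨(f, hf.toLp _), hf.coeFn_toLp, rfl⟩

lemma norm_mulOp {h : Rn n → ℂ} (f : (mulOp Ω h).domain) :
    ENNReal.ofReal ‖mulOp Ω h f‖ = eLpNorm (fun x => h x * (f : L2 Ω) x) 2 (vol Ω) := by
  rw [ofReal_norm, Lp.enorm_def, eLpNorm_congr_ae (mulOp_graph_mem f)]

lemma norm_potentialForm_le {V : Rn n → ℂ} (hV : AEStronglyMeasurable V (vol Ω))
    (f : (absSqrtOp Ω V).domain) :
    ‖(potentialForm Ω hV).form f f‖ ≤ ‖absSqrtOp Ω V f‖ ^ 2 := by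
  change ‖∫ x, ⟪absSqrtOp Ω V f x, phase (V x) * absSqrtOp Ω V f x⟫_ℂ ∂(vol Ω)‖ ≤ _
  have h1 : ‖absSqrtOp Ω V f‖ ^ 2 = ∫ x, ‖absSqrtOp Ω V f x‖ ^ 2 ∂(vol Ω) := by
    have := inner_self_eq_norm_sq (𝕜 := ℂ) (absSqrtOp Ω V f)
    rw [← this, L2.inner_def, ← integral_re (L2.integrable_inner _ _)]
    exact integral_congr_ae (Filter.Eventually.of_forall fun x =>
      inner_self_eq_norm_sq (𝕜 := ℂ) _)
  rw [h1]
  refine norm_integral_le_of_norm_le ?_ (Filter.Eventually.of_forall fun x => ?_)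
  · exact (Lp.memLp (absSqrtOp Ω V f)).integrable_norm_pow two_ne_zero
  · refine (norm_inner_le_norm _ _).trans (le_of_eq ?_)
    rw [norm_mul, phase, Complex.norm_exp_ofReal_mul_I, one_mul, sq]

variable {a : Rn n → Matrix (Fin n) (Fin n) ℂ} {a₁ a₂ : ℝ}

lemma ellipticForm_apply (ha : IsElliptic Ω a a₁ a₂) (W : Submodule ℂ (L2 Ω)) (hW : W ≤ W12 Ω)
    (f g : W) : (ellipticForm Ω ha W hW).form f g =
      ∫ x, ⟪weakGrad Ω ⟨f, hW f.2⟩ x,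
        Matrix.toEuclideanCLM (𝕜 := ℂ) (a x) (weakGrad Ω ⟨g, hW g.2⟩ x)⟫_ℂ ∂(vol Ω) := rfl

lemma norm_sq_eq_integral (F : L2vec Ω) : ‖F‖ ^ 2 = ∫ x, ‖F x‖ ^ 2 ∂(vol Ω) := by
  rw [← inner_self_eq_norm_sq (𝕜 := ℂ) F, L2.inner_def, ← integral_re (L2.integrable_inner _ _)]
  exact integral_congr_ae (Filter.Eventually.of_forall fun x => inner_self_eq_norm_sq (𝕜 := ℂ) _)

lemma ellipticForm_re_ge (ha : IsElliptic Ω a a₁ a₂) (W : Submodule ℂ (L2 Ω)) (hW : W ≤ W12 Ω)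
    (f : W) : a₁ * ‖weakGrad Ω ⟨f, hW f.2⟩‖ ^ 2 ≤ ((ellipticForm Ω ha W hW).form f f).re := by
  rw [ellipticForm_apply, norm_sq_eq_integral, ← integral_const_mul]
  refine le_trans ?_ (integral_re (ha.integrable _ _)).le
  refine integral_mono_ae ?_ (ha.integrable _ _).re ?_
  · exact ((Lp.memLp _).integrable_norm_pow two_ne_zero).const_mul _
  · filter_upwards [ha.lower] with x hx using hx _

lemma norm_ellipticForm_le (ha : IsElliptic Ω a a₁ a₂) (W : Submodule ℂ (L2 Ω)) (hW : W ≤ W12 Ω)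
    (f : W) : ‖(ellipticForm Ω ha W hW).form f f‖ ≤ a₂ * ‖weakGrad Ω ⟨f, hW f.2⟩‖ ^ 2 := by
  rw [ellipticForm_apply, norm_sq_eq_integral, ← integral_const_mul]
  refine norm_integral_le_of_norm_le ?_ ?_
  · exact ((Lp.memLp _).integrable_norm_pow two_ne_zero).const_mul _
  · filter_upwards [ha.upper] with x hx
    refine (hx _ _).trans (le_of_eq ?_)
    ring

lemma ellipticForm_one_apply (W : Submodule ℂ (L2 Ω)) (hW : W ≤ W12 Ω) (f g : W) :
    (ellipticForm Ω (isElliptic_one Ω) W hW).form f g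
      = ⟪weakGrad Ω ⟨f, hW f.2⟩, weakGrad Ω ⟨g, hW g.2⟩⟫_ℂ := by
  rw [ellipticForm_apply, L2.inner_def]
  refine integral_congr_ae (Filter.Eventually.of_forall fun x => ?_)
  simp only [map_one]
  rfl

lemma ellipticForm_isSectorial (ha : IsElliptic Ω a a₁ a₂) (W : Submodule ℂ (L2 Ω))
    (hW : W ≤ W12 Ω) : (ellipticForm Ω ha W hW).IsSectorial := by
  have h2 : 0 ≤ a₂ := ha.pos.le.trans ha.le
  refine ⟨0, a₂ / a₁, div_nonneg h2 ha.pos.le, fun u => ?_⟩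
  have h1 := ellipticForm_re_ge ha W hW u
  have h3 := norm_ellipticForm_le ha W hW u
  simp only [zero_mul, sub_zero]
  refine ⟨le_trans (mul_nonneg ha.pos.le (sq_nonneg _)) h1, ?_⟩
  refine (Complex.abs_im_le_norm _).trans (h3.trans ?_)
  rw [div_mul_eq_mul_div, le_div_iff₀ ha.pos, mul_assoc, mul_comm _ a₁]
  exact mul_le_mul_of_nonneg_left h1 h2

/-- Ellipticity makes `Re q_a` comparable to `‖∇f‖²`, so closedness of the form is closedness of the
gradient on `W`. -/
lemma ellipticForm_isClosed (hΩ : IsOpen Ω) (ha : IsElliptic Ω a a₁ a₂) (W : Submodule ℂ (L2 Ω))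
    (hW : W ≤ W12 Ω) (hcl : IsClosed (restrictedGradGraph Ω W : Set (L2 Ω × L2vec Ω))) :
    (ellipticForm Ω ha W hW).IsClosed := by
  intro (s : ℕ → W) u hs hcauchy
  let G : W → L2vec Ω := fun f => weakGrad Ω ⟨f, hW f.2⟩
  have hGsub : ∀ f g : W, G (f - g) = G f - G g := fun f g =>
    (weakGrad Ω).map_sub ⟨f, hW f.2⟩ ⟨g, hW g.2⟩
  have hGmem : ∀ f : W, ((f : L2 Ω), G f) ∈ restrictedGradGraph Ω W := fun f =>
    ⟨mem_weakGradGraph_weakGrad hΩ (hW f.2), f.2, trivial⟩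
  have h1 : Filter.Tendsto (fun p : ℕ × ℕ => ‖G (s p.1) - G (s p.2)‖ ^ 2) Filter.atTop
      (nhds 0) := by
    have h2 := hcauchy.const_mul a₁⁻¹
    rw [mul_zero] at h2
    refine squeeze_zero (fun _ => sq_nonneg _) (fun p => ?_) h2
    have := ellipticForm_re_ge ha W hW (s p.1 - s p.2)
    rw [inv_mul_eq_div, le_div_iff₀ ha.pos, mul_comm, ← hGsub]
    exact this
  have hc : CauchySeq fun k => G (s k) := by
    rw [Metric.cauchySeq_iff]
    intro ε hε
    have h2 := (h1.eventually_lt_const (show (0 : ℝ) < ε ^ 2 by positivity))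
    obtain ⟨⟨N, M⟩, hN⟩ := Filter.eventually_atTop.1 h2
    refine ⟨max N M, fun k hk l hl => ?_⟩
    rw [dist_eq_norm]
    exact lt_of_pow_lt_pow_left₀ 2 hε.le
      (hN (k, l) ⟨(le_max_left _ _).trans hk, (le_max_right _ _).trans hl⟩)
  obtain ⟨U, hU⟩ := cauchySeq_tendsto_of_complete hc
  have hmem : (u, U) ∈ restrictedGradGraph Ω W :=
    hcl.mem_of_tendsto (hs.prodMk_nhds hU) (Filter.Eventually.of_forall fun k => hGmem (s k))
  have hu : u ∈ W := hmem.2.1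
  refine ⟨hu, ?_⟩
  have hGu : G ⟨u, hu⟩ = U := (weakGrad_eq hΩ hmem.1).2
  have h3 : Filter.Tendsto (fun k => a₂ * ‖G (s k) - U‖ ^ 2) Filter.atTop (nhds 0) := by
    have := ((tendsto_iff_norm_sub_tendsto_zero.1 hU).pow 2).const_mul a₂
    simpa using this
  refine squeeze_zero (fun k => ?_) (fun k => ?_) h3
  · exact le_trans (mul_nonneg ha.pos.le (sq_nonneg _)) (ellipticForm_re_ge ha W hW _)
  · have := (Complex.re_le_norm _).trans (norm_ellipticForm_le ha W hW (s k - ⟨u, hu⟩))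
    rw [← hGu, ← hGsub]
    exact this

lemma eq_zero_of_orthogonal (hΩ : IsOpen Ω) {W : Submodule ℂ (L2 Ω)}
    (hD : testRestrictions Ω Ω ≤ W) (f : L2 Ω) (h : ∀ g ∈ W, ⟪g, f⟫_ℂ = 0) : f = 0 :=
  eq_zero_of_orthogonal_testRestrictions hΩ f fun g hg => h g (hD hg)

lemma dense_of_testRestrictions_le (hΩ : IsOpen Ω) {W : Submodule ℂ (L2 Ω)}
    (hD : testRestrictions Ω Ω ≤ W) : Dense (W : Set (L2 Ω)) := by
  rw [Submodule.dense_iff_topologicalClosure_eq_top, Submodule.topologicalClosure_eq_top_iff,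
    Submodule.eq_bot_iff]
  exact fun x hx => eq_zero_of_orthogonal hΩ hD x fun g hg =>
    Submodule.inner_right_of_mem_orthogonal hg hx

/-- For `a = 1` the form is `⟪∇f, ∇g⟫`, and its associated operator is `A*A` by definition. The
density of `W` makes the operator graph single-valued, so that it is the graph of `negLaplacian`. -/
lemma negLaplacian_graph (hΩ : IsOpen Ω) {W : Submodule ℂ (L2 Ω)} (hW : W ≤ W12 Ω)
    (hD : testRestrictions Ω Ω ≤ W) :
    ((negLaplacian Ω W hW).graph : Set (L2 Ω × L2 Ω)) = gramGraph (restrictedGradGraph Ω W) := by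
  have h1 : (negLaplacian Ω W hW).graph
      = (ellipticForm Ω (isElliptic_one Ω) W hW).operatorGraph := by
    refine Submodule.toLinearPMap_graph_eq _ fun p hp hp1 => ?_
    obtain ⟨hv, h⟩ := hp
    refine eq_zero_of_orthogonal hΩ hD _ fun g hg => ?_
    have h0 : (⟨p.1, hv⟩ : W) = 0 := Subtype.ext hp1
    have h2 : (ellipticForm Ω (isElliptic_one Ω) W hW).form ⟨g, hg⟩ (0 : W) = ⟪g, p.2⟫_ℂ :=
      h0 ▸ h ⟨g, hg⟩
    exact h2.symm.trans (map_zero _)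
  rw [h1]
  ext ⟨x, y⟩
  constructor
  · rintro ⟨hv, h⟩
    refine ⟨weakGrad Ω ⟨x, hW hv⟩, ⟨mem_weakGradGraph_weakGrad hΩ (hW hv), hv, trivial⟩,
      fun w hw => ?_⟩
    obtain ⟨_, hw2⟩ := weakGrad_eq hΩ hw.1
    rw [← hw2]
    exact (ellipticForm_one_apply W hW ⟨w.1, hw.2.1⟩ ⟨x, hv⟩).symm.trans (h ⟨w.1, hw.2.1⟩)
  · rintro ⟨k, hk, h⟩
    have hx : x ∈ W := hk.2.1
    refine ⟨hx, fun w => ?_⟩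
    obtain ⟨_, hk2⟩ := weakGrad_eq hΩ hk.1
    refine (ellipticForm_one_apply W hW w ⟨x, hx⟩).trans ?_
    dsimp only at hk2
    rw [hk2]
    exact h (w, weakGrad Ω ⟨w, hW w.2⟩) ⟨mem_weakGradGraph_weakGrad hΩ (hW w.2), w.2, trivial⟩

/-- For a closed `W` containing the test functions, the two form bounds follow from an
infinitesimal bound of `|V|^{1/2}` by the gradient on `W`. -/
theorem formBounds_of_absSqrtOp_bound (hΩ : IsOpen Ω) {V : Rn n → ℂ}
    (hV : AEStronglyMeasurable V (vol Ω)) (W : Submodule ℂ (L2 Ω)) (hW : W ≤ W12 Ω)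
    (hcl : IsClosed (restrictedGradGraph Ω W : Set (L2 Ω × L2vec Ω)))
    (hD : testRestrictions Ω Ω ≤ W)
    (hb : ∀ ε : ℝ, 0 < ε → ∃ η : ℝ, 0 ≤ η ∧ ∀ f F, f ∈ W → (f, F) ∈ weakGradGraph Ω →
      ∃ hv : f ∈ (absSqrtOp Ω V).domain,
        ‖absSqrtOp Ω V ⟨f, hv⟩‖ ^ 2 ≤ ε * ‖F‖ ^ 2 + η * ‖f‖ ^ 2) :
    LaplacianFormBound Ω hV W hW ∧ EllipticFormBound Ω hV W hW := by
  have hdense := dense_of_testRestrictions_le hΩ hD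
  have hb' : ∀ ε : ℝ, ∃ η : ℝ, 0 < ε → 0 ≤ η ∧ ∀ f F, f ∈ W → (f, F) ∈ weakGradGraph Ω →
      ∃ hv : f ∈ (absSqrtOp Ω V).domain,
        ‖absSqrtOp Ω V ⟨f, hv⟩‖ ^ 2 ≤ ε * ‖F‖ ^ 2 + η * ‖f‖ ^ 2 := fun ε => by
    by_cases hε : 0 < ε
    · obtain ⟨η, hη⟩ := hb ε hε
      exact ⟨η, fun _ => hη⟩
    · exact ⟨0, fun h => absurd h hε⟩
  choose η hη using hb'
  have hell : EllipticFormBound Ω hV W hW := by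
    intro a₁ ha₁
    -- The gradient bound is used with parameter `ε a₁`, and `a₁ ‖∇f‖² ≤ Re q_a(f, f)`. The function
    -- depends on the coefficients only through `a₁`.
    refine ⟨fun ε => η (ε * a₁), fun ε hε => (hη _ (mul_pos hε ha₁)).1, fun a₂ a ha => ?_⟩
    have hmain : ∀ ε, 0 < ε → ∀ (f : L2 Ω) (hf : f ∈ W),
        ∃ hv : f ∈ (absSqrtOp Ω V).domain, ‖absSqrtOp Ω V ⟨f, hv⟩‖ ^ 2 ≤
          ε * ((ellipticForm Ω ha W hW).form ⟨f, hf⟩ ⟨f, hf⟩).re + η (ε * a₁) * ‖f‖ ^ 2 := by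
      intro ε hε f hf
      obtain ⟨hv, h⟩ := (hη _ (mul_pos hε ha₁)).2 f _ hf (mem_weakGradGraph_weakGrad hΩ (hW hf))
      refine ⟨hv, h.trans (add_le_add_left ?_ _)⟩
      rw [mul_assoc]
      exact mul_le_mul_of_nonneg_left (ellipticForm_re_ge ha W hW ⟨f, hf⟩) hε.le
    refine ⟨⟨ellipticForm Ω ha W hW, hdense, ellipticForm_isSectorial ha W hW,
      ellipticForm_isClosed hΩ ha W hW hcl, rfl, fun f hf => (hmain 1 one_pos f hf).1,
      fun α hα => ⟨η (α * a₁), (hη _ (mul_pos hα ha₁)).1, fun u ht hu => ?_⟩⟩, hmain⟩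
    obtain ⟨hv, h⟩ := hmain α hα u ht
    refine (norm_potentialForm_le hV ⟨u, hu⟩).trans (h.trans (add_le_add_left ?_ _))
    exact mul_le_mul_of_nonneg_left (Complex.re_le_norm _) hα.le
  refine ⟨⟨?_, ?_⟩, hell⟩
  · obtain ⟨_, -, h⟩ := hell 1 one_pos
    exact (h 1 _ (isElliptic_one Ω)).1
  · have hfun : ∀ k, ((0 : L2 Ω), k) ∈ restrictedGradGraph Ω W → k = 0 := fun k hk =>
      snd_eq_zero_of_mem_weakGradGraph hΩ _ hk.1 rfl
    have hort : ∀ x : L2 Ω, (∀ w ∈ restrictedGradGraph Ω W, ⟪w.1, x⟫_ℂ = 0) → x = 0 :=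
      fun x hx => eq_zero_of_orthogonal hΩ hD x fun g hg =>
        hx (g, weakGrad Ω ⟨g, hW hg⟩) ⟨mem_weakGradGraph_weakGrad hΩ (hW hg), hg, trivial⟩
    obtain ⟨hdom, hnorm⟩ := opSqrt_of_gramGraph hcl hfun hort (negLaplacian_graph hΩ hW hD)
    have hdom' : (opSqrt (negLaplacian Ω W hW)).domain = W := by
      ext x
      rw [hdom]
      exact ⟨fun ⟨k, hk⟩ => hk.2.1, fun hx =>
        ⟨_, mem_weakGradGraph_weakGrad hΩ (hW hx), hx, trivial⟩⟩
    refine ⟨hdom', η, fun ε hε => (hη ε hε).1, fun ε hε f hf => ?_⟩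
    have hg := mem_weakGradGraph_weakGrad hΩ (hW hf)
    obtain ⟨hv, h⟩ := (hη ε hε).2 f _ hf hg
    have hs : f ∈ (opSqrt (negLaplacian Ω W hW)).domain := hdom'.ge hf
    refine ⟨hv, hs, ?_⟩
    rw [hnorm ⟨f, hs⟩ _ ⟨hg, hf, trivial⟩]
    exact h

end FormBounds

/-! ### Critical potentials and Sobolev bounds -/

/-- The Sobolev exponent `2 n / (n - 2)`, with value `∞` for `n ≤ 2`. -/
def sobolevExp (n : ℕ) : ℝ≥0∞ := ((2 : ℝ≥0∞)⁻¹ - (n : ℝ≥0∞)⁻¹)⁻¹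

/-- The Sobolev embedding `W ⊆ L^r(Ω)`, `r` the Sobolev exponent, for `W ⊆ W^{1,2}(Ω)`. -/
def HasSobolevBound {n : ℕ} (Ω : Set (Rn n)) (W : Submodule ℂ (L2 Ω)) : Prop :=
  ∃ C : ℝ≥0, ∀ (f : L2 Ω) (F : L2vec Ω), f ∈ W → (f, F) ∈ weakGradGraph Ω →
    eLpNorm f (sobolevExp n) (vol Ω) ≤ C * (‖f‖ₑ + ‖F‖ₑ)

section Potential

variable {n : ℕ} {Ω : Set (Rn n)}

/-- For `n ≥ 3`, `1/(2q) = 1/n` is the amount subtracted from `1/2` in `sobolevExp`. For `n = 1` the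
truncated difference is `0`, so `r = ∞` and `2q = 2`. -/
lemma holderTriple_sobolevExp (hn : 1 ≤ n) (hn2 : n ≠ 2) :
    ENNReal.HolderTriple (2 * (if n = 1 then 1 else (n : ℝ≥0∞) / 2)) (sobolevExp n) 2 := by
  constructor
  rw [sobolevExp, inv_inv]
  rcases lt_or_ge n 2 with h | h
  · have h1 : (2 : ℝ≥0∞)⁻¹ - (n : ℝ≥0∞)⁻¹ = 0 := by
      rw [tsub_eq_zero_iff_le, ENNReal.inv_le_inv]
      exact_mod_cast h.le
    rw [h1, add_zero]
    interval_cases n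
    simp
  · have h1 : n ≠ 1 := by omega
    rw [if_neg h1, ENNReal.mul_div_cancel two_ne_zero ENNReal.ofNat_ne_top]
    refine add_tsub_cancel_of_le ?_
    rw [ENNReal.inv_le_inv]
    exact_mod_cast h

/-- A critical potential is, up to a bounded function, arbitrarily small in `L^q`. -/
lemma IsCriticalPotential.exists_small {V : Rn n → ℂ} (hV : IsCriticalPotential Ω V) {δ : ℝ}
    (hδ : 0 < δ) : ∃ (V' : Rn n → ℂ) (M : ℝ), AEStronglyMeasurable V' (vol Ω) ∧ 0 ≤ M ∧
      eLpNorm V' (if n = 1 then 1 else (n : ℝ≥0∞) / 2) (vol Ω) ≤ ENNReal.ofReal δ ∧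
      ∀ᵐ x ∂(vol Ω), ‖V x‖ ≤ ‖V' x‖ + M := by
  obtain ⟨V₁, V₂, h1, h2, hV⟩ := hV
  set U := h1.1.mk V₁ with hU
  have hUm : StronglyMeasurable U := h1.1.stronglyMeasurable_mk
  have hUV : V₁ =ᵐ[vol Ω] U := h1.1.ae_eq_mk
  obtain ⟨M, hM⟩ := ((memLp_congr_ae hUV).1 h1).eLpNorm_indicator_norm_ge_le hUm hδ
  have hms : MeasurableSet {x | M ≤ ‖U x‖₊} :=
    measurableSet_le measurable_const hUm.nnnorm.measurable.coe_nnreal_real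
  -- The large values of the `L^q` part are kept, and the rest is bounded. The level `M` is not
  -- known to be non-negative, hence `max M 0`.
  refine ⟨{x | M ≤ ‖U x‖₊}.indicator U, max M 0 + (eLpNorm V₂ ∞ (vol Ω)).toReal,
    (hUm.indicator hms).aestronglyMeasurable, by positivity, hM, ?_⟩
  have h3 : ∀ᵐ x ∂(vol Ω), ‖V₂ x‖ ≤ (eLpNorm V₂ ∞ (vol Ω)).toReal := by
    filter_upwards [enorm_ae_le_eLpNormEssSup V₂ (vol Ω)] with x hx
    rw [← eLpNorm_exponent_top] at hx
    rw [← toReal_enorm]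
    exact ENNReal.toReal_mono h2.2.ne hx
  filter_upwards [hV, hUV, h3] with x hx hxU hx3
  rw [hx, hxU]
  refine (norm_add_le _ _).trans ?_
  by_cases hxM : M ≤ ‖U x‖
  · rw [indicator_of_mem (show x ∈ {x | M ≤ ‖U x‖₊} from hxM)]
    have := le_max_right M 0
    linarith
  · rw [indicator_of_notMem (show x ∉ {x | M ≤ ‖U x‖₊} from hxM), norm_zero]
    have := le_max_left M 0
    linarith [not_le.1 hxM]

/-- Pointwise `√|V| ≤ √|V'| + √M`. The first term is estimated by Hölder with exponents `2q` and
`r`, using `‖√|V'|‖_{2q} = ‖V'‖_q^{1/2}`. -/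
lemma eLpNorm_sqrt_mul_le (hn : 1 ≤ n) (hn2 : n ≠ 2) {V V' : Rn n → ℂ} {M δ : ℝ}
    (hV' : AEStronglyMeasurable V' (vol Ω)) (hM : 0 ≤ M)
    (hδ0 : 0 ≤ δ) (hδ : eLpNorm V' (if n = 1 then 1 else (n : ℝ≥0∞) / 2) (vol Ω) ≤ ENNReal.ofReal δ)
    (hle : ∀ᵐ x ∂(vol Ω), ‖V x‖ ≤ ‖V' x‖ + M) {f : Rn n → ℂ}
    (hf : AEStronglyMeasurable f (vol Ω)) :
    eLpNorm (fun x => (Real.sqrt ‖V x‖ : ℂ) * f x) 2 (vol Ω)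
      ≤ ENNReal.ofReal (Real.sqrt δ) * eLpNorm f (sobolevExp n) (vol Ω)
        + ENNReal.ofReal (Real.sqrt M) * eLpNorm f 2 (vol Ω) := by
  have hs : AEStronglyMeasurable (fun x => ‖V' x‖ ^ (1 / 2 : ℝ)) (vol Ω) :=
    (hV'.norm.aemeasurable.pow_const _).aestronglyMeasurable
  have h1 : eLpNorm (fun x => (Real.sqrt ‖V x‖ : ℂ) * f x) 2 (vol Ω)
      ≤ eLpNorm ((fun x => ‖V' x‖ ^ (1 / 2 : ℝ)) • (fun x => ‖f x‖) +
          Real.sqrt M • fun x => ‖f x‖) 2 (vol Ω) := by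
    refine eLpNorm_mono_ae_real ?_
    filter_upwards [hle] with x hx
    rw [norm_mul, Complex.norm_real, Real.norm_of_nonneg (Real.sqrt_nonneg _)]
    change _ ≤ ‖V' x‖ ^ (1 / 2 : ℝ) * ‖f x‖ + Real.sqrt M * ‖f x‖
    rw [← add_mul]
    refine mul_le_mul_of_nonneg_right ?_ (norm_nonneg _)
    rw [← Real.sqrt_eq_rpow]
    refine (Real.sqrt_le_sqrt hx).trans (Real.sqrt_le_iff.2 ⟨by positivity, ?_⟩)
    rw [add_sq, Real.sq_sqrt (norm_nonneg _), Real.sq_sqrt hM]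
    have : 0 ≤ 2 * Real.sqrt ‖V' x‖ * Real.sqrt M := by positivity
    linarith
  refine h1.trans ((eLpNorm_add_le (hs.smul hf.norm) (hf.norm.const_smul _) one_le_two).trans ?_)
  refine add_le_add ?_ ?_
  · have := holderTriple_sobolevExp hn hn2
    refine (eLpNorm_smul_le_mul_eLpNorm (p := 2 * (if n = 1 then 1 else (n : ℝ≥0∞) / 2))
      (q := sobolevExp n) hf.norm hs).trans ?_
    rw [eLpNorm_norm]
    refine mul_le_mul_left ?_ _
    rw [eLpNorm_norm_rpow _ (by norm_num : (0 : ℝ) < 1 / 2)]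
    have h2 : ENNReal.ofReal (1 / 2 : ℝ) = 2⁻¹ := by
      rw [one_div, ENNReal.ofReal_inv_of_pos two_pos]; simp
    rw [h2, mul_comm (2 : ℝ≥0∞), mul_assoc, ENNReal.mul_inv_cancel two_ne_zero
      ENNReal.ofNat_ne_top, mul_one, Real.sqrt_eq_rpow,
      ← ENNReal.ofReal_rpow_of_nonneg hδ0 (by norm_num)]
    exact ENNReal.rpow_le_rpow hδ (by norm_num)
  · rw [eLpNorm_const_smul, eLpNorm_norm, Real.enorm_of_nonneg (Real.sqrt_nonneg _)]

/-- A Sobolev embedding for `W` makes critical potentials infinitesimally small on `W`. -/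
theorem HasSobolevBound.absSqrtOp_bound (hn : 1 ≤ n) (hn2 : n ≠ 2) {V : Rn n → ℂ}
    (hVm : AEStronglyMeasurable V (vol Ω)) (hV : IsCriticalPotential Ω V)
    {W : Submodule ℂ (L2 Ω)} (hS : HasSobolevBound Ω W) (ε : ℝ)
    (hε : 0 < ε) : ∃ η : ℝ, 0 ≤ η ∧ ∀ f F, f ∈ W → (f, F) ∈ weakGradGraph Ω →
      ∃ hv : f ∈ (absSqrtOp Ω V).domain,
        ‖absSqrtOp Ω V ⟨f, hv⟩‖ ^ 2 ≤ ε * ‖F‖ ^ 2 + η * ‖f‖ ^ 2 := by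
  obtain ⟨C, hC⟩ := hS
  -- Chosen so that `2 δ C² ≤ ε`, the factor `2` coming from `(a + b)² ≤ 2 a² + 2 b²` with `a = s C
  -- ‖F‖` and `b = (s C + m) ‖f‖`; the summand `1` allows `C = 0`.
  have hδ : 0 < ε / (2 * (C ^ 2 + 1) : ℝ) := by positivity
  set δ := ε / (2 * (C ^ 2 + 1) : ℝ) with hδ_def
  obtain ⟨V', M, hV'm, hM, hV', hle⟩ := hV.exists_small hδ
  set s := Real.sqrt δ
  set m := Real.sqrt M
  have hs0 : 0 ≤ s := Real.sqrt_nonneg _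
  have hm0 : 0 ≤ m := Real.sqrt_nonneg _
  refine ⟨2 * (s * C + m) ^ 2, by positivity, fun f F hf hF => ?_⟩
  have h1 := eLpNorm_sqrt_mul_le hn hn2 hV'm hM hδ.le hV' hle (Lp.memLp f).1
  have h2 : eLpNorm (fun x => (Real.sqrt ‖V x‖ : ℂ) * f x) 2 (vol Ω)
      ≤ ENNReal.ofReal (s * (C * (‖f‖ + ‖F‖)) + m * ‖f‖) := by
    refine h1.trans ?_
    rw [ENNReal.ofReal_add (by positivity) (by positivity), ENNReal.ofReal_mul hs0,
      ENNReal.ofReal_mul hm0, ENNReal.ofReal_mul C.coe_nonneg, ENNReal.ofReal_add (by positivity)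
      (by positivity), ofReal_norm, ofReal_norm, ENNReal.ofReal_coe_nnreal, ← Lp.enorm_def]
    gcongr
    exact hC f F hf hF
  have hv : f ∈ (absSqrtOp Ω V).domain := by
    refine mem_mulOp_domain ⟨?_, h2.trans_lt ENNReal.ofReal_lt_top⟩
    exact ((Complex.continuous_ofReal.comp (Real.continuous_sqrt.comp
      continuous_norm)).comp_aestronglyMeasurable hVm).mul (Lp.memLp f).1
  refine ⟨hv, ?_⟩
  have h3 : ‖absSqrtOp Ω V ⟨f, hv⟩‖ ≤ s * (C * (‖f‖ + ‖F‖)) + m * ‖f‖ := by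
    rw [← ENNReal.ofReal_le_ofReal_iff (by positivity)]
    exact (norm_mulOp ⟨f, hv⟩).le.trans h2
  have h4 : s ^ 2 * (2 * C ^ 2) ≤ ε := by
    rw [Real.sq_sqrt hδ.le, hδ_def, div_mul_eq_mul_div, div_le_iff₀ (by positivity)]
    nlinarith
  calc ‖absSqrtOp Ω V ⟨f, hv⟩‖ ^ 2 ≤ (s * C * ‖F‖ + (s * C + m) * ‖f‖) ^ 2 := by
        refine pow_le_pow_left₀ (norm_nonneg _) (h3.trans (le_of_eq ?_)) 2
        ring
    _ ≤ s ^ 2 * (2 * C ^ 2) * ‖F‖ ^ 2 + 2 * (s * C + m) ^ 2 * ‖f‖ ^ 2 := by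
        nlinarith [sq_nonneg (s * C * ‖F‖ - (s * C + m) * ‖f‖)]
    _ ≤ _ := by gcongr

/-- A Sobolev embedding for a closed `W` containing the test functions gives the form bounds. -/
theorem HasSobolevBound.formBounds (hn : 1 ≤ n) (hn2 : n ≠ 2) (hΩ : IsOpen Ω) {V : Rn n → ℂ}
    (hVm : AEStronglyMeasurable V (vol Ω)) (hV : IsCriticalPotential Ω V)
    {W : Submodule ℂ (L2 Ω)} (hW : W ≤ W12 Ω) (hS : HasSobolevBound Ω W)
    (hcl : IsClosed (restrictedGradGraph Ω W : Set (L2 Ω × L2vec Ω)))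
    (hD : testRestrictions Ω Ω ≤ W) :
    LaplacianFormBound Ω hVm W hW ∧ EllipticFormBound Ω hVm W hW :=
  formBounds_of_absSqrtOp_bound hΩ hVm W hW hcl hD (hS.absSqrtOp_bound hn hn2 hVm hV)

end Potential

/-! ### The Gagliardo-Nirenberg-Sobolev inequality on lower sets -/

section LowerSets

variable {ι : Type*} [Fintype ι] [DecidableEq ι] {F : Type*} [NormedAddCommGroup F]
  [NormedSpace ℝ F]

/-- On a lower set, a function is bounded by the integral of its derivative along the part of a
coordinate line in that set. -/
lemma enorm_le_lintegral_indicator_fderiv {G : Set (ι → ℝ)} (hG : IsLowerSet G) {u : (ι → ℝ) → F}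
    (hu : ContDiff ℝ 1 u) (hc : HasCompactSupport u) {x : ι → ℝ} (hx : x ∈ G) (i : ι) :
    ‖u x‖ₑ ≤ ∫⁻ t, G.indicator (fun y => ‖fderiv ℝ u y‖ₑ) (Function.update x i t) := by
  calc ‖u x‖ₑ ≤ ∫⁻ t in Iic (x i), ‖deriv (u ∘ Function.update x i) t‖ₑ := by
        refine le_trans (by simp) (HasCompactSupport.enorm_le_lintegral_Ici_deriv
          (hu.comp (by convert! contDiff_update 1 x i))
          (hc.comp_isClosedEmbedding (isClosedEmbedding_update x i)) (x i))
    _ ≤ ∫⁻ t in Iic (x i), G.indicator (fun y => ‖fderiv ℝ u y‖ₑ) (Function.update x i t) := by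
        refine setLIntegral_mono' measurableSet_Iic fun t ht => ?_
        have hmem : Function.update x i t ∈ G :=
          hG (update_le_self_iff.2 ht) hx
        rw [indicator_of_mem hmem, fderiv_comp_deriv _
          (hu.differentiable one_ne_zero).differentiableAt
          (hasDerivAt_update x i t).differentiableAt]
        refine (ContinuousLinearMap.le_opENorm _ _).trans ?_
        simp [deriv_update, Pi.enorm_single]
    _ ≤ _ := setLIntegral_le_lintegral _ _

/-- With `p = n/(n-1)`, `|u|^p` is a product of `n` factors `|u|^{1/(n-1)}`, and the `i`-th is
bounded by a line integral of `1_G |Du|` in direction `i`. The grid-lines inequality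
`lintegral_prod_lintegral_pow_le`, applied to `1_G |Du|`, then never sees the complement of `G`. -/
lemma lintegral_pow_le_of_isLowerSet {G : Set (ι → ℝ)} (hG : IsLowerSet G)
    (hGm : MeasurableSet G) {p : ℝ} (hp : Real.HolderConjugate (Fintype.card ι) p)
    {u : (ι → ℝ) → F} (hu : ContDiff ℝ 1 u) (hc : HasCompactSupport u) :
    ∫⁻ x in G, ‖u x‖ₑ ^ p ≤ (∫⁻ x in G, ‖fderiv ℝ u x‖ₑ) ^ p := by
  have hι : (1 : ℝ) ≤ (Fintype.card ι : ℝ) - 1 := by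
    have : (2 : ℝ) ≤ Fintype.card ι := by exact_mod_cast hp.lt
    linarith
  set f : (ι → ℝ) → ℝ≥0∞ := G.indicator fun y => ‖fderiv ℝ u y‖ₑ with hf
  have hfm : Measurable f :=
    (hu.continuous_fderiv one_ne_zero).enorm.measurable.indicator hGm
  calc ∫⁻ x in G, ‖u x‖ₑ ^ p
      ≤ ∫⁻ x in G, ∏ i, (∫⁻ t, f (Function.update x i t)) ^
          ((1 : ℝ) / ((Fintype.card ι : ℝ) - 1)) := by
        refine setLIntegral_mono' hGm fun x hx => ?_
        have h1 : ‖u x‖ₑ ^ p = ∏ _i : ι, ‖u x‖ₑ ^ ((1 : ℝ) / ((Fintype.card ι : ℝ) - 1)) := by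
          rw [Finset.prod_const, ← ENNReal.rpow_natCast, ← ENNReal.rpow_mul, hp.conjugate_eq]
          congr 1
          rw [Finset.card_univ]
          field_simp
        rw [h1]
        exact Finset.prod_le_prod' fun i _ => ENNReal.rpow_le_rpow
          (enorm_le_lintegral_indicator_fderiv hG hu hc hx i) (by positivity)
    _ ≤ ∫⁻ x, ∏ i, (∫⁻ t, f (Function.update x i t)) ^
          ((1 : ℝ) / ((Fintype.card ι : ℝ) - 1)) := setLIntegral_le_lintegral _ _
    _ ≤ (∫⁻ x, f x) ^ p := lintegral_prod_lintegral_pow_le _ hp hfm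
    _ = (∫⁻ x in G, ‖fderiv ℝ u x‖ₑ) ^ p := by rw [hf, lintegral_indicator hGm]

end LowerSets

/-! ### The Sobolev inequality with square integrable gradient on lower domains -/

lemma sobolevExp_one : sobolevExp 1 = ⊤ := by
  have : (2 : ℝ≥0∞)⁻¹ - ((1 : ℕ) : ℝ≥0∞)⁻¹ = 0 := by
    rw [tsub_eq_zero_iff_le, ENNReal.inv_le_inv]
    norm_num
  rw [sobolevExp, this, ENNReal.inv_zero]

lemma sobolevExp_toReal {n : ℕ} (hn : 3 ≤ n) :
    (sobolevExp n).toReal = 2 * n / (n - 2) := by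
  have h3 : (3 : ℝ) ≤ n := by exact_mod_cast hn
  rw [sobolevExp, ENNReal.toReal_inv, ENNReal.toReal_sub_of_le _ (by simp), ENNReal.toReal_inv,
    ENNReal.toReal_inv, ENNReal.toReal_natCast, ENNReal.toReal_ofNat]
  · have : (n : ℝ) - 2 ≠ 0 := by linarith
    field_simp
  · rw [ENNReal.inv_le_inv]
    exact_mod_cast (by omega : 2 ≤ n)

/-- The `L¹` inequality is applied to `|u|^γ`, `γ = 2(n-1)/(n-2) > 1`. Here `γ p = 2(γ - 1) = r`, so
Cauchy-Schwarz gives `I^{1/p} ≤ γ ‖Du‖₂ I^{1/2}` with `I = ∫_G |u|^r`, and `1/p - 1/2 = 1/r`. -/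
lemma eLpNorm_sobolevExp_le_of_isLowerSet {n : ℕ} (hn : 3 ≤ n) {G : Set (Fin n → ℝ)}
    (hG : IsLowerSet G) (hGm : MeasurableSet G) {u : (Fin n → ℝ) → ℂ} (hu : ContDiff ℝ 1 u)
    (hc : HasCompactSupport u) :
    eLpNorm u (sobolevExp n) (volume.restrict G)
      ≤ ENNReal.ofReal (2 * (n - 1) / (n - 2)) * eLpNorm (fderiv ℝ u) 2 (volume.restrict G) := by
  have h3 : (3 : ℝ) ≤ n := by exact_mod_cast hn
  have h1 : (0 : ℝ) < n - 1 := by linarith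
  have h2 : (0 : ℝ) < n - 2 := by linarith
  have h0 : (0 : ℝ) < n := by linarith
  set r : ℝ := 2 * n / (n - 2) with hr
  set γ : ℝ := 2 * (n - 1) / (n - 2) with hγ
  set p : ℝ := n / (n - 1) with hp
  have hr0 : 0 < r := by positivity
  have hγ1 : 1 < γ := by
    rw [hγ, one_lt_div h2]
    linarith
  have hp0 : 0 < p := by positivity
  have hconj : Real.HolderConjugate (Fintype.card (Fin n)) p := by
    rw [Fintype.card_fin, Real.holderConjugate_iff]
    refine ⟨by linarith, ?_⟩
    rw [hp]
    field_simp
    ring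
  have hγp : γ * p = r := by rw [hγ, hp, hr]; field_simp
  have hγ2 : (γ - 1) * 2 = r := by rw [hγ, hr]; field_simp; ring
  have hpr : 1 / p - 1 / 2 = 1 / r := by rw [hp, hr]; field_simp; ring
  set μ := (volume : Measure (Fin n → ℝ)).restrict G
  set I := ∫⁻ x, ‖u x‖ₑ ^ r ∂μ with hI
  have hr' : (sobolevExp n).toReal = r := sobolevExp_toReal hn
  have hne0 : sobolevExp n ≠ 0 := fun h => by rw [h] at hr'; simp at hr'; linarith
  have hneT : sobolevExp n ≠ ⊤ := fun h => by rw [h] at hr'; simp at hr'; linarith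
  rw [eLpNorm_eq_lintegral_rpow_enorm_toReal hne0 hneT, hr',
    eLpNorm_eq_lintegral_rpow_enorm_toReal two_ne_zero ENNReal.ofNat_ne_top, ENNReal.toReal_ofNat]
  change I ^ (1 / r) ≤ _
  by_cases hI0 : I = 0
  · rw [hI0, ENNReal.zero_rpow_of_pos (by positivity)]
    exact zero_le
  -- Needed to divide by `I^{1/2}` at the end; it comes from the compact support of `u`.
  have hIT : I ≠ ⊤ := by
    have := (hu.continuous.memLp_of_hasCompactSupport (p := sobolevExp n) (μ := μ) hc).2
    rw [eLpNorm_eq_lintegral_rpow_enorm_toReal hne0 hneT, hr'] at this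
    intro h
    rw [← hI, h, ENNReal.top_rpow_of_pos (by positivity)] at this
    exact this.ne rfl
  let v : (Fin n → ℝ) → ℝ := fun x => ‖u x‖ ^ γ
  have hv : ContDiff ℝ 1 v := hu.norm_rpow hγ1
  have hcv : HasCompactSupport v := hc.norm.rpow_const (by linarith)
  have hcont := hu.continuous
  have hcontd := hu.continuous_fderiv one_ne_zero
  have key : I ^ (1 / p) ≤ ENNReal.ofReal γ * (∫⁻ x, ‖fderiv ℝ u x‖ₑ ^ (2 : ℝ) ∂μ) ^ (1 / (2 : ℝ))
      * I ^ (1 / (2 : ℝ)) := by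
    calc I ^ (1 / p) = (∫⁻ x, ‖v x‖ₑ ^ p ∂μ) ^ (1 / p) := by
          refine congrArg (· ^ (1 / p)) (lintegral_congr fun x => ?_)
          rw [← hγp, ENNReal.rpow_mul, Real.enorm_rpow_of_nonneg (norm_nonneg _) (by linarith),
            enorm_norm]
      _ ≤ ((∫⁻ x, ‖fderiv ℝ v x‖ₑ ∂μ) ^ p) ^ (1 / p) :=
          ENNReal.rpow_le_rpow (lintegral_pow_le_of_isLowerSet hG hGm hconj hv hcv)
            (by positivity)
      _ = ∫⁻ x, ‖fderiv ℝ v x‖ₑ ∂μ := by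
          rw [← ENNReal.rpow_mul, mul_one_div_cancel hp0.ne', ENNReal.rpow_one]
      _ ≤ ∫⁻ x, ENNReal.ofReal γ * (‖u x‖ₑ ^ (γ - 1) * ‖fderiv ℝ u x‖ₑ) ∂μ := by
          refine lintegral_mono fun x => ?_
          have := enorm_fderiv_norm_rpow_le (p := γ.toNNReal) (x := x)
            (hu.differentiable one_ne_zero) (by rwa [← Real.toNNReal_one,
              Real.toNNReal_lt_toNNReal_iff (by linarith)])
          rw [Real.coe_toNNReal γ (by linarith)] at this
          rw [← mul_assoc]
          exact this
      _ = ENNReal.ofReal γ * ∫⁻ x, ‖u x‖ₑ ^ (γ - 1) * ‖fderiv ℝ u x‖ₑ ∂μ := by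
          rw [lintegral_const_mul]
          exact (hcont.enorm.measurable.pow_const _).mul hcontd.enorm.measurable
      _ ≤ ENNReal.ofReal γ * ((∫⁻ x, (‖u x‖ₑ ^ (γ - 1)) ^ (2 : ℝ) ∂μ) ^ (1 / (2 : ℝ)) *
          (∫⁻ x, ‖fderiv ℝ u x‖ₑ ^ (2 : ℝ) ∂μ) ^ (1 / (2 : ℝ))) := by
          gcongr
          exact ENNReal.lintegral_mul_le_Lp_mul_Lq μ Real.HolderConjugate.two_two
            (hcont.enorm.measurable.pow_const _).aemeasurable hcontd.enorm.aemeasurable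
      _ = _ := by
          simp_rw [← ENNReal.rpow_mul, hγ2]
          rw [← hI]
          ring
  have hI2 : I ^ (1 / (2 : ℝ)) ≠ 0 := (ENNReal.rpow_pos (pos_iff_ne_zero.2 hI0) hIT).ne'
  have hI2' : I ^ (1 / (2 : ℝ)) ≠ ⊤ := ENNReal.rpow_ne_top_of_nonneg (by norm_num) hIT
  rwa [← hpr, ENNReal.rpow_sub _ _ hI0 hIT, ENNReal.div_le_iff hI2 hI2']

/-- The bound along the line, applied to `|u|²`, gives `|u(x)|² ≤ 2 ∫_G |u| |u'| ≤ 2AB ≤ (A + B)²`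
for `x ∈ G`. -/
lemma eLpNorm_top_le_of_isLowerSet {G : Set (Fin 1 → ℝ)}
    (hG : IsLowerSet G) (hGm : MeasurableSet G) {u : (Fin 1 → ℝ) → ℂ} (hu : ContDiff ℝ 1 u)
    (hc : HasCompactSupport u) :
    eLpNorm u ⊤ (volume.restrict G)
      ≤ eLpNorm u 2 (volume.restrict G) + eLpNorm (fderiv ℝ u) 2 (volume.restrict G) := by
  set μ := (volume : Measure (Fin 1 → ℝ)).restrict G
  set A := eLpNorm u 2 μ
  set B := eLpNorm (fderiv ℝ u) 2 μ
  let v : (Fin 1 → ℝ) → ℝ := fun x => ‖u x‖ ^ (2 : ℝ)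
  have hv : ContDiff ℝ 1 v := hu.norm_rpow (by norm_num)
  have hcv : HasCompactSupport v := hc.norm.rpow_const (by norm_num)
  have hcont := hu.continuous
  have hcontd := hu.continuous_fderiv one_ne_zero
  rw [eLpNorm_exponent_top, eLpNormEssSup]
  refine essSup_le_of_ae_le _ ?_
  filter_upwards [ae_restrict_mem hGm] with x hx
  have h1 : ‖u x‖ₑ ^ (2 : ℝ) ≤ 2 * (A * B) := by
    calc ‖u x‖ₑ ^ (2 : ℝ) = ‖v x‖ₑ := by
          rw [Real.enorm_rpow_of_nonneg (norm_nonneg _) (by norm_num), enorm_norm]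
      _ ≤ ∫⁻ t, G.indicator (fun y => ‖fderiv ℝ v y‖ₑ) (Function.update x 0 t) :=
          enorm_le_lintegral_indicator_fderiv hG hv hcv hx 0
      _ = ∫⁻ y, G.indicator (fun y => ‖fderiv ℝ v y‖ₑ) y := by
          rw [← (volume_preserving_funUnique (Fin 1) ℝ).lintegral_comp_emb
            (MeasurableEquiv.measurableEmbedding _)]
          refine lintegral_congr fun y => ?_
          congr 1
          ext i
          rw [Subsingleton.elim i 0]
          simp
      _ = ∫⁻ y, ‖fderiv ℝ v y‖ₑ ∂μ := lintegral_indicator hGm _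
      _ ≤ ∫⁻ y, 2 * (‖u y‖ₑ * ‖fderiv ℝ u y‖ₑ) ∂μ := by
          refine lintegral_mono fun y => ?_
          have := enorm_fderiv_norm_rpow_le (p := 2) (x := y)
            (hu.differentiable one_ne_zero) (by norm_num)
          rw [← mul_assoc]
          refine this.trans (le_of_eq ?_)
          have h2 : ((2 : ℝ≥0) : ℝ) - 1 = 1 := by norm_num
          rw [h2, ENNReal.rpow_one]
          congr 2
      _ = 2 * ∫⁻ y, ‖u y‖ₑ * ‖fderiv ℝ u y‖ₑ ∂μ := by
          rw [lintegral_const_mul]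
          exact hcont.enorm.measurable.mul hcontd.enorm.measurable
      _ ≤ 2 * (A * B) := by
          gcongr
          have := ENNReal.lintegral_mul_le_Lp_mul_Lq μ Real.HolderConjugate.two_two
            hcont.enorm.aemeasurable hcontd.enorm.aemeasurable
          simp only [A, B, eLpNorm_eq_lintegral_rpow_enorm_toReal two_ne_zero
            ENNReal.ofNat_ne_top, ENNReal.toReal_ofNat]
          exact this
  have h2 : 2 * (A * B) ≤ (A + B) ^ (2 : ℝ) := by
    rw [ENNReal.rpow_two, add_sq]
    calc 2 * (A * B) = 2 * A * B := by ring
      _ ≤ A ^ 2 + 2 * A * B := le_add_self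
      _ ≤ _ := le_self_add
  exact (ENNReal.rpow_le_rpow_iff (by norm_num : (0 : ℝ) < 2)).1 (h1.trans h2)

/-- A set `G ⊆ ℝⁿ` which is a lower set in suitable linear coordinates. -/
structure IsLowerDomain {n : ℕ} (G : Set (Rn n)) (e : (Fin n → ℝ) ≃L[ℝ] Rn n) : Prop where
  isOpen : IsOpen G
  isLowerSet : IsLowerSet (e ⁻¹' G)

lemma norm_fderiv_le_norm_classicalGrad {n : ℕ} (u : Rn n → ℂ) (x : Rn n) :
    ‖fderiv ℝ u x‖ ≤ ‖classicalGrad u x‖ := by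
  refine ContinuousLinearMap.opNorm_le_bound _ (norm_nonneg _) fun v => ?_
  have h1 : fderiv ℝ u x v
      = ⟪(WithLp.toLp 2 fun j => (v j : ℂ) : Cn n), classicalGrad u x⟫_ℂ := by
    have hv : v = ∑ j, v j • EuclideanSpace.single j (1 : ℝ) := by
      ext i
      simp [Finset.sum_apply, Pi.single_apply]
    conv_lhs => rw [hv]
    rw [map_sum, PiLp.inner_apply]
    refine Finset.sum_congr rfl fun j _ => ?_
    rw [map_smul, classicalGrad_apply]
    simp [mul_comm]
  have h2 : ‖(WithLp.toLp 2 fun j => (v j : ℂ) : Cn n)‖ = ‖v‖ := by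
    simp [EuclideanSpace.norm_eq]
  rw [h1, mul_comm, ← h2]
  exact norm_inner_le_norm _ _

/-- The inequality on the lower set `e⁻¹(G)` is transported by `e`. The image of Lebesgue measure is
a multiple `c > 0` of Lebesgue measure, which multiplies an `L^p` norm by `c^{1/p}`; the chain rule
costs a factor `‖e‖`. -/
theorem IsLowerDomain.exists_sobolev {n : ℕ} (hn : 1 ≤ n) (hn2 : n ≠ 2) {G : Set (Rn n)}
    {e : (Fin n → ℝ) ≃L[ℝ] Rn n} (hG : IsLowerDomain G e) :
    ∃ C : ℝ≥0, ∀ u : Rn n → ℂ, ContDiff ℝ 1 u → HasCompactSupport u →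
      eLpNorm u (sobolevExp n) (vol G)
        ≤ C * (eLpNorm u 2 (vol G) + eLpNorm (classicalGrad u) 2 (vol G)) := by
  set G' := e ⁻¹' G
  have hG'm : MeasurableSet G' := (hG.isOpen.preimage e.continuous).measurableSet
  set μ := (volume : Measure (Fin n → ℝ)).restrict G'
  have hcoord : ∃ C : ℝ≥0, ∀ u : (Fin n → ℝ) → ℂ, ContDiff ℝ 1 u → HasCompactSupport u →
      eLpNorm u (sobolevExp n) μ ≤ C * (eLpNorm u 2 μ + eLpNorm (fderiv ℝ u) 2 μ) := by
    rcases (by omega : n = 1 ∨ 3 ≤ n) with rfl | h3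
    · refine ⟨1, fun u hu hc => ?_⟩
      rw [sobolevExp_one, ENNReal.coe_one, one_mul]
      exact eLpNorm_top_le_of_isLowerSet hG.isLowerSet hG'm hu hc
    · refine ⟨Real.toNNReal (2 * (n - 1) / (n - 2)), fun u hu hc => ?_⟩
      refine (eLpNorm_sobolevExp_le_of_isLowerSet h3 hG.isLowerSet hG'm hu hc).trans ?_
      exact mul_le_mul_right le_add_self _
  obtain ⟨C, hC⟩ := hcoord
  have hmap : ((volume : Measure (Fin n → ℝ)).map e).IsAddHaarMeasure :=
    e.isAddHaarMeasure_map volume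
  set c : ℝ≥0 := ((volume : Measure (Fin n → ℝ)).map e).addHaarScalarFactor volume with hc
  have hmapc : (volume : Measure (Fin n → ℝ)).map e = c • (volume : Measure (Rn n)) :=
    Measure.isAddLeftInvariant_eq_smul _ _
  have hc0 : c ≠ 0 := (Measure.addHaarScalarFactor_pos_of_isAddHaarMeasure _ _).ne'
  have htrans : ∀ {E : Type} [NormedAddCommGroup E] (g : Rn n → E) (p : ℝ≥0∞),
      Continuous g → eLpNorm (g ∘ e) p μ = (c : ℝ≥0∞) ^ (1 / p).toReal * eLpNorm g p (vol G) := by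
    intro E _ g p hg
    have h1 : Measure.map e μ = c • vol G := by
      rw [← Measure.restrict_smul, ← hmapc]
      exact (Measure.restrict_map e.continuous.measurable hG.isOpen.measurableSet).symm
    have h2 := eLpNorm_smul_measure_of_ne_zero (ε := E) (c := (c : ℝ≥0∞)) (by simpa using hc0) g p
      (vol G)
    have h3 : eLpNorm g p (Measure.map e μ) = eLpNorm (g ∘ e) p μ :=
      eLpNorm_map_measure hg.aestronglyMeasurable e.continuous.aemeasurable
    rw [← h3, h1]
    exact h2
  have hk : ∀ t : ℝ, (c : ℝ≥0∞) ^ t = ((c ^ t : ℝ≥0) : ℝ≥0∞) := fun t =>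
    (ENNReal.coe_rpow_of_ne_zero hc0 t).symm
  set kr : ℝ≥0 := c ^ (1 / sobolevExp n).toReal with hkr
  set k₂ : ℝ≥0 := c ^ (1 / (2 : ℝ≥0∞)).toReal with hk₂
  have hkr0 : (kr : ℝ≥0∞) ≠ 0 := by
    rw [ENNReal.coe_ne_zero, hkr]
    exact (NNReal.rpow_pos (pos_iff_ne_zero.2 hc0)).ne'
  set M : ℝ≥0 := ‖(e : (Fin n → ℝ) →L[ℝ] Rn n)‖₊ with hM
  refine ⟨kr⁻¹ * (C * (k₂ * (1 + M))), fun u hu hcu => ?_⟩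
  have h1 := hC (u ∘ e) (hu.comp e.contDiff) (hcu.comp_homeomorph e.toHomeomorph)
  have h2 : eLpNorm (fderiv ℝ (u ∘ e)) 2 μ ≤ M * eLpNorm (classicalGrad u ∘ e) 2 μ := by
    refine eLpNorm_le_nnreal_smul_eLpNorm_of_ae_le_mul (Filter.Eventually.of_forall fun x => ?_) 2
    rw [fderiv_comp x (hu.differentiable one_ne_zero).differentiableAt e.differentiableAt, e.fderiv]
    refine (ContinuousLinearMap.opNNNorm_comp_le _ _).trans ?_
    rw [mul_comm]
    exact mul_le_mul_right (show ‖fderiv ℝ u (e x)‖₊ ≤ ‖classicalGrad u (e x)‖₊ from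
      norm_fderiv_le_norm_classicalGrad u (e x)) _
  rw [htrans _ _ hu.continuous, htrans _ _ hu.continuous, hk, hk] at h1
  rw [htrans _ _ (continuous_classicalGrad hu), hk] at h2
  set A := eLpNorm u 2 (vol G)
  set B := eLpNorm (classicalGrad u) 2 (vol G)
  push_cast
  rw [ENNReal.coe_inv (by exact_mod_cast hkr0), mul_assoc,
    ← ENNReal.mul_le_mul_iff_right hkr0 ENNReal.coe_ne_top, ← mul_assoc (kr : ℝ≥0∞),
    ENNReal.mul_inv_cancel hkr0 ENNReal.coe_ne_top, one_mul]
  refine h1.trans ?_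
  rw [mul_assoc]
  refine mul_le_mul_right ((add_le_add_right h2 _).trans ?_) _
  calc (k₂ : ℝ≥0∞) * A + M * (k₂ * B) ≤ k₂ * A + M * (k₂ * B) + (k₂ * B + k₂ * M * A) := le_self_add
    _ = k₂ * (1 + M) * (A + B) := by ring

/-! ### Mollification inside a lower domain -/

section Mollify

variable {n : ℕ} {E : Type*} [NormedAddCommGroup E] [NormedSpace ℝ E]

/-- The convolution of `f` with the kernel `ρ`. -/
def mollify (ρ : Rn n → ℝ) (f : Rn n → E) (x : Rn n) : E := ∫ t, ρ (x - t) • f t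

lemma mollify_eq_convolution (ρ : Rn n → ℝ) (f : Rn n → E) :
    mollify ρ f = convolution f ρ
      (ContinuousLinearMap.lsmul ℝ ℝ : ℝ →L[ℝ] E →L[ℝ] E).flip volume := rfl

variable {ρ : Rn n → ℝ} {f : Rn n → E}

lemma contDiff_mollify [CompleteSpace E] (hρ : ContDiff ℝ 1 ρ) (hc : HasCompactSupport ρ)
    (hf : LocallyIntegrable f) : ContDiff ℝ 1 (mollify ρ f) := by
  rw [mollify_eq_convolution]
  exact hc.contDiff_convolution_right _ hf hρ

lemma hasCompactSupport_mollify (hc : HasCompactSupport ρ) (hf : HasCompactSupport f) :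
    HasCompactSupport (mollify ρ f) := by
  rw [mollify_eq_convolution]
  exact hf.convolution _ hc

lemma fderiv_mollify_apply [CompleteSpace E] (hρ : ContDiff ℝ 1 ρ) (hc : HasCompactSupport ρ)
    (hf : LocallyIntegrable f) (x v : Rn n) :
    fderiv ℝ (mollify ρ f) x v = ∫ t, fderiv ℝ ρ (x - t) v • f t := by
  rw [mollify_eq_convolution, (hc.hasFDerivAt_convolution_right _ hf hρ x).fderiv,
    convolution_precompR_apply _ hf (hc.fderiv (𝕜 := ℝ)) (hρ.continuous_fderiv one_ne_zero)]
  rfl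

/-- Cauchy-Schwarz with the splitting `ρ |f| = ρ^{1/2} · ρ^{1/2} |f|` and `∫ ρ = 1` gives `|ρ * f|²
≤ ρ * |f|²`; Tonelli's theorem then integrates the right side. -/
lemma eLpNorm_mollify_le (hρ : Continuous ρ) (hρi : Integrable ρ) (hρ0 : ∀ x, 0 ≤ ρ x)
    (hρ1 : ∫ x, ρ x = 1)
    (hf : AEStronglyMeasurable f) : eLpNorm (mollify ρ f) 2 volume ≤ eLpNorm f 2 volume := by
  have hm1 : ∫⁻ x, ‖ρ x‖ₑ = 1 := by
    rw [← ofReal_integral_norm_eq_lintegral_enorm hρi]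
    simp_rw [Real.norm_of_nonneg (hρ0 _)]
    rw [hρ1, ENNReal.ofReal_one]
  have hpt : ∀ x, ‖mollify ρ f x‖ₑ ^ (2 : ℝ) ≤ ∫⁻ t, ‖ρ (x - t)‖ₑ * ‖f t‖ₑ ^ (2 : ℝ) := by
    intro x
    have hρm : AEMeasurable (fun t => ‖ρ (x - t)‖ₑ) volume := by fun_prop
    have h1 : ‖mollify ρ f x‖ₑ ≤ ∫⁻ t, ‖ρ (x - t)‖ₑ ^ (1 / 2 : ℝ) *
        (‖ρ (x - t)‖ₑ ^ (1 / 2 : ℝ) * ‖f t‖ₑ) := by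
      refine (enorm_integral_le_lintegral_enorm _).trans (le_of_eq (lintegral_congr fun t => ?_))
      rw [enorm_smul, ← mul_assoc, ← ENNReal.rpow_add_of_nonneg _ _ (by norm_num) (by norm_num)]
      norm_num
    have h2 := ENNReal.lintegral_mul_le_Lp_mul_Lq volume Real.HolderConjugate.two_two
      (hρm.pow_const (1 / 2 : ℝ)) ((hρm.pow_const (1 / 2 : ℝ)).mul hf.enorm)
    have h3 : ∫⁻ t, (‖ρ (x - t)‖ₑ ^ (1 / 2 : ℝ)) ^ (2 : ℝ) = 1 := by
      simp_rw [← ENNReal.rpow_mul]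
      norm_num
      rw [← hm1]
      exact lintegral_sub_left_eq_self (fun t => ‖ρ t‖ₑ) x
    rw [h3, ENNReal.one_rpow, one_mul] at h2
    have h4 := ENNReal.rpow_le_rpow (h1.trans h2) (by norm_num : (0 : ℝ) ≤ 2)
    rw [← ENNReal.rpow_mul] at h4
    norm_num at h4
    refine (le_of_eq (by norm_num)).trans (h4.trans (le_of_eq (lintegral_congr fun t => ?_)))
    rw [mul_pow, ← ENNReal.rpow_natCast, ← ENNReal.rpow_mul]
    norm_num
  have hswap : ∫⁻ x, ∫⁻ t, ‖ρ (x - t)‖ₑ * ‖f t‖ₑ ^ (2 : ℝ)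
      = ∫⁻ t, ‖f t‖ₑ ^ (2 : ℝ) := by
    rw [lintegral_lintegral_swap]
    · refine lintegral_congr fun t => ?_
      rw [lintegral_mul_const]
      · rw [lintegral_sub_right_eq_self (fun x => ‖ρ x‖ₑ) t, hm1, one_mul]
      · exact (hρ.comp (continuous_id.sub continuous_const)).enorm.measurable
    · have : AEMeasurable (fun p : Rn n × Rn n => ‖f p.2‖ₑ) (volume.prod volume) :=
        hf.enorm.comp_snd
      refine AEMeasurable.mul ?_ (this.pow_const _)
      exact (hρ.comp (continuous_fst.sub continuous_snd)).enorm.aemeasurable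
  rw [eLpNorm_eq_lintegral_rpow_enorm_toReal two_ne_zero ENNReal.ofNat_ne_top,
    eLpNorm_eq_lintegral_rpow_enorm_toReal two_ne_zero ENNReal.ofNat_ne_top, ENNReal.toReal_ofNat,
    ← hswap]
  exact ENNReal.rpow_le_rpow (lintegral_mono hpt) (by norm_num)

/-- `g` is the weak gradient of `u` on `G`. -/
def IsWeakGradOn (G : Set (Rn n)) (u : Rn n → ℂ) (g : Rn n → Cn n) : Prop :=
  ∀ φ : Rn n → ℝ, ContDiff ℝ ∞ φ → HasCompactSupport φ → tsupport φ ⊆ G → ∀ j : Fin n,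
    ∫ x, fderiv ℝ φ x (EuclideanSpace.single j 1) • u x = - ∫ x, φ x • g x j

/-- The condition on `x` says that `t ↦ ρ (x - t)` is supported in `G`, so it is an admissible test
function; its derivative in `t` is minus the derivative of the kernel in `x`. -/
lemma IsWeakGradOn.classicalGrad_mollify {G : Set (Rn n)} {u : Rn n → ℂ} {g : Rn n → Cn n}
    (h : IsWeakGradOn G u g) (hu : LocallyIntegrable u) (hg : LocallyIntegrable g)
    (hρ : ContDiff ℝ ∞ ρ) (hc : HasCompactSupport ρ) {x : Rn n}
    (hx : ∀ s ∈ tsupport ρ, x - s ∈ G) : classicalGrad (mollify ρ u) x = mollify ρ g x := by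
  have hρ1 : ContDiff ℝ 1 ρ := hρ.of_le (by simp)
  set φ : Rn n → ℝ := fun t => ρ (x - t) with hφ
  have hφs : ContDiff ℝ ∞ φ := hρ.comp (contDiff_const.sub contDiff_id)
  have hφc : HasCompactSupport φ := hc.comp_homeomorph (Homeomorph.subLeft x)
  have hφG : tsupport φ ⊆ G := by
    intro t ht
    have h1 : x - t ∈ tsupport ρ := by
      have := tsupport_comp_subset_preimage ρ (f := fun t => x - t) (by fun_prop) ht
      exact this
    have := hx _ h1
    rwa [sub_sub_cancel] at this
  have hφd : ∀ t v, fderiv ℝ φ t v = - fderiv ℝ ρ (x - t) v := fun t v => by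
    have h1 : HasFDerivAt φ ((fderiv ℝ ρ (x - t)).comp (-ContinuousLinearMap.id ℝ (Rn n))) t :=
      ((hρ1.differentiable one_ne_zero) (x - t)).hasFDerivAt.comp t
        ((hasFDerivAt_id t).const_sub x)
    rw [h1.fderiv]
    simp
  ext j
  have hint : Integrable (fun t => φ t • g t) := by
    have := hg.integrable_smul_left_of_hasCompactSupport hφs.continuous hφc
    exact this
  rw [classicalGrad_apply, fderiv_mollify_apply hρ1 hc hu]
  have h2 := h φ hφs hφc hφG j
  simp_rw [hφd, neg_smul] at h2
  rw [integral_neg, neg_inj] at h2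
  rw [h2]
  exact ((EuclideanSpace.proj j : Cn n →L[ℂ] ℂ).integral_comp_comm hint)

/-- A ball inside the positive cone of a system of linear coordinates. -/
lemma exists_closedBall_subset_cone (e : (Fin n → ℝ) ≃L[ℝ] Rn n) :
    ∃ (c : Rn n) (r : ℝ), 0 < r ∧ ∀ t : ℝ, 0 < t → ∀ s ∈ Metric.closedBall (t • c) (t * r),
      0 ≤ e.symm s := by
  have ho : IsOpen {s : Rn n | ∀ i, 0 < e.symm s i} := by
    simp only [ofPred_forall]
    exact isOpen_iInter_of_finite fun i =>
      isOpen_lt continuous_const ((continuous_apply i).comp e.symm.continuous)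
  have hm : e (fun _ => 1) ∈ {s : Rn n | ∀ i, 0 < e.symm s i} := by
    intro i
    simp
  obtain ⟨r, hr, hsub⟩ := Metric.nhds_basis_closedBall.mem_iff.1 (ho.mem_nhds hm)
  refine ⟨e fun _ => 1, r, hr, fun t ht s hs i => ?_⟩
  have h1 : t⁻¹ • s ∈ Metric.closedBall (e fun _ => 1) r := by
    rw [mem_closedBall_iff_norm] at hs ⊢
    have : t⁻¹ • s - e (fun _ => 1) = t⁻¹ • (s - t • e fun _ => 1) := by
      rw [smul_sub, inv_smul_smul₀ ht.ne']
    rw [this, norm_smul, norm_inv, Real.norm_of_nonneg ht.le, inv_mul_le_iff₀ ht]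
    exact hs
  have h2 : 0 < t⁻¹ * e.symm s i := by simpa using hsub h1 i
  exact ((mul_pos_iff_of_pos_left (inv_pos.2 ht)).1 h2).le

lemma IsLowerDomain.sub_mem {G : Set (Rn n)} {e : (Fin n → ℝ) ≃L[ℝ] Rn n}
    (hG : IsLowerDomain G e) {x s : Rn n} (hx : x ∈ G) (hs : 0 ≤ e.symm s) : x - s ∈ G := by
  have h1 : e.symm x ∈ e ⁻¹' G := by simpa using hx
  have h2 : e.symm (x - s) ∈ e ⁻¹' G := by
    refine hG.isLowerSet ?_ h1
    rw [map_sub]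
    exact sub_le_self _ hs
  simpa using h2

/-- Mollifying with kernels supported in the positive cone uses, at `x ∈ G`, only values at points
`x - s ∈ G`. Hence the smooth functions have the mollified weak gradient on all of `G`, up to its
boundary, and Fatou's lemma passes to the limit. -/
theorem IsLowerDomain.exists_sobolev_weak (hn : 1 ≤ n) (hn2 : n ≠ 2) {G : Set (Rn n)}
    {e : (Fin n → ℝ) ≃L[ℝ] Rn n} (hG : IsLowerDomain G e) :
    ∃ C : ℝ≥0, ∀ (u : Rn n → ℂ) (g : Rn n → Cn n), MemLp u 2 volume → MemLp g 2 volume →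
      HasCompactSupport u → IsWeakGradOn G u g →
      eLpNorm u (sobolevExp n) (vol G) ≤ C * (eLpNorm u 2 volume + eLpNorm g 2 volume) := by
  obtain ⟨C, hC⟩ := hG.exists_sobolev hn hn2
  refine ⟨C, fun u g hu hg hcu hw => ?_⟩
  obtain ⟨c, r, hr, hcone⟩ := exists_closedBall_subset_cone e
  let t : ℕ → ℝ := fun k => 1 / ((k : ℝ) + 1)
  have ht0 : ∀ k, 0 < t k := fun k => Nat.one_div_pos_of_nat
  have htlim : Filter.Tendsto t Filter.atTop (nhds 0) := tendsto_one_div_add_atTop_nhds_zero_nat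
  let φ : ∀ k, ContDiffBump (t k • c) := fun k =>
    ⟨t k * r / 2, t k * r, by have := ht0 k; positivity, half_lt_self (mul_pos (ht0 k) hr)⟩
  let ρ : ℕ → Rn n → ℝ := fun k => (φ k).normed volume
  have hρ : ∀ k, ContDiff ℝ ∞ (ρ k) := fun k => (φ k).contDiff_normed
  have hρc : ∀ k, HasCompactSupport (ρ k) := fun k => (φ k).hasCompactSupport_normed
  have hul : LocallyIntegrable u := hu.locallyIntegrable one_le_two
  have hgl : LocallyIntegrable g := hg.locallyIntegrable one_le_two
  have hρ1 : ∀ k, ContDiff ℝ 1 (ρ k) := fun k => (hρ k).of_le (by simp)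
  have hbound : ∀ k, eLpNorm (mollify (ρ k) u) (sobolevExp n) (vol G)
      ≤ C * (eLpNorm u 2 volume + eLpNorm g 2 volume) := by
    intro k
    refine (hC _ (contDiff_mollify (hρ1 k) (hρc k) hul)
      (hasCompactSupport_mollify (hρc k) hcu)).trans ?_
    have hgrad : eLpNorm (classicalGrad (mollify (ρ k) u)) 2 (vol G)
        = eLpNorm (mollify (ρ k) g) 2 (vol G) := by
      refine eLpNorm_congr_ae ?_
      filter_upwards [ae_restrict_mem hG.isOpen.measurableSet] with x hx
      refine hw.classicalGrad_mollify hul hgl (hρ k) (hρc k) fun s hs => ?_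
      rw [(φ k).tsupport_normed_eq] at hs
      exact hG.sub_mem hx (hcone _ (ht0 k) s hs)
    rw [hgrad]
    gcongr
    · exact (eLpNorm_mono_measure _ Measure.restrict_le_self).trans
        (eLpNorm_mollify_le (hρ k).continuous (φ k).integrable_normed (φ k).nonneg_normed
          (φ k).integral_normed hu.1)
    · exact (eLpNorm_mono_measure _ Measure.restrict_le_self).trans
        (eLpNorm_mollify_le (hρ k).continuous (φ k).integrable_normed (φ k).nonneg_normed
          (φ k).integral_normed hg.1)
  have hlim : ∀ᵐ x, Filter.Tendsto (fun k => mollify (ρ k) u x) Filter.atTop (nhds (u x)) := by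
    -- The kernels are not centred at the origin: the averages run over balls of radius `t_k r`
    -- about `x - t_k c`. Lebesgue differentiation holds for them, as `x` lies in the balls dilated
    -- by `‖c‖ / r`.
    filter_upwards [IsUnifLocDoublingMeasure.ae_tendsto_average_norm_sub (μ := volume) hul
      (‖c‖ / r)] with x hx
    have hx' := hx (l := Filter.atTop) (fun k => x - t k • c) (fun k => t k * r) ?_ ?_
    -- The inner radius of the bump is half the outer one, so the normalized kernel is at most `2 ^
    -- n` divided by the volume of the outer ball.
    · refine tendsto_integral_smul_of_tendsto_average_norm_sub (2 ^ (Module.finrank ℝ (Rn n))) hx'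
        ?_ ?_ ?_ ?_
      · exact Filter.Eventually.of_forall fun k => hul.integrableOn_isCompact
          (isCompact_closedBall _ _)
      · refine tendsto_const_nhds.congr fun k => ?_
        rw [integral_sub_left_eq_self (fun y => ρ k y) volume x]
        exact (φ k).integral_normed.symm
      · refine Filter.Eventually.of_forall fun k y hy => ?_
        have h1 : x - y ∈ Function.support (ρ k) := hy
        rw [(φ k).support_normed_eq, mem_ball_iff_norm] at h1
        rw [mem_closedBall_iff_norm, ← norm_neg]
        refine le_trans (le_of_eq ?_) h1.le
        congr 1
        abel
      · refine Filter.Eventually.of_forall fun k y => ?_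
        rw [abs_of_nonneg ((φ k).nonneg_normed _), Measure.addHaar_real_closedBall_center]
        have := (φ k).normed_le_div_measure_closedBall_rOut volume 2
          (le_of_eq (by change t k * r = 2 * (t k * r / 2); ring)) (x - y)
        rwa [Measure.addHaar_real_closedBall_center] at this
    · refine tendsto_nhdsWithin_iff.2 ⟨?_, Filter.Eventually.of_forall fun k =>
        mul_pos (ht0 k) hr⟩
      simpa using htlim.mul_const r
    · refine Filter.Eventually.of_forall fun k => ?_
      rw [mem_closedBall_iff_norm, sub_sub_cancel, norm_smul, Real.norm_of_nonneg (ht0 k).le]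
      refine le_of_eq ?_
      field_simp
  refine (Lp.eLpNorm_lim_le_liminf_eLpNorm (fun k =>
    (contDiff_mollify (hρ1 k) (hρc k) hul).continuous.aestronglyMeasurable) u
      (ae_restrict_of_ae hlim)).trans ?_
  exact Filter.liminf_le_of_le (by isBoundedDefault) fun b hb =>
    let ⟨k, hk⟩ := hb.exists
    hk.trans (hbound k)

end Mollify

/-! ### Localization -/

section Localization

variable {n : ℕ} {Ω : Set (Rn n)}

/-- The function `f ∇χ`. -/
def smulGrad (χ : Rn n → ℝ) (f : Rn n → ℂ) (x : Rn n) : Cn n :=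
  ∑ j, EuclideanSpace.single j (fderiv ℝ χ x (EuclideanSpace.single j 1) • f x)

lemma smulGrad_apply (χ : Rn n → ℝ) (f : Rn n → ℂ) (x : Rn n) (j : Fin n) :
    smulGrad χ f x j = fderiv ℝ χ x (EuclideanSpace.single j 1) • f x := by
  simp [smulGrad, Pi.single_apply]

lemma norm_smulGrad_le {χ : Rn n → ℝ} {M : ℝ} (hM : ∀ x, ‖fderiv ℝ χ x‖ ≤ M)
    (f : Rn n → ℂ) (x : Rn n) : ‖smulGrad χ f x‖ ≤ n * M * ‖f x‖ := by
  refine (norm_sum_le _ _).trans ((Finset.sum_le_card_nsmul _ _ (M * ‖f x‖) fun j _ => ?_).trans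
    (le_of_eq (by simp [mul_assoc])))
  rw [PiLp.norm_single, norm_smul]
  refine mul_le_mul_of_nonneg_right ?_ (norm_nonneg _)
  refine ((fderiv ℝ χ x).le_opNorm _).trans ?_
  rw [PiLp.norm_single, norm_one, mul_one]
  exact hM x

lemma aestronglyMeasurable_smulGrad {χ : Rn n → ℝ} (hχ : ContDiff ℝ 1 χ) {f : Rn n → ℂ}
    {μ : Measure (Rn n)} (hf : AEStronglyMeasurable f μ) :
    AEStronglyMeasurable (smulGrad χ f) μ := by
  unfold smulGrad
  refine Finset.aestronglyMeasurable_fun_sum _ fun j _ => ?_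
  have h : AEStronglyMeasurable (fun x => fderiv ℝ χ x (EuclideanSpace.single j 1) • f x) μ :=
    ((hχ.continuous_fderiv one_ne_zero).clm_apply
      continuous_const).aestronglyMeasurable.smul hf
  exact (LinearIsometry.continuous
    (⟨⟨⟨EuclideanSpace.single j, fun a b => by ext i; by_cases hi : i = j <;> simp [hi]⟩,
      fun r a => by ext i; by_cases hi : i = j <;> simp [hi]⟩,
      fun a => by simp⟩ : ℂ →ₗᵢ[ℂ] Cn n)).comp_aestronglyMeasurable h

/-- Cutting off a test function on `G` to `Ω`, away from the boundary of `Ω`. -/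
lemma testFun_indicator (hΩ : IsOpen Ω) {G : Set (Rn n)} {χ φ : Rn n → ℝ}
    (hχ : ContDiff ℝ ∞ χ) (hcχ : HasCompactSupport χ) (hφ : ContDiff ℝ ∞ φ)
    (hφG : tsupport φ ⊆ G) (hdisj : tsupport χ ∩ G ∩ frontier Ω = ∅) :
    ContDiff ℝ ∞ (Ω.indicator fun x => χ x * φ x) ∧
      HasCompactSupport (Ω.indicator fun x => χ x * φ x) ∧
      tsupport (Ω.indicator fun x => χ x * φ x) ⊆ Ω := by
  -- A point outside `Ω` is either exterior, or a boundary point and then outside one of the two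
  -- supports. In both cases the product vanishes nearby, so the jump of the indicator is invisible.
  have hout : ∀ x, x ∉ Ω → (Ω.indicator fun x => χ x * φ x) =ᶠ[nhds x] fun _ => 0 := by
    intro x hx
    by_cases hcl : x ∈ closure Ω
    · have hfr : x ∈ frontier Ω := by rw [hΩ.frontier_eq]; exact ⟨hcl, hx⟩
      have h1 : x ∉ tsupport χ ∨ x ∉ tsupport φ := by
        by_contra! h
        exact (hdisj ▸ (⟨⟨h.1, hφG h.2⟩, hfr⟩ : x ∈ tsupport χ ∩ G ∩ frontier Ω) :
          x ∈ (∅ : Set (Rn n)))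
      rcases h1 with h1 | h1
      · filter_upwards [notMem_tsupport_iff_eventuallyEq.1 h1] with y hy
        simp [hy]
      · filter_upwards [notMem_tsupport_iff_eventuallyEq.1 h1] with y hy
        simp [hy]
    · filter_upwards [isClosed_closure.isOpen_compl.mem_nhds hcl] with y hy
      exact indicator_of_notMem (fun h => hy (subset_closure h)) _
  refine ⟨contDiff_iff_contDiffAt.2 fun x => ?_, ?_, fun x hx => ?_⟩
  · by_cases hx : x ∈ Ω
    · refine (hχ.mul hφ).contDiffAt.congr_of_eventuallyEq ?_
      filter_upwards [hΩ.mem_nhds hx] with y hy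
      rw [indicator_of_mem hy]
    · exact contDiffAt_const.congr_of_eventuallyEq (hout x hx)
  · refine hcχ.mono fun x hx h0 => hx ?_
    simp [h0]
  · by_contra hxΩ
    exact notMem_tsupport_iff_eventuallyEq.2 (hout x hxΩ) hx

/-- A test function `φ` on `G` may meet the complement of `Ω`, but `1_Ω χ φ` is a test function on
`Ω`. Inserting it into the definition of `∇f` and expanding the derivative gives the product rule.
-/
lemma isWeakGradOn_cutoff (hΩ : IsOpen Ω) {G : Set (Rn n)} {χ : Rn n → ℝ}
    (hχ : ContDiff ℝ ∞ χ) (hcχ : HasCompactSupport χ)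
    (hdisj : tsupport χ ∩ G ∩ frontier Ω = ∅) {f : L2 Ω} {F : L2vec Ω}
    (h : (f, F) ∈ weakGradGraph Ω) :
    IsWeakGradOn G (Ω.indicator fun x => χ x • f x)
      (Ω.indicator fun x => χ x • F x + smulGrad χ f x) := by
  intro φ hφ hcφ hφG j
  set v : Rn n := EuclideanSpace.single j 1
  obtain ⟨h1, h2, h3⟩ := testFun_indicator hΩ hχ hcχ hφ hφG hdisj
  have h4 : ∫ x, fderiv ℝ (Ω.indicator fun x => χ x * φ x) x v • f x ∂(vol Ω)
      = - ∫ x, (Ω.indicator fun x => χ x * φ x) x • (F x) j ∂(vol Ω) := h _ h1 h2 h3 j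
  have e1 : ∀ x ∈ Ω, fderiv ℝ (Ω.indicator fun x => χ x * φ x) x v
      = χ x * fderiv ℝ φ x v + φ x * fderiv ℝ χ x v := by
    intro x hx
    have : (Ω.indicator fun x => χ x * φ x) =ᶠ[nhds x] fun x => χ x * φ x := by
      filter_upwards [hΩ.mem_nhds hx] with y hy
      rw [indicator_of_mem hy]
    rw [this.fderiv_eq, fderiv_fun_mul (hχ.differentiable (by simp) x)
      (hφ.differentiable (by simp) x)]
    simp
  have hχd : Continuous fun x => fderiv ℝ χ x v :=
    (hχ.continuous_fderiv (by simp)).clm_apply continuous_const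
  have hφd : Continuous fun x => fderiv ℝ φ x v :=
    (hφ.continuous_fderiv (by simp)).clm_apply continuous_const
  have i1 : Integrable (fun x => (χ x * fderiv ℝ φ x v) • f x) (vol Ω) :=
    integrable_testFun_smul (hχ.continuous.mul hφd) hcχ.mul_right (Lp.memLp f)
  have i2 : Integrable (fun x => (φ x * fderiv ℝ χ x v) • f x) (vol Ω) :=
    integrable_testFun_smul (hφ.continuous.mul hχd) hcφ.mul_right (Lp.memLp f)
  have i3 : Integrable (fun x => (χ x * φ x) • (F x) j) (vol Ω) :=
    integrable_testFun_smul (hχ.continuous.mul hφ.continuous) hcχ.mul_right (memLp_proj F j)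
  have h5 : ∫ x, (χ x * fderiv ℝ φ x v) • f x ∂(vol Ω)
        + ∫ x, (φ x * fderiv ℝ χ x v) • f x ∂(vol Ω)
      = - ∫ x, (χ x * φ x) • (F x) j ∂(vol Ω) := by
    rw [← integral_add i1 i2]
    refine Eq.trans (setIntegral_congr_fun hΩ.measurableSet fun x hx => ?_) (h4.trans ?_)
    · rw [e1 x hx, add_smul]
    · congr 1
      refine setIntegral_congr_fun hΩ.measurableSet fun x hx => ?_
      change (Ω.indicator fun x => χ x * φ x) x • (F x) j = _
      rw [indicator_of_mem hx]
  have e2 : ∫ x, fderiv ℝ φ x v • (Ω.indicator fun x => χ x • f x) x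
      = ∫ x, (χ x * fderiv ℝ φ x v) • f x ∂(vol Ω) := by
    rw [← integral_indicator hΩ.measurableSet]
    refine integral_congr_ae (Filter.Eventually.of_forall fun x => ?_)
    by_cases hx : x ∈ Ω
    · simp only [indicator_of_mem hx]
      rw [smul_smul, mul_comm]
    · simp only [indicator_of_notMem hx, smul_zero]
  have e3 : ∫ x, φ x • (Ω.indicator fun x => χ x • F x + smulGrad χ f x) x j
      = ∫ x, (χ x * φ x) • (F x) j ∂(vol Ω) + ∫ x, (φ x * fderiv ℝ χ x v) • f x ∂(vol Ω) := by
    rw [← integral_add i3 i2, ← integral_indicator hΩ.measurableSet]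
    refine integral_congr_ae (Filter.Eventually.of_forall fun x => ?_)
    by_cases hx : x ∈ Ω
    · simp only [indicator_of_mem hx]
      rw [PiLp.add_apply, smulGrad_apply, smul_add, PiLp.smul_apply, smul_smul, smul_smul,
        mul_comm (φ x) (χ x)]
    · simp only [indicator_of_notMem hx, PiLp.zero_apply, smul_zero]
  rw [e2, e3, neg_add, ← h5]
  abel

/-- The Sobolev estimate on the part of `Ω` in the set `A`. -/
def SobolevBoundOn (Ω A : Set (Rn n)) : Prop :=
  ∃ C : ℝ≥0, ∀ (f : L2 Ω) (F : L2vec Ω), (f, F) ∈ weakGradGraph Ω →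
    eLpNorm (Ω.indicator f) (sobolevExp n) (volume.restrict A) ≤ C * (‖f‖ₑ + ‖F‖ₑ)

/-- The constant depends on `χ` only through the bound `M` for `χ` and its derivative. This
uniformity later permits exhausting cutoffs without compact support. -/
lemma IsLowerDomain.exists_cutoff_bound (hn : 1 ≤ n) (hn2 : n ≠ 2) (hΩ : IsOpen Ω)
    {G : Set (Rn n)} {e : (Fin n → ℝ) ≃L[ℝ] Rn n} (hG : IsLowerDomain G e) (M : ℝ≥0) :
    ∃ C : ℝ≥0, ∀ χ : Rn n → ℝ, ContDiff ℝ ∞ χ → HasCompactSupport χ → (∀ x, ‖χ x‖ ≤ M) →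
      (∀ x, ‖fderiv ℝ χ x‖ ≤ M) → tsupport χ ∩ G ∩ frontier Ω = ∅ →
      ∀ (f : L2 Ω) (F : L2vec Ω), (f, F) ∈ weakGradGraph Ω →
        eLpNorm (Ω.indicator fun x => χ x • f x) (sobolevExp n) (vol G)
          ≤ C * (‖f‖ₑ + ‖F‖ₑ) := by
  obtain ⟨C, hC⟩ := hG.exists_sobolev_weak hn hn2
  refine ⟨C * (M * (1 + n)), fun χ hχ hcχ h1 h2 hdisj f F h => ?_⟩
  have b1 : eLpNorm (fun x => χ x • f x) 2 (vol Ω) ≤ M * ‖f‖ₑ := by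
    rw [Lp.enorm_def]
    refine eLpNorm_le_nnreal_smul_eLpNorm_of_ae_le_mul (Filter.Eventually.of_forall fun x => ?_) 2
    rw [nnnorm_smul]
    exact mul_le_mul_left (show ‖χ x‖₊ ≤ M from h1 x) _
  have b2 : eLpNorm (fun x => χ x • F x) 2 (vol Ω) ≤ M * ‖F‖ₑ := by
    rw [Lp.enorm_def]
    refine eLpNorm_le_nnreal_smul_eLpNorm_of_ae_le_mul (Filter.Eventually.of_forall fun x => ?_) 2
    rw [nnnorm_smul]
    exact mul_le_mul_left (show ‖χ x‖₊ ≤ M from h1 x) _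
  have b3 : eLpNorm (smulGrad χ f) 2 (vol Ω) ≤ (n * M : ℝ≥0) * ‖f‖ₑ := by
    rw [Lp.enorm_def]
    refine eLpNorm_le_nnreal_smul_eLpNorm_of_ae_le_mul (Filter.Eventually.of_forall fun x => ?_) 2
    exact norm_smulGrad_le h2 f x
  have m1 : AEStronglyMeasurable (fun x => χ x • f x) (vol Ω) :=
    hχ.continuous.aestronglyMeasurable.smul (Lp.memLp f).1
  have m2 : AEStronglyMeasurable (fun x => χ x • F x) (vol Ω) :=
    hχ.continuous.aestronglyMeasurable.smul (Lp.memLp F).1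
  have m3 : AEStronglyMeasurable (smulGrad χ f) (vol Ω) :=
    aestronglyMeasurable_smulGrad (hχ.of_le (by simp)) (Lp.memLp f).1
  have b4 := (eLpNorm_add_le m2 m3 one_le_two).trans (add_le_add b2 b3)
  have hu2 : eLpNorm (Ω.indicator fun x => χ x • f x) 2 volume ≤ M * ‖f‖ₑ := by
    rw [eLpNorm_indicator_eq_eLpNorm_restrict hΩ.measurableSet]
    exact b1
  have hg2 : eLpNorm (Ω.indicator fun x => χ x • F x + smulGrad χ f x) 2 volume
      ≤ M * ‖F‖ₑ + (n * M : ℝ≥0) * ‖f‖ₑ := by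
    rw [eLpNorm_indicator_eq_eLpNorm_restrict hΩ.measurableSet]
    exact b4
  have hcu : HasCompactSupport (Ω.indicator fun x => χ x • f x) := by
    refine hcχ.mono fun x hx h0 => hx ?_
    simp [h0]
  have := hC (Ω.indicator fun x => χ x • f x) (Ω.indicator fun x => χ x • F x + smulGrad χ f x)
    ⟨(aestronglyMeasurable_indicator_iff hΩ.measurableSet).2 m1,
      hu2.trans_lt (by finiteness)⟩
    ⟨(aestronglyMeasurable_indicator_iff hΩ.measurableSet).2 (m2.add m3),
      hg2.trans_lt (by finiteness)⟩ hcu (isWeakGradOn_cutoff hΩ hχ hcχ hdisj h)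
  refine this.trans ?_
  rw [ENNReal.coe_mul, mul_assoc]
  refine mul_le_mul_right ((add_le_add hu2 hg2).trans ?_) _
  push_cast
  calc (M : ℝ≥0∞) * ‖f‖ₑ + (M * ‖F‖ₑ + n * M * ‖f‖ₑ)
      ≤ (M : ℝ≥0∞) * ‖f‖ₑ + (M * ‖F‖ₑ + n * M * ‖f‖ₑ) + n * M * ‖F‖ₑ := le_self_add
    _ = M * (1 + n) * (‖f‖ₑ + ‖F‖ₑ) := by ring

/-- The Sobolev estimate on the set where a cutoff function equals one; the cutoff has to vanish on
the part of the boundary of `Ω` in the lower domain `G`. -/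
lemma IsLowerDomain.sobolevBoundOn (hn : 1 ≤ n) (hn2 : n ≠ 2) (hΩ : IsOpen Ω)
    {G : Set (Rn n)} {e : (Fin n → ℝ) ≃L[ℝ] Rn n} (hG : IsLowerDomain G e) {χ : Rn n → ℝ} {M : ℝ≥0}
    (hχ : ContDiff ℝ ∞ χ) (h1 : ∀ x, ‖χ x‖ ≤ M) (h2 : ∀ x, ‖fderiv ℝ χ x‖ ≤ M)
    (hdisj : tsupport χ ∩ G ∩ frontier Ω = ∅) {A : Set (Rn n)} (hA : MeasurableSet A)
    (hAG : A ∩ Ω ⊆ G) (hA1 : ∀ x ∈ A, x ∈ Ω → χ x = 1) : SobolevBoundOn Ω A := by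
  -- `χ` need not have compact support, so it is multiplied by `b(x / (k + 1))`. The derivatives of
  -- these factors are bounded by `L` uniformly in `k`, whence the common bound `M + M L`, and `k →
  -- ∞` by Fatou's lemma.
  let b : ContDiffBump (0 : Rn n) := ⟨1, 2, one_pos, one_lt_two⟩
  have hbs : ContDiff ℝ ∞ b := b.contDiff
  obtain ⟨L, hL⟩ := (hbs.continuous_fderiv (by simp)).bounded_above_of_compact_support
    (b.hasCompactSupport.fderiv (𝕜 := ℝ))
  have hL0 : 0 ≤ L := (norm_nonneg _).trans (hL 0)
  obtain ⟨C, hC⟩ := hG.exists_cutoff_bound hn hn2 hΩ (M + M * L.toNNReal)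
  let c : ℕ → ℝ := fun k => ((k : ℝ) + 1)⁻¹
  have hc0 : ∀ k, 0 < c k := fun k => by positivity
  have hc1 : ∀ k, c k ≤ 1 := fun k => inv_le_one_of_one_le₀ (by simp)
  let χk : ℕ → Rn n → ℝ := fun k x => χ x * b (c k • x)
  have hs : ∀ k, ContDiff ℝ ∞ fun x : Rn n => b (c k • x) := fun k =>
    hbs.comp (contDiff_const_smul (c k))
  have hb1 : ∀ x, ‖b x‖ ≤ 1 := fun x => by
    rw [Real.norm_of_nonneg b.nonneg]
    exact b.le_one
  have hd : ∀ k x, ‖fderiv ℝ (fun x : Rn n => b (c k • x)) x‖ ≤ L := fun k x => by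
    rw [fderiv_comp_smul, norm_smul, Real.norm_of_nonneg (hc0 k).le]
    exact (mul_le_of_le_one_left (norm_nonneg _) (hc1 k)).trans (hL _)
  have hbound : ∀ (k : ℕ) (f : L2 Ω) (F : L2vec Ω), (f, F) ∈ weakGradGraph Ω →
      eLpNorm (Ω.indicator fun x => χk k x • f x) (sobolevExp n) (vol G)
        ≤ C * (‖f‖ₑ + ‖F‖ₑ) := by
    intro k
    refine hC (χk k) (hχ.mul (hs k)) ?_ (fun x => ?_) (fun x => ?_) ?_
    · refine HasCompactSupport.mul_left ?_
      exact b.hasCompactSupport.comp_homeomorph (Homeomorph.smulOfNeZero (c k) (hc0 k).ne')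
    · push_cast
      rw [norm_mul]
      exact (mul_le_mul (h1 x) (hb1 _) (norm_nonneg _) M.2).trans
        (by rw [mul_one]; exact le_add_of_nonneg_right (by positivity))
    · push_cast
      rw [Real.coe_toNNReal L hL0]
      have e : fderiv ℝ (χk k) x = χ x • fderiv ℝ (fun x : Rn n => b (c k • x)) x
          + b (c k • x) • fderiv ℝ χ x :=
        fderiv_fun_mul (hχ.differentiable (by simp) x) ((hs k).differentiable (by simp) x)
      rw [e, add_comm]
      refine (norm_add_le _ _).trans (add_le_add ?_ ?_)
      · rw [norm_smul]
        exact (mul_le_of_le_one_left (norm_nonneg _) (hb1 _)).trans (h2 x)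
      · rw [norm_smul]
        exact mul_le_mul (h1 x) (hd k x) (norm_nonneg _) M.2
    · refine subset_empty_iff.1 (Subset.trans ?_ hdisj.subset)
      exact inter_subset_inter_left _ (inter_subset_inter_left _ (tsupport_mul_subset_left))
  refine ⟨C, fun f F h => ?_⟩
  have hm : ∀ k, AEStronglyMeasurable (Ω.indicator fun x => χk k x • f x) (vol G) := fun k =>
    ((aestronglyMeasurable_indicator_iff hΩ.measurableSet).2
      ((hχ.mul (hs k)).continuous.aestronglyMeasurable.smul (Lp.memLp f).1)).mono_measure
      Measure.restrict_le_self
  have hlim : ∀ x, Filter.Tendsto (fun k => (Ω.indicator fun x => χk k x • f x) x) Filter.atTop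
      (nhds ((Ω.indicator fun x => χ x • f x) x)) := by
    intro x
    refine tendsto_const_nhds.congr' ?_
    have h0 : Filter.Tendsto (fun k => c k • x) Filter.atTop (nhds 0) := by
      simpa [c] using (tendsto_one_div_add_atTop_nhds_zero_nat (𝕜 := ℝ)).smul_const x
    filter_upwards [h0.eventually (Metric.closedBall_mem_nhds 0 one_pos)] with k hk
    by_cases hx : x ∈ Ω
    · simp only [indicator_of_mem hx, χk, b.one_of_mem_closedBall hk, mul_one]
    · simp only [indicator_of_notMem hx]
  have key : eLpNorm (Ω.indicator fun x => χ x • f x) (sobolevExp n) (vol G)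
      ≤ C * (‖f‖ₑ + ‖F‖ₑ) := by
    refine (Lp.eLpNorm_lim_le_liminf_eLpNorm hm _ (Filter.Eventually.of_forall hlim)).trans ?_
    exact Filter.liminf_le_of_le (by isBoundedDefault) fun b hb =>
      let ⟨k, hk⟩ := hb.exists
      hk.trans (hbound k f F h)
  refine le_trans ?_ key
  rw [← eLpNorm_indicator_eq_eLpNorm_restrict hA,
    ← eLpNorm_indicator_eq_eLpNorm_restrict hG.isOpen.measurableSet]
  refine eLpNorm_mono fun x => ?_
  by_cases hx : x ∈ A
  · by_cases hxΩ : x ∈ Ω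
    · rw [indicator_of_mem hx, indicator_of_mem (hAG ⟨hx, hxΩ⟩), indicator_of_mem hxΩ,
        indicator_of_mem hxΩ, hA1 x hx hxΩ, one_smul]
    · rw [indicator_of_mem hx, indicator_of_notMem hxΩ, norm_zero]
      exact norm_nonneg _
  · rw [indicator_of_notMem hx, norm_zero]
    exact norm_nonneg _

lemma one_le_sobolevExp (n : ℕ) : 1 ≤ sobolevExp n := by
  rw [sobolevExp, ENNReal.one_le_inv]
  refine tsub_le_self.trans ?_
  simp

lemma SobolevBoundOn.union {A B : Set (Rn n)} (hΩ : IsOpen Ω) (hA : MeasurableSet A)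
    (hB : MeasurableSet B) (h1 : SobolevBoundOn Ω A) (h2 : SobolevBoundOn Ω B) :
    SobolevBoundOn Ω (A ∪ B) := by
  obtain ⟨C, hC⟩ := h1
  obtain ⟨D, hD⟩ := h2
  refine ⟨C + D, fun f F h => ?_⟩
  have hm : AEStronglyMeasurable (Ω.indicator f) volume :=
    (aestronglyMeasurable_indicator_iff hΩ.measurableSet).2 (Lp.memLp f).1
  rw [ENNReal.coe_add, add_mul]
  refine le_trans ?_ (add_le_add (hC f F h) (hD f F h))
  rw [← eLpNorm_indicator_eq_eLpNorm_restrict hA, ← eLpNorm_indicator_eq_eLpNorm_restrict hB,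
    ← eLpNorm_indicator_eq_eLpNorm_restrict (hA.union hB)]
  refine le_trans (eLpNorm_mono_real (g := fun x => ‖A.indicator (Ω.indicator f) x‖ +
    ‖B.indicator (Ω.indicator f) x‖) fun x => ?_) ?_
  · by_cases hxA : x ∈ A
    · rw [indicator_of_mem (mem_union_left B hxA), indicator_of_mem hxA]
      exact le_add_of_nonneg_right (norm_nonneg _)
    · by_cases hxB : x ∈ B
      · rw [indicator_of_mem (mem_union_right A hxB), indicator_of_mem hxB]
        exact le_add_of_nonneg_left (norm_nonneg _)
      · rw [indicator_of_notMem (by simp [hxA, hxB] : x ∉ A ∪ B), norm_zero]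
        positivity
  · refine (eLpNorm_add_le (hm.indicator hA).norm (hm.indicator hB).norm
      (one_le_sobolevExp n)).trans ?_
    rw [eLpNorm_norm, eLpNorm_norm]

lemma SobolevBoundOn.biUnion {ι : Type*} (hΩ : IsOpen Ω) (t : Finset ι) (A : ι → Set (Rn n))
    (hA : ∀ i ∈ t, MeasurableSet (A i)) (h : ∀ i ∈ t, SobolevBoundOn Ω (A i)) :
    SobolevBoundOn Ω (⋃ i ∈ t, A i) := by
  classical
  induction t using Finset.induction_on with
  | empty => exact ⟨0, fun f F _ => by simp⟩
  | insert i t hi ih =>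
    rw [Finset.set_biUnion_insert]
    refine SobolevBoundOn.union hΩ (hA i (Finset.mem_insert_self i t))
      (Finset.measurableSet_biUnion _ fun j hj => hA j (Finset.mem_insert_of_mem hj))
      (h i (Finset.mem_insert_self i t)) (ih (fun j hj => hA j (Finset.mem_insert_of_mem hj))
      fun j hj => h j (Finset.mem_insert_of_mem hj))

lemma SobolevBoundOn.of_null {A : Set (Rn n)} (hA : volume A = 0) : SobolevBoundOn Ω A :=
  ⟨0, fun f F _ => by simp [Measure.restrict_eq_zero.2 hA]⟩

lemma SobolevBoundOn.hasSobolevBound (hΩ : IsOpen Ω) {A : Set (Rn n)} (h : SobolevBoundOn Ω A)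
    (hA : Ω ⊆ A) (W : Submodule ℂ (L2 Ω)) : HasSobolevBound Ω W := by
  obtain ⟨C, hC⟩ := h
  refine ⟨C, fun f F _ hF => le_trans ?_ (hC f F hF)⟩
  rw [← eLpNorm_indicator_eq_eLpNorm_restrict hΩ.measurableSet,
    eLpNorm_indicator_eq_eLpNorm_restrict hΩ.measurableSet]
  refine (eLpNorm_congr_ae ?_).trans_le (eLpNorm_mono_measure _ (Measure.restrict_mono hA le_rfl))
  filter_upwards [ae_restrict_mem hΩ.measurableSet] with x hx
  rw [indicator_of_mem hx]

end Localization

/-! ### Dirichlet boundary conditions -/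

section Dirichlet

variable {n : ℕ} {Ω : Set (Rn n)}

lemma isLowerDomain_univ (e : (Fin n → ℝ) ≃L[ℝ] Rn n) : IsLowerDomain univ e :=
  ⟨isOpen_univ, isLowerSet_univ⟩

/-- `ℝⁿ` is itself a lower domain, and test functions on `Ω` have the same norms over `Ω` and over
`ℝⁿ`. The closure is reached by Fatou's lemma along an almost everywhere convergent subsequence. -/
theorem hasSobolevBound_W12zero (hn : 1 ≤ n) (hn2 : n ≠ 2) (hΩ : IsOpen Ω) :
    HasSobolevBound Ω (W12zero Ω) := by
  obtain ⟨C, hC⟩ :=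
    (isLowerDomain_univ (EuclideanSpace.equiv (Fin n) ℝ).symm).exists_sobolev hn hn2
  have htest : ∀ f F, f ∈ testRestrictions Ω Ω → (f, F) ∈ weakGradGraph Ω →
      eLpNorm f (sobolevExp n) (vol Ω) ≤ C * (‖f‖ₑ + ‖F‖ₑ) := by
    intro f F hf hF
    obtain ⟨φ, F', h1, h2, h3, h4, h5, h6⟩ := testRestrictions_mem hf
    have hFF : F = F' := by
      have := (weakGradGraph Ω).sub_mem hF h6
      rw [Prod.mk_sub_mk, sub_self] at this
      exact sub_eq_zero.1 (snd_eq_zero_of_mem_weakGradGraph hΩ _ this rfl)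
    have hsupp : ∀ x, x ∉ Ω → x ∉ tsupport φ := fun x hx h => hx (h3 h)
    have e1 : eLpNorm φ 2 volume = ‖f‖ₑ := by
      rw [Lp.enorm_def, eLpNorm_congr_ae h4, ← eLpNorm_indicator_eq_eLpNorm_restrict
        hΩ.measurableSet, indicator_eq_self.2 ((subset_tsupport φ).trans h3)]
    have e2 : eLpNorm (classicalGrad φ) 2 volume = ‖F‖ₑ := by
      rw [hFF, Lp.enorm_def, eLpNorm_congr_ae h5, ← eLpNorm_indicator_eq_eLpNorm_restrict
        hΩ.measurableSet, indicator_eq_self.2]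
      intro x hx
      by_contra hxΩ
      refine hx ?_
      ext j
      simp [classicalGrad, fderiv_of_notMem_tsupport (𝕜 := ℝ) (hsupp x hxΩ)]
    have := hC φ (h1.of_le (by simp)) h2
    rw [vol, Measure.restrict_univ, e1, e2] at this
    rw [eLpNorm_congr_ae h4]
    exact (eLpNorm_mono_measure _ Measure.restrict_le_self).trans this
  refine ⟨C, fun f F hf hF => ?_⟩
  have hmem : (f, F) ∈ (weakGradGraph Ω ⊓ (testRestrictions Ω Ω).prod ⊤).topologicalClosure := by
    have : (f, F) ∈ restrictedGradGraph Ω (W12zero Ω) := ⟨hF, hf, trivial⟩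
    rw [W12zero, restrictedGradGraph_sobolevClosure hΩ] at this
    exact this.1
  obtain ⟨p, hp, hlim⟩ := mem_closure_iff_seq_limit.1 hmem
  have hlim1 : Filter.Tendsto (fun k => (p k).1) Filter.atTop (nhds f) :=
    (continuous_fst.tendsto (f, F)).comp hlim
  have hlim2 : Filter.Tendsto (fun k => (p k).2) Filter.atTop (nhds F) :=
    (continuous_snd.tendsto (f, F)).comp hlim
  obtain ⟨s, hs, hae⟩ := (tendstoInMeasure_of_tendsto_Lp hlim1).exists_seq_tendsto_ae
  refine (Lp.eLpNorm_lim_le_liminf_eLpNorm (fun k => (Lp.memLp (p (s k)).1).1) f hae).trans ?_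
  refine (Filter.liminf_le_liminf (Filter.Eventually.of_forall fun k =>
    htest _ _ (hp (s k)).2.1 (hp (s k)).1)).trans (le_of_eq ?_)
  refine Filter.Tendsto.liminf_eq ?_
  refine ENNReal.Tendsto.const_mul ?_ (Or.inr ENNReal.coe_ne_top)
  exact ((hlim1.comp hs.tendsto_atTop).enorm).add ((hlim2.comp hs.tendsto_atTop).enorm)

end Dirichlet

/-! ### Intervals -/

section Interval

lemma exists_norm_deriv_smoothTransition_le :
    ∃ L : ℝ, ∀ x, ‖deriv Real.smoothTransition x‖ ≤ L := by
  have hs : ContDiff ℝ 1 Real.smoothTransition := Real.smoothTransition.contDiff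
  refine (hs.continuous_deriv le_rfl).bounded_above_of_compact_support
    (HasCompactSupport.intro (isCompact_Icc (a := (0 : ℝ)) (b := 1)) fun x hx => ?_)
  rw [mem_Icc, not_and_or, not_le, not_le] at hx
  rcases hx with hx | hx
  · have : Real.smoothTransition =ᶠ[nhds x] fun _ => 0 := by
      filter_upwards [gt_mem_nhds hx] with y hy
      exact Real.smoothTransition.zero_of_nonpos hy.le
    rw [this.deriv_eq, deriv_const]
  · have : Real.smoothTransition =ᶠ[nhds x] fun _ => 1 := by
      filter_upwards [lt_mem_nhds hx] with y hy
      exact Real.smoothTransition.one_of_one_le hy.le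
    rw [this.deriv_eq, deriv_const]

lemma mem_of_convex_one {Ω : Set (Rn 1)} (hc : Convex ℝ Ω) {s : ℝ} (hs : s ≠ 0) {x y z : Rn 1}
    (hx : x ∈ Ω) (hz : z ∈ Ω) (hxy : s * x 0 ≤ s * y 0) (hyz : s * y 0 ≤ s * z 0) : y ∈ Ω := by
  let ℓ : Rn 1 →ₗ[ℝ] ℝ := s • (EuclideanSpace.proj (0 : Fin 1) : Rn 1 →L[ℝ] ℝ).toLinearMap
  have h : s * y 0 ∈ ℓ '' Ω :=
    ((hc.linear_image ℓ).ordConnected).out ⟨x, hx, rfl⟩ ⟨z, hz, rfl⟩ ⟨hxy, hyz⟩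
  obtain ⟨w, hw, hwy⟩ := h
  have h0 : w 0 = y 0 := mul_left_cancel₀ hs hwy
  have : w = y := by
    ext i
    rw [Subsingleton.elim i 0, h0]
  exact this ▸ hw

/-- `G` is the set of points not beyond `Ω` in the direction given by the sign of `s`, a lower
domain. The only boundary that `Ω` can have in `G` lies behind `c`, where the cutoff vanishes. -/
lemma sobolevBoundOn_half {Ω : Set (Rn 1)} (hΩ : IsOpen Ω) (hc : Convex ℝ Ω) {c : Rn 1}
    (hcΩ : c ∈ Ω) {s : ℝ} (hs : s ≠ 0) : SobolevBoundOn Ω {x | s * c 0 ≤ s * x 0} := by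
  obtain ⟨L, hL⟩ := exists_norm_deriv_smoothTransition_le
  have hL0 : 0 ≤ L := (norm_nonneg _).trans (hL 0)
  let ℓ : Rn 1 →L[ℝ] ℝ := s • (EuclideanSpace.proj (0 : Fin 1) : Rn 1 →L[ℝ] ℝ)
  have hℓ : ∀ x, ℓ x = s * x 0 := fun x => rfl
  let v : Rn 1 := EuclideanSpace.single 0 s⁻¹
  have hv : ∀ t : ℝ, s * (c + t • v) 0 = s * c 0 + t := fun t => by
    simp [v]
    field_simp
  obtain ⟨δ, hδ, hδΩ⟩ : ∃ δ : ℝ, 0 < δ ∧ c - δ • v ∈ Ω := by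
    have hcont : Filter.Tendsto (fun δ : ℝ => c - δ • v) (nhds 0) (nhds c) := by
      have : Continuous fun δ : ℝ => c - δ • v := by fun_prop
      simpa using this.tendsto 0
    have hev : ∀ᶠ δ in nhdsWithin (0 : ℝ) (Ioi 0), c - δ • v ∈ Ω :=
      (hcont.mono_left nhdsWithin_le_nhds).eventually (hΩ.mem_nhds hcΩ)
    obtain ⟨δ, h1, h2⟩ := (hev.and
      self_mem_nhdsWithin).exists
    exact ⟨δ, h2, h1⟩
  have hvδ : s * (c - δ • v) 0 = s * c 0 - δ := by
    have := hv (-δ)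
    rwa [neg_smul, ← sub_eq_add_neg, ← sub_eq_add_neg] at this
  let G : Set (Rn 1) := {x | ∃ y ∈ Ω, s * x 0 ≤ s * y 0}
  let e : (Fin 1 → ℝ) ≃L[ℝ] Rn 1 := (EuclideanSpace.equiv (Fin 1) ℝ).symm.trans
    (ContinuousLinearEquiv.smulLeft (Units.mk0 s⁻¹ (inv_ne_zero hs)))
  have he : ∀ a, s * (e a) 0 = a 0 := fun a => mul_inv_cancel_left₀ hs (a 0)
  have hGo : IsOpen G := by
    -- `G` is defined by a non-strict inequality; openness of `Ω` absorbs the case of equality.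
    have : G = Ω ∪ ⋃ y ∈ Ω, {x | ℓ x < ℓ y} := by
      ext x
      constructor
      · rintro ⟨y, hy, hxy⟩
        rcases hxy.lt_or_eq with h | h
        · exact Or.inr (mem_biUnion hy h)
        · exact Or.inl (mem_of_convex_one hc hs hy hy h.ge h.le)
      · rintro (h | h)
        · exact ⟨x, h, le_rfl⟩
        · obtain ⟨y, hy, hxy⟩ := mem_iUnion₂.1 h
          exact ⟨y, hy, le_of_lt hxy⟩
    rw [this]
    exact hΩ.union (isOpen_biUnion fun y _ => isOpen_lt ℓ.continuous continuous_const)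
  have hG : IsLowerDomain G e := by
    refine ⟨hGo, fun a b hba ⟨y, hy, h⟩ => ⟨y, hy, le_trans ?_ h⟩⟩
    rw [he, he]
    exact hba 0
  -- Equals `0` where `ℓ x ≤ ℓ c - δ` and `1` where `ℓ x ≥ ℓ c`. A point of its support that lies in
  -- `G` is between `c - δ v ∈ Ω` and a point of `Ω`, hence in `Ω`.
  let χ : Rn 1 → ℝ := fun x => Real.smoothTransition ((ℓ x - ℓ c) / δ + 1)
  have hin : ∀ x, HasFDerivAt (fun x => (ℓ x - ℓ c) / δ + 1) (δ⁻¹ • ℓ) x := fun x => by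
    simpa [div_eq_inv_mul] using ((ℓ.hasFDerivAt (x := x)).sub_const (ℓ c)).const_mul δ⁻¹
  have hχ : ContDiff ℝ ∞ χ := Real.smoothTransition.contDiff.comp (by fun_prop)
  have hM : (0 : ℝ) ≤ 1 + L * ‖δ⁻¹ • ℓ‖ := by positivity
  refine hG.sobolevBoundOn (χ := χ) (M := ⟨1 + L * ‖δ⁻¹ • ℓ‖, hM⟩) le_rfl (by norm_num) hΩ hχ
    (fun x => ?_) (fun x => ?_) ?_ (measurableSet_le measurable_const ℓ.continuous.measurable)
    (fun x hx => ⟨x, hx.2, le_rfl⟩) (fun x hx _ => ?_)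
  · rw [Real.norm_of_nonneg (Real.smoothTransition.nonneg _)]
    exact (Real.smoothTransition.le_one _).trans (le_add_of_nonneg_right (by positivity))
  · have hd : HasDerivAt Real.smoothTransition
        (deriv Real.smoothTransition ((ℓ x - ℓ c) / δ + 1)) ((ℓ x - ℓ c) / δ + 1) :=
      ((Real.smoothTransition.contDiff (n := 1)).differentiable one_ne_zero _).hasDerivAt
    have := hd.comp_hasFDerivAt x (hin x)
    rw [show fderiv ℝ χ x = _ from this.fderiv, norm_smul]
    exact (mul_le_mul_of_nonneg_right (hL _) (norm_nonneg _)).trans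
      (le_add_of_nonneg_left zero_le_one)
  · have hsupp : tsupport χ ⊆ {x | ℓ c - δ ≤ ℓ x} := by
      refine closure_minimal (fun x hx => ?_) (isClosed_le continuous_const ℓ.continuous)
      by_contra hlt
      refine hx (Real.smoothTransition.zero_of_nonpos ?_)
      have : (ℓ x - ℓ c) / δ < -1 := by
        rw [div_lt_iff₀ hδ]
        linarith [not_le.1 (show ¬ ℓ c - δ ≤ ℓ x from hlt)]
      linarith
    refine eq_empty_of_forall_notMem fun x ⟨⟨h1, y, hy, h2⟩, h3⟩ => ?_
    rw [hΩ.frontier_eq] at h3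
    exact h3.2 (mem_of_convex_one hc hs hδΩ hy (hvδ.trans_le (hsupp h1)) h2)
  · refine Real.smoothTransition.one_of_one_le ?_
    exact le_add_of_nonneg_left (div_nonneg (sub_nonneg.2 hx) hδ.le)

theorem hasSobolevBound_of_convex_one {Ω : Set (Rn 1)} (hΩ : IsOpen Ω) (hne : Ω.Nonempty)
    (hc : Convex ℝ Ω) (W : Submodule ℂ (L2 Ω)) : HasSobolevBound Ω W := by
  obtain ⟨c, hcΩ⟩ := hne
  have hcont : Continuous fun x : Rn 1 => x 0 := by fun_prop
  refine SobolevBoundOn.hasSobolevBound hΩ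
    (A := {x | 1 * c 0 ≤ 1 * x 0} ∪ {x | -1 * c 0 ≤ -1 * x 0})
    (SobolevBoundOn.union hΩ (measurableSet_le measurable_const (by fun_prop))
      (measurableSet_le measurable_const (by fun_prop))
      (sobolevBoundOn_half hΩ hc hcΩ one_ne_zero)
      (sobolevBoundOn_half hΩ hc hcΩ (neg_ne_zero.2 one_ne_zero))) (fun x _ => ?_) W
  rcases le_total (c 0) (x 0) with h | h
  · exact Or.inl (by simpa using h)
  · exact Or.inr (by simpa using h)

end Interval

/-! ### Strongly Lipschitz domains -/

section Lipschitz

variable {n : ℕ} {Ω : Set (Rn n)}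

/-- The nonnegative orthant of suitable coordinates is contained in the cone of all directions which
point above the graph of every `K`-Lipschitz function. -/
lemma exists_coordinates_cone {ν : Rn n} (hν : ‖ν‖ = 1) (K : ℝ≥0) :
    ∃ e : (Fin n → ℝ) ≃L[ℝ] Rn n, ∀ y, 0 ≤ y →
      K * ‖(ℝ ∙ ν)ᗮ.orthogonalProjectionOnto (e y)‖ ≤ ⟪ν, e y⟫_ℝ := by
  -- The coordinates will be `y ↦ y + Λ (∑ y_i) ν`. The map is injective if `1 + Λ ∑ ν_i ≠ 0`, and
  -- at least one of `K + 1`, `K + 2` satisfies this.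
  obtain ⟨Λ, hΛ, hΛν⟩ : ∃ Λ : ℝ, K + 1 ≤ Λ ∧ 1 + Λ * ∑ i, ν i ≠ 0 := by
    by_cases h : 1 + (K + 1 : ℝ) * ∑ i, ν i = 0
    · refine ⟨K + 2, by linarith, fun h' => ?_⟩
      have : ∑ i, ν i = 0 := by linear_combination h' - h
      rw [this] at h
      norm_num at h
    · exact ⟨K + 1, le_rfl, h⟩
  let T : (Fin n → ℝ) →ₗ[ℝ] Rn n :=
    (EuclideanSpace.equiv (Fin n) ℝ).symm.toLinearMap +
      (Λ • ∑ i, LinearMap.proj i : (Fin n → ℝ) →ₗ[ℝ] ℝ).smulRight ν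
  have hT : ∀ y, T y = WithLp.toLp 2 y + (Λ * ∑ i, y i) • ν := fun y => by
    simp [T]
  have hinj : Function.Injective T := by
    rw [← LinearMap.ker_eq_bot, LinearMap.ker_eq_bot']
    intro y hy
    rw [hT] at hy
    have hyi : ∀ i, y i + (Λ * ∑ i, y i) * ν i = 0 := fun i => by
      simpa using congrArg (fun w : Rn n => w i) hy
    have hsum : (1 + Λ * ∑ i, ν i) * ∑ i, y i = 0 := by
      have := Finset.sum_congr (rfl : (Finset.univ : Finset (Fin n)) = _) fun i _ => hyi i
      rw [Finset.sum_add_distrib, ← Finset.mul_sum, Finset.sum_const_zero] at this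
      linear_combination this
    have h0 := (mul_eq_zero.1 hsum).resolve_left hΛν
    ext i
    simpa [h0] using hyi i
  let e : (Fin n → ℝ) ≃L[ℝ] Rn n :=
    (LinearEquiv.ofInjectiveOfFinrankEq T hinj (by simp)).toContinuousLinearEquiv
  refine ⟨e, fun y hy => ?_⟩
  have he : e y = WithLp.toLp 2 y + (Λ * ∑ i, y i) • ν := hT y
  -- For `y ≥ 0` the Euclidean norm is at most `S = ∑ y_i`. So the part of `e y` orthogonal to `ν`
  -- has norm at most `S`, while the part along `ν` is at least `(Λ - 1) S ≥ K S`.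
  have hS : ‖(WithLp.toLp 2 y : Rn n)‖ ≤ ∑ i, y i := by
    have h1 : (WithLp.toLp 2 y : Rn n) = ∑ i, EuclideanSpace.single i (y i) := by
      ext j
      simp [Pi.single_apply]
    rw [h1]
    refine (norm_sum_le _ _).trans (Finset.sum_le_sum fun i _ => ?_)
    rw [PiLp.norm_single, Real.norm_of_nonneg (hy i)]
  have hS0 : 0 ≤ ∑ i, y i := (norm_nonneg _).trans hS
  have hP : (ℝ ∙ ν)ᗮ.orthogonalProjectionOnto (e y)
      = (ℝ ∙ ν)ᗮ.orthogonalProjectionOnto (WithLp.toLp 2 y) := by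
    rw [he, map_add, map_smul,
      Submodule.orthogonalProjectionOnto_orthogonalComplement_singleton_eq_zero,
      smul_zero, add_zero]
  have hin : ⟪ν, e y⟫_ℝ = ⟪ν, WithLp.toLp 2 y⟫_ℝ + Λ * ∑ i, y i := by
    rw [he, inner_add_right, inner_smul_right, real_inner_self_eq_norm_sq, hν]
    ring
  have h1 : ‖(ℝ ∙ ν)ᗮ.orthogonalProjectionOnto (e y)‖ ≤ ∑ i, y i := by
    rw [hP]
    exact (Submodule.norm_orthogonalProjectionOnto_apply_le _ _).trans hS
  have h2 : -(∑ i, y i) ≤ ⟪ν, WithLp.toLp 2 y⟫_ℝ := by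
    refine (neg_le_neg ?_).trans (neg_abs_le _)
    refine (abs_real_inner_le_norm _ _).trans ?_
    rwa [hν, one_mul]
  rw [hin]
  nlinarith [mul_le_mul_of_nonneg_left h1 K.2, mul_le_mul_of_nonneg_right hΛ hS0]

variable {ν : Rn n} {ψ : (ℝ ∙ ν)ᗮ → ℝ} {K : ℝ≥0}

/-- The part strictly below the graph of `ψ`. -/
def belowGraph (ν : Rn n) (ψ : (ℝ ∙ ν)ᗮ → ℝ) : Set (Rn n) :=
  {x | ⟪ν, x⟫_ℝ < ψ ((ℝ ∙ ν)ᗮ.orthogonalProjectionOnto x)}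

/-- A step `w` in the cone raises `ψ` by at most `K ‖P w‖` and the height by at least as much. Hence
the region below the graph is stable under subtracting the cone, and the region above under adding
it. -/
lemma LipschitzWith.sub_inner_le (hψ : LipschitzWith K ψ) {x w : Rn n}
    (hw : K * ‖(ℝ ∙ ν)ᗮ.orthogonalProjectionOnto w‖ ≤ ⟪ν, w⟫_ℝ) :
    ψ ((ℝ ∙ ν)ᗮ.orthogonalProjectionOnto (x + w)) - ⟪ν, x + w⟫_ℝ
      ≤ ψ ((ℝ ∙ ν)ᗮ.orthogonalProjectionOnto x) - ⟪ν, x⟫_ℝ := by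
  have h := (le_abs_self _).trans (hψ.dist_le_mul ((ℝ ∙ ν)ᗮ.orthogonalProjectionOnto (x + w))
    ((ℝ ∙ ν)ᗮ.orthogonalProjectionOnto x))
  rw [dist_eq_norm, map_add, add_sub_cancel_left] at h
  rw [inner_add_right, map_add]
  linarith

lemma isLowerDomain_belowGraph (hψ : LipschitzWith K ψ) {e : (Fin n → ℝ) ≃L[ℝ] Rn n}
    (he : ∀ y, 0 ≤ y → K * ‖(ℝ ∙ ν)ᗮ.orthogonalProjectionOnto (e y)‖ ≤ ⟪ν, e y⟫_ℝ) :
    IsLowerDomain (belowGraph ν ψ) e := by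
  refine ⟨isOpen_lt (by fun_prop) (hψ.continuous.comp (by fun_prop)), fun a b hba ha => ?_⟩
  have h := hψ.sub_inner_le (x := e b) (he (a - b) (sub_nonneg.2 hba))
  rw [← map_add, add_sub_cancel] at h
  have ha' : ⟪ν, e a⟫_ℝ < ψ ((ℝ ∙ ν)ᗮ.orthogonalProjectionOnto (e a)) := ha
  change ⟪ν, e b⟫_ℝ < ψ ((ℝ ∙ ν)ᗮ.orthogonalProjectionOnto (e b))
  linarith

/-- The region above the graph is an upper set in the coordinates `e`, so the coordinates are
reflected. -/
lemma isLowerDomain_aboveGraph (hψ : LipschitzWith K ψ) {e : (Fin n → ℝ) ≃L[ℝ] Rn n}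
    (he : ∀ y, 0 ≤ y → K * ‖(ℝ ∙ ν)ᗮ.orthogonalProjectionOnto (e y)‖ ≤ ⟪ν, e y⟫_ℝ) :
    IsLowerDomain (aboveGraph ν ψ) (e.trans (ContinuousLinearEquiv.neg ℝ)) := by
  refine ⟨isOpen_lt (hψ.continuous.comp (by fun_prop)) (by fun_prop), fun a b hba ha => ?_⟩
  have h := hψ.sub_inner_le (x := -e a) (he (a - b) (sub_nonneg.2 hba))
  have hab : -e a + e (a - b) = -e b := by rw [map_sub]; abel
  rw [hab] at h
  have ha' : ψ ((ℝ ∙ ν)ᗮ.orthogonalProjectionOnto (-e a)) < ⟪ν, -e a⟫_ℝ := ha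
  change ψ ((ℝ ∙ ν)ᗮ.orthogonalProjectionOnto (-e b)) < ⟪ν, -e b⟫_ℝ
  linarith

/-- The translates of the graph by `ν / (k + 1)` are pairwise disjoint, and these infinitely many
translation vectors are bounded, which forces measure zero. -/
lemma volume_graph (hν : ‖ν‖ = 1) (hψ : LipschitzWith K ψ) :
    volume {x | ψ ((ℝ ∙ ν)ᗮ.orthogonalProjectionOnto x) = ⟪ν, x⟫_ℝ} = 0 := by
  have hcl : IsClosed {x | ψ ((ℝ ∙ ν)ᗮ.orthogonalProjectionOnto x) = ⟪ν, x⟫_ℝ} :=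
    isClosed_eq (hψ.continuous.comp (by fun_prop)) (by fun_prop)
  refine Measure.addHaar_eq_zero_of_disjoint_translates volume
    (u := fun k : ℕ => ((1 : ℝ) / (k + 1)) • ν) ?_ (fun k l hkl => ?_) hcl.measurableSet
  · have := (tendsto_one_div_add_atTop_nhds_zero_nat (𝕜 := ℝ)).smul_const ν
    exact Metric.isBounded_range_of_tendsto _ this
  · rw [Function.onFun, disjoint_left]
    rintro x hx hx'
    rw [singleton_add, mem_image] at hx hx'
    obtain ⟨y, hy, rfl⟩ := hx
    obtain ⟨z, hz, hyz⟩ := hx'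
    have hP : ∀ (c : ℝ) (w : Rn n), (ℝ ∙ ν)ᗮ.orthogonalProjectionOnto (c • ν + w)
        = (ℝ ∙ ν)ᗮ.orthogonalProjectionOnto w := fun c w => by
      rw [map_add, map_smul,
        Submodule.orthogonalProjectionOnto_orthogonalComplement_singleton_eq_zero, smul_zero,
        zero_add]
    have h1 := congrArg (fun w => (ℝ ∙ ν)ᗮ.orthogonalProjectionOnto w) hyz
    have h2 := congrArg (fun w => ⟪ν, w⟫_ℝ) hyz
    simp only [hP] at h1
    simp only [inner_add_right, inner_smul_right, real_inner_self_eq_norm_sq, hν] at h2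
    have hy' : ψ ((ℝ ∙ ν)ᗮ.orthogonalProjectionOnto y) = ⟪ν, y⟫_ℝ := hy
    have hz' : ψ ((ℝ ∙ ν)ᗮ.orthogonalProjectionOnto z) = ⟪ν, z⟫_ℝ := hz
    rw [← hy', ← hz', h1] at h2
    have h3 : (1 : ℝ) / (l + 1) = 1 / (k + 1) := by linarith
    rw [div_eq_div_iff (by positivity) (by positivity)] at h3
    refine hkl ?_
    have : (k : ℝ) = l := by linarith
    exact_mod_cast this

/-- `Ω` coincides in `U` with the region above the graph of a Lipschitz function. -/
def IsGraphPatch (Ω U : Set (Rn n)) : Prop :=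
  ∃ (ν : Rn n) (ψ : (ℝ ∙ ν)ᗮ → ℝ) (K : ℝ≥0),
    ‖ν‖ = 1 ∧ LipschitzWith K ψ ∧ Ω ∩ U = aboveGraph ν ψ ∩ U

/-- Lets regions free of boundary points be treated as patches: for `U = ∅` the requirement on a
cutoff becomes that its support avoids `∂Ω`. -/
lemma isGraphPatch_empty (hn : 1 ≤ n) (Ω : Set (Rn n)) : IsGraphPatch Ω ∅ :=
  ⟨EuclideanSpace.single ⟨0, hn⟩ 1, fun _ => 0, 0, by simp, LipschitzWith.const 0, by simp⟩

/-- Within `U`, neither side of the graph contains boundary points of `Ω`: the upper side lies in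
the open set `Ω`, the lower one misses it. So `χ` is an admissible cutoff for both lower domains.
Outside `U` the graph may be unrelated to `Ω`, because only `tsupport χ ∩ ∂Ω` has to lie in `U`. -/
lemma IsGraphPatch.sobolevBoundOn (hn : 1 ≤ n) (hn2 : n ≠ 2) (hΩ : IsOpen Ω) {U : Set (Rn n)}
    (hU : IsOpen U) (h : IsGraphPatch Ω U) {χ : Rn n → ℝ} {M : ℝ≥0} (hχ : ContDiff ℝ ∞ χ)
    (h1 : ∀ x, ‖χ x‖ ≤ M) (h2 : ∀ x, ‖fderiv ℝ χ x‖ ≤ M)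
    (hsupp : tsupport χ ∩ frontier Ω ⊆ U) {A : Set (Rn n)} (hA : MeasurableSet A)
    (hA1 : ∀ x ∈ A, χ x = 1) : SobolevBoundOn Ω A := by
  obtain ⟨ν, ψ, K, hν, hψ, hΩU⟩ := h
  obtain ⟨e, he⟩ := exists_coordinates_cone hν K
  have ha := isLowerDomain_aboveGraph hψ he
  have hb := isLowerDomain_belowGraph hψ he
  have hfr : ∀ x ∈ frontier Ω, x ∉ Ω := fun x hx => by
    rw [hΩ.frontier_eq] at hx
    exact hx.2
  have da : tsupport χ ∩ aboveGraph ν ψ ∩ frontier Ω = ∅ := by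
    refine eq_empty_of_forall_notMem fun x ⟨⟨hx1, hx2⟩, hx3⟩ => hfr x hx3 ?_
    exact (hΩU.ge ⟨hx2, hsupp ⟨hx1, hx3⟩⟩).1
  have db : tsupport χ ∩ belowGraph ν ψ ∩ frontier Ω = ∅ := by
    refine eq_empty_of_forall_notMem fun x ⟨⟨hx1, hx2⟩, hx3⟩ => ?_
    obtain ⟨y, ⟨hy1, hy2⟩, hy3⟩ := mem_closure_iff.1 (frontier_subset_closure hx3)
      (belowGraph ν ψ ∩ U) (hb.isOpen.inter hU) ⟨hx2, hsupp ⟨hx1, hx3⟩⟩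
    have hy4 : ψ ((ℝ ∙ ν)ᗮ.orthogonalProjectionOnto y) < ⟪ν, y⟫_ℝ := (hΩU.le ⟨hy3, hy2⟩).1
    exact lt_asymm hy4 hy1
  have hma := ha.isOpen.measurableSet
  have hmb := hb.isOpen.measurableSet
  have ba := ha.sobolevBoundOn hn hn2 hΩ hχ h1 h2 da (hA.inter hma) (fun x hx => hx.1.2)
    (fun x hx _ => hA1 x hx.1)
  have bb := hb.sobolevBoundOn hn hn2 hΩ hχ h1 h2 db (hA.inter hmb) (fun x hx => hx.1.2)
    (fun x hx _ => hA1 x hx.1)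
  have hnull : volume (A \ (aboveGraph ν ψ ∪ belowGraph ν ψ)) = 0 := by
    refine measure_mono_null (fun x hx => ?_) (volume_graph hν hψ)
    have h3 : ¬ ψ ((ℝ ∙ ν)ᗮ.orthogonalProjectionOnto x) < ⟪ν, x⟫_ℝ := fun h => hx.2 (Or.inl h)
    have h4 : ¬ ⟪ν, x⟫_ℝ < ψ ((ℝ ∙ ν)ᗮ.orthogonalProjectionOnto x) := fun h => hx.2 (Or.inr h)
    exact le_antisymm (not_lt.1 h4) (not_lt.1 h3)
  have := ((ba.union hΩ (hA.inter hma) (hA.inter hmb) bb).union hΩ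
    ((hA.inter hma).union (hA.inter hmb)) (hA.diff (hma.union hmb)) (.of_null hnull))
  rwa [← inter_union_distrib_left, inter_union_sdiff] at this

/-! ### From graph patches to the whole domain -/

lemma exists_bump_bound {x : Rn n} (b : ContDiffBump x) :
    ∃ M : ℝ≥0, (∀ y, ‖b y‖ ≤ M) ∧ (∀ y, ‖fderiv ℝ b y‖ ≤ M) ∧ 1 ≤ M := by
  have hbs : ContDiff ℝ ∞ b := b.contDiff
  obtain ⟨L, hL⟩ := (hbs.continuous_fderiv (by simp)).bounded_above_of_compact_support
    (b.hasCompactSupport.fderiv (𝕜 := ℝ))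
  refine ⟨1 + L.toNNReal, fun y => ?_, fun y => ?_, le_self_add⟩
  · rw [Real.norm_of_nonneg b.nonneg]
    exact b.le_one.trans (by simp)
  · refine (hL y).trans ((Real.le_coe_toNNReal L).trans ?_)
    simp

lemma IsGraphPatch.exists_sobolevBoundOn_closedBall (hn : 1 ≤ n) (hn2 : n ≠ 2) (hΩ : IsOpen Ω)
    {U : Set (Rn n)} (hU : IsOpen U) (h : IsGraphPatch Ω U) {x : Rn n} {O : Set (Rn n)}
    (hO : O ∈ nhds x) (hOU : O ∩ frontier Ω ⊆ U) :
    ∃ r : ℝ, 0 < r ∧ SobolevBoundOn Ω (Metric.closedBall x r) := by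
  obtain ⟨r, hr, hrO⟩ := Metric.nhds_basis_closedBall.mem_iff.1 hO
  let b : ContDiffBump x := ⟨r / 2, r, half_pos hr, half_lt_self hr⟩
  obtain ⟨M, hM1, hM2, -⟩ := exists_bump_bound b
  refine ⟨r / 2, half_pos hr, h.sobolevBoundOn hn hn2 hΩ hU b.contDiff hM1 hM2 ?_
    Metric.isClosed_closedBall.measurableSet fun y hy => b.one_of_mem_closedBall hy⟩
  rw [b.tsupport_eq]
  exact (inter_subset_inter_left _ hrO).trans hOU

/-- The cutoff is one minus a bump that equals `1` on a ball containing `∂Ω \ U`. Its support is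
unbounded but meets `∂Ω` only inside `U`. -/
lemma IsGraphPatch.exists_sobolevBoundOn_compl_ball (hn : 1 ≤ n) (hn2 : n ≠ 2) (hΩ : IsOpen Ω)
    {U : Set (Rn n)} (hU : IsOpen U) (h : IsGraphPatch Ω U)
    (hb : Bornology.IsBounded (frontier Ω \ U)) :
    ∃ r : ℝ, SobolevBoundOn Ω (Metric.ball 0 r)ᶜ := by
  obtain ⟨r, hr, hrU⟩ := hb.subset_ball_lt 0 0
  let b : ContDiffBump (0 : Rn n) := ⟨r, r + 1, hr, lt_add_one r⟩
  obtain ⟨M, hM1, hM2, hM3⟩ := exists_bump_bound b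
  refine ⟨r + 1, h.sobolevBoundOn (χ := fun x => 1 - b x) (M := M) hn hn2 hΩ hU
    (contDiff_const.sub b.contDiff) (fun x => ?_) (fun x => ?_) ?_
    Metric.isOpen_ball.measurableSet.compl fun x hx => ?_⟩
  · rw [Real.norm_of_nonneg (sub_nonneg.2 b.le_one)]
    exact (sub_le_self _ b.nonneg).trans hM3
  · rw [fderiv_const_sub, norm_neg]
    exact hM2 x
  · intro x ⟨hx1, hx2⟩
    by_contra hxU
    have hxb := hrU ⟨hx2, hxU⟩
    refine notMem_tsupport_iff_eventuallyEq.2 ?_ hx1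
    filter_upwards [b.eventuallyEq_one_of_mem_ball hxb] with y hy
    rw [hy, Pi.one_apply, sub_self, Pi.zero_apply]
  · rw [b.zero_of_le_dist (not_lt.1 hx), sub_zero]

/-- Near infinity, `∂Ω` lies in the one patch with unbounded boundary part, if there is one;
otherwise `∂Ω` is bounded and the empty patch serves. The remaining ball is compact and is covered
by finitely many local estimates. -/
theorem IsStronglyLipschitz.hasSobolevBound (hn : 1 ≤ n) (hn2 : n ≠ 2)
    (h : IsStronglyLipschitz Ω) (W : Submodule ℂ (L2 Ω)) : HasSobolevBound Ω W := by
  obtain ⟨hΩ, -, N, U, hUo, hcov, hpatch, hunb⟩ := h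
  have hpatch' : ∀ j, IsGraphPatch Ω (U j) := hpatch
  have hloc : ∀ x, ∃ r : ℝ, 0 < r ∧ SobolevBoundOn Ω (Metric.closedBall x r) := by
    intro x
    by_cases hx : x ∈ frontier Ω
    · obtain ⟨j, hj⟩ := mem_iUnion.1 (hcov hx)
      exact (hpatch' j).exists_sobolevBoundOn_closedBall hn hn2 hΩ (hUo j)
        ((hUo j).mem_nhds hj) inter_subset_left
    · exact (isGraphPatch_empty hn Ω).exists_sobolevBoundOn_closedBall hn hn2 hΩ isOpen_empty
        (isClosed_frontier.isOpen_compl.mem_nhds hx) (by simp)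
  have hout : ∃ r : ℝ, SobolevBoundOn Ω (Metric.ball 0 r)ᶜ := by
    by_cases hj : ∃ j, ¬ Bornology.IsBounded (frontier Ω ∩ U j)
    · obtain ⟨j, hj⟩ := hj
      refine (hpatch' j).exists_sobolevBoundOn_compl_ball hn hn2 hΩ (hUo j) ?_
      refine Bornology.IsBounded.subset (t := ⋃ k ∈ {k | k ≠ j}, frontier Ω ∩ U k)
        ((Bornology.isBounded_biUnion (toFinite {k | k ≠ j})).2 fun k hk => ?_) fun x hx => ?_
      · by_contra hk'
        exact hk (hunb k j hk' hj)
      · obtain ⟨k, hk⟩ := mem_iUnion.1 (hcov hx.1)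
        exact mem_biUnion (x := k) (fun hkj => hx.2 (hkj ▸ hk)) ⟨hx.1, hk⟩
    · push Not at hj
      refine (isGraphPatch_empty hn Ω).exists_sobolevBoundOn_compl_ball hn hn2 hΩ isOpen_empty ?_
      refine (Bornology.isBounded_iUnion.2 hj).subset fun x hx => ?_
      rw [← inter_iUnion]
      exact ⟨hx.1, hcov hx.1⟩
  choose r hr0 hr using hloc
  obtain ⟨R, hR⟩ := hout
  obtain ⟨t, -, ht⟩ := (isCompact_closedBall (0 : Rn n) R).elim_nhds_subcover
    (fun x => Metric.closedBall x (r x)) fun x _ => Metric.closedBall_mem_nhds x (hr0 x)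
  have hmt : ∀ x ∈ t, MeasurableSet (Metric.closedBall x (r x)) := fun x _ =>
    Metric.isClosed_closedBall.measurableSet
  refine SobolevBoundOn.hasSobolevBound hΩ (SobolevBoundOn.union hΩ
    (Finset.measurableSet_biUnion t hmt) Metric.isOpen_ball.measurableSet.compl
    (.biUnion hΩ t _ hmt fun x _ => hr x) hR) (fun x _ => ?_) W
  by_cases hx : x ∈ Metric.ball (0 : Rn n) R
  · exact Or.inl (ht (Metric.ball_subset_closedBall hx))
  · exact Or.inr hx

end Lipschitz

end

/-! ### The three boundary conditions -/

theorem theorem3p14 (n : ℕ) (hn : 1 ≤ n) (hn2 : n ≠ 2) (Ω : Set (Rn n)) (hΩ : IsOpen Ω)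
    (hne : Ω.Nonempty) (V : Rn n → ℂ) (hVm : AEStronglyMeasurable V (vol Ω))
    (hV : IsCriticalPotential Ω V) :
    -- Dirichlet boundary conditions
    (LaplacianFormBound Ω hVm (W12zero Ω) (sobolevClosure_le Ω _) ∧
      EllipticFormBound Ω hVm (W12zero Ω) (sobolevClosure_le Ω _)) ∧
    -- Neumann boundary conditions on an open interval
    (n = 1 → Convex ℝ Ω →
      LaplacianFormBound Ω hVm (W12 Ω) le_rfl ∧ EllipticFormBound Ω hVm (W12 Ω) le_rfl) ∧
    -- mixed boundary conditions on a strongly Lipschitz domain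
    (3 ≤ n → IsStronglyLipschitz Ω →
      ∀ P : Set (Rn n), (∃ O : Set (Rn n), IsOpen O ∧ P = frontier Ω ∩ O) →
        LaplacianFormBound Ω hVm (W12mixed Ω P) (sobolevClosure_le Ω _) ∧
          EllipticFormBound Ω hVm (W12mixed Ω P) (sobolevClosure_le Ω _)) := by
  refine ⟨?_, ?_, ?_⟩
  · exact (hasSobolevBound_W12zero hn hn2 hΩ).formBounds hn hn2 hΩ hVm hV _
      (isClosed_restrictedGradGraph_sobolevClosure hΩ _)
      (le_sobolevClosure (testRestrictions_le_W12 hΩ Ω))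
  · rintro rfl hc
    exact (hasSobolevBound_of_convex_one hΩ hne hc _).formBounds hn hn2 hΩ hVm hV _
      (isClosed_restrictedGradGraph_W12 hΩ) (testRestrictions_le_W12 hΩ Ω)
  · rintro - hL P -
    refine (hL.hasSobolevBound hn hn2 _).formBounds hn hn2 hΩ hVm hV _
      (isClosed_restrictedGradGraph_sobolevClosure hΩ _)
      ((testRestrictions_mono fun x hx hxP => ?_).trans
        (le_sobolevClosure (testRestrictions_le_W12 hΩ _)))
    -- An open set is disjoint from its boundary, so `C_0^∞(Ω)` belongs to the functions defining
    -- the mixed space for every `Π`.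
    rw [hΩ.frontier_eq] at hxP
    exact hxP.1.2 hx
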